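/- **Setting.** Let $n\ge 1$ and let $\mathbb A=\mathbb R^{n+1}/\mathbb R(1,\dots,1)$ be the standard apartment of the affine building of type $A_n$. Its positive roots are $\alpha=\epsilon_i-\epsilon_j$ $(i<j)$, acting by $\langle x,\alpha\rangle=x_i-x_j$, with coroots $\alpha^\vee=\epsilon_i-\epsilon_j$; its hyperplanes are $H_{(\alpha,m)}=\{x:\langle x,\alpha\rangle=m\}$, $m\in\mathbb Z$. Let $s_{(\alpha,m)}$ be the reflection at $H_{(\alpha,m)}$, let the affine Weyl group $W^a$ be generated by all $s_{(\alpha,m)}$ and the Weyl group $W$ by all $s_{(\alpha,0)}$. Put $\omega_i=\epsilon_1+\dots+\epsilon_i$ $(1\le i\le n)$. *Faces and sectors.* Faces are the non-empty sets $\bigcap_{(\alpha,m)}H^{e(\alpha,m)}_{(\alpha,m)}$, where each $H^{e}_{(\alpha,m)}$ is the hyperplane or one of its two closed half-spaces; vertices and edges are the faces of dimension $0$ and $1$. A vertex is special if for every root $\alpha$ it lies on some $H_{(\alpha,m)}$. The open face $F^\circ$ of a face $F$ is the set of points of $F$ lying only on hyperplanes that contain $F$. The type of a face $F$ is the set of walls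 of the fundamental alcove $\Delta_f=\{x: 0\le\langle x,\alpha\rangle\le 1\ \forall\alpha>0\}$ that contain the unique face of $\Delta_f$ conjugate to $F$ under $W^a$. Chambers are the sets $w(C^+)$, $w\in W$, where $C^+=\{x:\langle x,\alpha\rangle\ge0\ \forall\alpha>0\}$; sectors at a vertex $V$ are the sets $S=V+C$, $C$ a chamber, and then $-S:=V-C$. Two sectors are equivalent if their intersection is a sector; classes of sectors correspond to elements $w\in W$ (via $w(C^+)$) and are ordered by the Bruhat order of $W$. *Galleries.* A combinatorial one-skeleton gallery is a sequence $\delta=(V_0\subset E_0\supset V_1\subset\dots\subset E_r\supset V_{r+1})$ of vertices $V_k$ and edges $E_k$ with $V_0,V_{r+1}$ special; the gallery $(V_0)$ without edges is allowed. Its type is the sequence of the types of its faces. For $\lambda=\sum_i\lambda_i\omega_i$ with $\lambda_i\in\mathbb Z_{\ge0}$ let $\delta_\lambda$ be the concatenation, by translation, of $\lambda_1$ copies of $(0\subset[0,\omega_1]\ni\omega_1)$, followed by $\lambda_2$ copies of $(0\subset[0,\omega_2]\ni\omega_2)$, and so on up to $\omega_n$; $\delta$ has type $\lambda$ if it has the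 same type as $\delta_\lambda$. A 2-step gallery $(E\supset V\subset F)$ is minimal if there is a sector $S$ at $V$ with $F\subset S$ and $E\subset -S$. It is obtained from $(E\supset V\subset F')$ by a positive folding if there is $(\alpha,m)$ with $V\in H_{(\alpha,m)}$, $s_{(\alpha,m)}(F')=F$, and $V-C^+$ and $F'$ both contained in one closed half-space of $H_{(\alpha,m)}$ while $F^\circ$ lies in the opposite open half-space. It is positively folded if it arises from a minimal 2-step gallery $(E\supset V\subset F_0)$ by finitely many (possibly no) positive foldings. A gallery $\delta$ is *minimal* if there is one class of sectors containing, for every $1\le k\le r$, a sector $S_k$ with $E_{k-1}\subset S_k$ and $E_k\subset -S_k$. It is *positively folded* if every $(E_{k-1}\supset V_k\subset E_k)$, $1\le k\le r$, is positively folded and there are sectors $S_k$ at $V_k$ containing $E_k$ $(0\le k\le r)$ with $\overline{S_0}\ge\dots\ge\overline{S_r}$. *Tableaux.* A Young tableau of type $A_n$ and shape $\lambda$ is a filling with letters from $\{1,\dots,n+1\}$, strictly increasing down each column, of the left-aligned diagram whose $i$-th row has $\lambda_i+\dots+\lambda_n$ boxes. It is *semistandard* if it is weakly increasing along rows, and *minimal*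 if all entries of every column other than the leftmost one also appear in the column directly to its left. *The assignment.* For a gallery $\delta$ of type $\lambda$, each difference $V_{k+1}-V_k$ is $\epsilon_{k_1}+\dots+\epsilon_{k_j}$ for a unique non-empty proper subset $\{k_1<\dots<k_j\}$ of $\{1,\dots,n+1\}$; $T_\delta=(C_0,\dots,C_r)$ is the tableau whose column $C_{r-k}$ (columns counted from the left) has the entries $k_1<\dots<k_j$ from top to bottom. **Theorem.** For every $n\ge1$ and every $\lambda=\sum_i\lambda_i\omega_i$ with $\lambda_i\in\mathbb Z_{\ge0}$, the assignment $\delta\mapsto T_\delta$ restricts to a bijection from the set of minimal combinatorial one-skeleton galleries of type $\lambda$ starting at the origin onto the set of minimal Young tableaux of shape $\lambda$, and to a bijection from the set of positively folded combinatorial one-skeleton galleries of type $\lambda$ starting at the origin onto the set of semistandard Young tableaux of shape $\lambda$. -/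

import Mathlib

noncomputable section

namespace OneSkeleton

/-! ### The standard apartment of type `A_n` -/

/-- The standard apartment of type `A_n`: the real span `ℝ^{n+1} / ℝ·(1,…,1)` of the coweight
lattice `ℤ^{n+1} / ℤ·(1,…,1)`. -/
abbrev Apartment (n : ℕ) : Type :=
  (Fin (n + 1) → ℝ) ⧸ Submodule.span ℝ {(fun _ => 1 : Fin (n + 1) → ℝ)}

/-- The coweight `∑_{i ∈ I} ε_i`, as a point of the apartment. -/
def eps {n : ℕ} (I : Finset (Fin (n + 1))) : Apartment n :=
  Submodule.Quotient.mk (∑ i ∈ I, Pi.single i (1 : ℝ))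

/-- The positive roots of type `A_n`: the pair `(i, j)` with `i < j` stands for `ε_i - ε_j`. -/
abbrev PosRoot (n : ℕ) : Type := {p : Fin (n + 1) × Fin (n + 1) // p.1 < p.2}

/-- The root `α = ε_i - ε_j` as the linear form `x ↦ ⟨x, α⟩ = x_i - x_j` on the apartment. -/
def root {n : ℕ} (α : PosRoot n) : Apartment n →ₗ[ℝ] ℝ :=
  Submodule.liftQ _
    ((LinearMap.proj α.1.1 : (Fin (n + 1) → ℝ) →ₗ[ℝ] ℝ) - LinearMap.proj α.1.2) (by
      rw [Submodule.span_singleton_le_iff_mem]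
      simp)

/-- The coroot of `α = ε_i - ε_j`, namely `ε_i - ε_j` again. -/
def coroot {n : ℕ} (α : PosRoot n) : Apartment n :=
  Submodule.Quotient.mk (Pi.single α.1.1 (1 : ℝ) - Pi.single α.1.2 (1 : ℝ))

theorem root_coroot {n : ℕ} (α : PosRoot n) : root α (coroot α) = 2 := by
  have h : α.1.1 ≠ α.1.2 := ne_of_lt α.2
  have h' : α.1.2 ≠ α.1.1 := h.symm
  rw [root, coroot, Submodule.liftQ_apply]
  simp [h, h']
  norm_num

/-- The simple roots `ε_i - ε_{i+1}`. -/
def IsSimpleRoot {n : ℕ} (α : PosRoot n) : Prop := (α.1.2 : ℕ) = (α.1.1 : ℕ) + 1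

/-- The fundamental coweight `ω_{i+1} = ε_1 + ⋯ + ε_{i+1}` (`i = 0, …, n - 1`). -/
def fundCoweight {n : ℕ} (i : Fin n) : Apartment n :=
  eps (Finset.univ.filter fun j : Fin (n + 1) => (j : ℕ) ≤ (i : ℕ))

/-- The hyperplane `H_{(α,m)}`. -/
def hyperplane {n : ℕ} (α : PosRoot n) (m : ℤ) : Set (Apartment n) := {x | root α x = m}

/-- The sets `H_{(α,m)}^+`, `H_{(α,m)}^-` (closed half-spaces) and `H_{(α,m)}^∅ = H_{(α,m)}`. -/
def halfSpace {n : ℕ} (α : PosRoot n) (m : ℤ) : SignType → Set (Apartment n)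
  | SignType.pos => {x | (m : ℝ) ≤ root α x}
  | SignType.neg => {x | root α x ≤ (m : ℝ)}
  | SignType.zero => hyperplane α m

/-- The linear reflection `s_α`. -/
def rootRefl {n : ℕ} (α : PosRoot n) : Apartment n ≃ₗ[ℝ] Apartment n :=
  Module.reflection (root_coroot α)

/-- The affine reflection `s_{(α,m)}` at `H_{(α,m)}`: `x ↦ s_α(x) + m α^∨`. -/
def affRefl {n : ℕ} (α : PosRoot n) (m : ℤ) : Apartment n ≃ᵃ[ℝ] Apartment n :=
  (rootRefl α).toAffineEquiv.trans (AffineEquiv.constVAdd ℝ (Apartment n) ((m : ℝ) • coroot α))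

/-- The Weyl group `W`. -/
def weylGroup (n : ℕ) : Subgroup (Apartment n ≃ₗ[ℝ] Apartment n) :=
  Subgroup.closure (Set.range (rootRefl (n := n)))

/-- The affine Weyl group `W^a`. -/
def affWeylGroup (n : ℕ) : Subgroup (Apartment n ≃ᵃ[ℝ] Apartment n) :=
  Subgroup.closure {g | ∃ (α : PosRoot n) (m : ℤ), g = affRefl α m}

/-- The length of `w ∈ W`: the least number of factors in an expression of `w` as a product of
simple reflections. -/
def weylLength {n : ℕ} (w : Apartment n ≃ₗ[ℝ] Apartment n) : ℕ :=
  sInf {k | ∃ l : List (Apartment n ≃ₗ[ℝ] Apartment n),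
    l.length = k ∧ (∀ s ∈ l, ∃ α : PosRoot n, IsSimpleRoot α ∧ s = rootRefl α) ∧ l.prod = w}

/-- The Bruhat order `u ≤ w` on `W`: generated by `x ≤ s_α x` whenever `ℓ(x) < ℓ(s_α x)`. -/
def BruhatLE {n : ℕ} (u w : Apartment n ≃ₗ[ℝ] Apartment n) : Prop :=
  Relation.ReflTransGen
    (fun x y => (∃ α : PosRoot n, y = rootRefl α * x) ∧ weylLength x < weylLength y) u w

/-! ### Faces -/

/-- Faces: non-empty sets of the form `⋂ H_{(α,m)}^{e(α,m)}`. -/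
def IsFace {n : ℕ} (F : Set (Apartment n)) : Prop :=
  F.Nonempty ∧ ∃ e : PosRoot n → ℤ → SignType, F = ⋂ (α : PosRoot n) (m : ℤ), halfSpace α m (e α m)

/-- The dimension of a face: the dimension of its affine span. -/
def faceDim {n : ℕ} (F : Set (Apartment n)) : ℕ :=
  Module.finrank ℝ (affineSpan ℝ F).direction

/-- The open face `F°`: the points of `F` that lie on no hyperplane except those containing `F`. -/
def openFace {n : ℕ} (F : Set (Apartment n)) : Set (Apartment n) :=
  {x ∈ F | ∀ (α : PosRoot n) (m : ℤ), x ∈ hyperplane α m → F ⊆ hyperplane α m}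

/-- Vertices: faces of dimension zero, that is, faces `{v}`. -/
def IsVertex {n : ℕ} (v : Apartment n) : Prop := IsFace {v}

/-- Edges: faces of dimension one. -/
def IsEdge {n : ℕ} (E : Set (Apartment n)) : Prop := IsFace E ∧ faceDim E = 1

/-- A vertex is special if, for every root, some hyperplane of that root contains it. -/
def IsSpecial {n : ℕ} (v : Apartment n) : Prop :=
  IsVertex v ∧ ∀ α : PosRoot n, ∃ m : ℤ, v ∈ hyperplane α m

/-- The fundamental alcove `Δ_f`. -/
def fundAlcove (n : ℕ) : Set (Apartment n) := {x | ∀ α : PosRoot n, 0 ≤ root α x ∧ root α x ≤ 1}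

/-- The set `S^a` of walls of the fundamental alcove. -/
def alcoveWalls (n : ℕ) : Set (PosRoot n × ℤ) :=
  {p | IsFace (fundAlcove n ∩ hyperplane p.1 p.2) ∧
    faceDim (fundAlcove n ∩ hyperplane p.1 p.2) + 1 = n}

/-- The type of a face `F`: the walls of `Δ_f` that contain the (unique) face of `Δ_f` conjugate
to `F` under `W^a`. -/
def faceType {n : ℕ} (F : Set (Apartment n)) : Set (PosRoot n × ℤ) :=
  {p ∈ alcoveWalls n | ∃ g ∈ affWeylGroup n, g '' F ⊆ fundAlcove n ∧ g '' F ⊆ hyperplane p.1 p.2}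

/-- `H_{(α,m)}` separates the set `Ω` and the face `F`. -/
def Separates {n : ℕ} (α : PosRoot n) (m : ℤ) (Ω F : Set (Apartment n)) : Prop :=
  (Ω ⊆ {x | root α x ≤ m} ∧ openFace F ⊆ {x | (m : ℝ) < root α x}) ∨
  (Ω ⊆ {x | (m : ℝ) ≤ root α x} ∧ openFace F ⊆ {x | root α x < m})

/-! ### Chambers and sectors -/

/-- The dominant chamber `C^+`. -/
def domChamber (n : ℕ) : Set (Apartment n) := {x | ∀ α : PosRoot n, 0 ≤ root α x}

/-- The chamber `-C`. -/
def opp {n : ℕ} (C : Set (Apartment n)) : Set (Apartment n) := {x | -x ∈ C}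

/-- The (closed Weyl) chambers: the `W`-translates of the dominant chamber. -/
def IsChamber {n : ℕ} (C : Set (Apartment n)) : Prop := ∃ w ∈ weylGroup n, C = w '' domChamber n

/-- The translate `C + v`. For a chamber `C` and a vertex `v` it is a sector at `v`, and
`sector v (opp C)` is the opposite sector at `v`. -/
def sector {n : ℕ} (v : Apartment n) (C : Set (Apartment n)) : Set (Apartment n) := {x | x - v ∈ C}

/-- Sectors in the apartment. -/
def IsSector {n : ℕ} (S : Set (Apartment n)) : Prop :=
  ∃ (v : Apartment n) (C : Set (Apartment n)), IsVertex v ∧ IsChamber C ∧ S = sector v C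

/-- Two sectors are equivalent if their intersection is again a sector. -/
def SectorEquiv {n : ℕ} (S S' : Set (Apartment n)) : Prop :=
  IsSector S ∧ IsSector S' ∧ IsSector (S ∩ S')

/-- The Bruhat order carried over to classes of sectors: the class of `S` is `≥` the class
of `S'`. -/
def SectorGE {n : ℕ} (S S' : Set (Apartment n)) : Prop :=
  ∃ w ∈ weylGroup n, ∃ w' ∈ weylGroup n,
    SectorEquiv (w '' domChamber n) S ∧ SectorEquiv (w' '' domChamber n) S' ∧ BruhatLE w' w

/-- The anti-dominant chamber at `v`, which is `C^- + v` with `C^- = -C^+`. -/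
def antiDomAt {n : ℕ} (v : Apartment n) : Set (Apartment n) := sector v (opp (domChamber n))

/-! ### One-skeleton galleries -/

/-- The data `(V_0, E_0, V_1, …, E_{len-1}, V_len)` of a one-skeleton gallery. -/
structure Gallery (n : ℕ) where
  len : ℕ
  vert : Fin (len + 1) → Apartment n
  edge : Fin len → Set (Apartment n)

variable {n : ℕ}

/-- One-skeleton galleries `V_0 ⊂ E_0 ⊃ V_1 ⊂ ⋯ ⊃ V_len`. -/
def IsOneSkeleton (δ : Gallery n) : Prop :=
  (∀ k, IsVertex (δ.vert k)) ∧ (∀ k, IsEdge (δ.edge k)) ∧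
  ∀ k : Fin δ.len, δ.vert k.castSucc ∈ δ.edge k ∧ δ.vert k.succ ∈ δ.edge k

/-- Combinatorial one-skeleton galleries: both ends are special vertices. -/
def IsCombinatorial (δ : Gallery n) : Prop :=
  IsOneSkeleton δ ∧ IsSpecial (δ.vert 0) ∧ IsSpecial (δ.vert (Fin.last δ.len))

/-- The type of a gallery: the types of its vertices and the types of its edges, in order. -/
def galleryType (δ : Gallery n) : List (Set (PosRoot n × ℤ)) × List (Set (PosRoot n × ℤ)) :=
  (List.ofFn fun k => faceType {δ.vert k}, List.ofFn fun k => faceType (δ.edge k))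

/-- The fundamental edge `E_ω` in direction of the fundamental coweight `ω`: the part of the ray
`ℝ_{≥0} ω` in the fundamental alcove. It joins the origin to `ω`, as `ω` is minuscule. -/
def fundEdge (i : Fin n) : Set (Apartment n) :=
  fundAlcove n ∩ {x | ∃ t : ℝ, 0 ≤ t ∧ x = t • fundCoweight i}

/-- The sequence `ω_1, …, ω_1, ω_2, …, ω_n` with `ω_i` occurring `λ_i` times, by indices. -/
def stepList (lam : Fin n → ℕ) : List (Fin n) :=
  (List.finRange n).flatMap fun i => List.replicate (lam i) i

/-- The gallery `δ_λ` for `λ = ∑ λ_i ω_i`: the concatenation, by translation, of the galleries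
`δ_{ω_i} = (0 ⊂ E_{ω_i} ⊃ ω_i)`, `λ_i` copies for each `i`, in the order of `i`. -/
def galleryOf (lam : Fin n → ℕ) : Gallery n where
  len := (stepList lam).length
  vert k := (((stepList lam).take k).map fundCoweight).sum
  edge k := {x | x - (((stepList lam).take k).map fundCoweight).sum ∈
    fundEdge ((stepList lam).get k)}

/-- The gallery `δ` has type `λ`. -/
def HasType (lam : Fin n → ℕ) (δ : Gallery n) : Prop := galleryType δ = galleryType (galleryOf lam)

/-- The 2-step gallery `E ⊃ v ⊂ F` is minimal. -/
def IsMinimalStep (E : Set (Apartment n)) (v : Apartment n) (F : Set (Apartment n)) : Prop :=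
  ∃ C, IsChamber C ∧ F ⊆ sector v C ∧ E ⊆ sector v (opp C)

/-- `E ⊃ v ⊂ F` is obtained from `E ⊃ v ⊂ F'` by a positive folding. -/
def IsPosFolding (v : Apartment n) (F' F : Set (Apartment n)) : Prop :=
  IsFace F' ∧ ∃ (α : PosRoot n) (m : ℤ), affRefl α m '' F' = F ∧ v ∈ hyperplane α m ∧
    Separates α m (antiDomAt v ∪ F') F

/-- The 2-step gallery `E ⊃ v ⊂ F` is positively folded. -/
def IsPosFoldedStep (E : Set (Apartment n)) (v : Apartment n) (F : Set (Apartment n)) : Prop :=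
  IsMinimalStep E v F ∨
  ∃ F₀, IsFace F₀ ∧ IsMinimalStep E v F₀ ∧ Relation.ReflTransGen (IsPosFolding v) F₀ F

/-- (Globally) minimal galleries: one class of sectors serves at all inner vertices. -/
def IsMinimal (δ : Gallery n) : Prop :=
  ∃ S, IsSector S ∧ ∀ (k : ℕ) (hk : k + 1 < δ.len),
    ∃ v C, IsVertex v ∧ IsChamber C ∧ SectorEquiv (sector v C) S ∧
      δ.edge ⟨k, by omega⟩ ⊆ sector v C ∧ δ.edge ⟨k + 1, hk⟩ ⊆ sector v (opp C)

/-- Locally positively folded galleries. -/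
def IsLocallyPosFolded (δ : Gallery n) : Prop :=
  ∀ (k : ℕ) (hk : k + 1 < δ.len),
    IsPosFoldedStep (δ.edge ⟨k, by omega⟩) (δ.vert ⟨k + 1, by omega⟩) (δ.edge ⟨k + 1, hk⟩)

/-- (Globally) positively folded galleries. -/
def IsPosFolded (δ : Gallery n) : Prop :=
  IsLocallyPosFolded δ ∧
  ∃ C : Fin δ.len → Set (Apartment n),
    (∀ k, IsChamber (C k) ∧ δ.edge k ⊆ sector (δ.vert k.castSucc) (C k)) ∧
    ∀ (k : ℕ) (hk : k + 1 < δ.len),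
      SectorGE (sector (δ.vert ⟨k, by omega⟩) (C ⟨k, by omega⟩))
        (sector (δ.vert ⟨k + 1, by omega⟩) (C ⟨k + 1, hk⟩))

/-- The combinatorial one-skeleton galleries of type `λ` starting at the origin. -/
def galleries (lam : Fin n → ℕ) : Set (Gallery n) :=
  {δ | IsCombinatorial δ ∧ HasType lam δ ∧ δ.vert 0 = 0}

/-! ### Young tableaux -/

/-- The number `λ_{i+1} + ⋯ + λ_n` of boxes in row `i` (rows are counted from `0`). -/
def rowLen (lam : Fin n → ℕ) (i : ℕ) : ℕ :=
  ∑ k ∈ Finset.univ.filter (fun k : Fin n => i ≤ (k : ℕ)), lam k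

theorem rowLen_anti (lam : Fin n → ℕ) : Antitone (rowLen lam) := by
  intro i j h
  refine Finset.sum_le_sum_of_subset fun k hk => ?_
  simp only [Finset.mem_filter, Finset.mem_univ, true_and] at hk ⊢
  omega

/-- The diagram of `λ = ∑ λ_i ω_i`; the box `(i, j)` is in row `i` and column `j`. -/
def diagram (lam : Fin n → ℕ) : YoungDiagram where
  cells := (Finset.range n ×ˢ Finset.range (rowLen lam 0)).filter fun c => c.2 < rowLen lam c.1
  isLowerSet := by
    rintro ⟨i, j⟩ ⟨i', j'⟩ ⟨hi, hj⟩ h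
    simp only [Finset.mem_coe, Finset.mem_filter, Finset.mem_product, Finset.mem_range] at *
    have := rowLen_anti lam hi
    omega

/-- Young tableaux of type `A_n` and shape `λ`: fillings `T` of the diagram with letters
`1, …, n + 1`, strictly increasing down the columns. (`T` is set to `0` outside the diagram.) -/
def IsYoungTableau (lam : Fin n → ℕ) (T : ℕ → ℕ → ℕ) : Prop :=
  (∀ i j, (i, j) ∈ diagram lam → 1 ≤ T i j ∧ T i j ≤ n + 1) ∧
  (∀ i i' j, i < i' → (i', j) ∈ diagram lam → T i j < T i' j) ∧
  ∀ i j, (i, j) ∉ diagram lam → T i j = 0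

/-- Semistandard Young tableaux: weakly increasing along the rows. -/
def IsSemistandard (lam : Fin n → ℕ) (T : ℕ → ℕ → ℕ) : Prop :=
  IsYoungTableau lam T ∧ ∀ i j j', j < j' → (i, j') ∈ diagram lam → T i j ≤ T i j'

/-- Minimal Young tableaux: every entry of a column also appears in the column to its left. -/
def IsMinimalTableau (lam : Fin n → ℕ) (T : ℕ → ℕ → ℕ) : Prop :=
  IsYoungTableau lam T ∧
  ∀ i j, (i, j + 1) ∈ diagram lam → ∃ i', (i', j) ∈ diagram lam ∧ T i' j = T i (j + 1)

/-! ### The tableau of a gallery -/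

/-- The set `{k_1 < ⋯ < k_j}` of the indices with `x = ε_{k_1} + ⋯ + ε_{k_j}`, for a point `x` of
the form `w(ω)` with `w ∈ W` and `ω` a fundamental coweight, that is, for a point `x = ∑_{i ∈ I} ε_i`
with `I` non-empty and proper. By `eps_injOn` it is well defined. -/
def columnSet (x : Apartment n) : Finset (Fin (n + 1)) :=
  open Classical in
  if h : ∃ I : Finset (Fin (n + 1)), (I.Nonempty ∧ I ≠ Finset.univ) ∧ x = eps I then h.choose else ∅

/-- The points `∑_{i ∈ I} ε_i` determine `I`, for non-empty proper `I`. -/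
theorem eps_injOn : Set.InjOn (eps (n := n)) {I | I.Nonempty ∧ I ≠ Finset.univ} := by
  have key : ∀ I J : Finset (Fin (n + 1)), I.Nonempty → eps I = eps J → J ⊆ I := by
    intro I J hI h
    rw [eps, eps, Submodule.Quotient.eq, Submodule.mem_span_singleton] at h
    obtain ⟨r, hr⟩ := h
    obtain ⟨c, hc⟩ := hI
    intro a ha
    by_contra haI
    have h1 := congrFun hr a
    have h2 := congrFun hr c
    simp [Finset.sum_apply, Pi.single_apply, ha, haI, hc] at h1 h2
    split_ifs at h2 <;> linarith
  intro I hI J hJ h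
  exact Finset.Subset.antisymm (key J I hJ.1 h.symm) (key I J hI.1 h)

/-- The tableau `T_δ` of a gallery `δ`. Its columns `C_0, …, C_r` correspond to the steps of `δ` in
reverse order: the step from `V_k` to `V_{k+1}`, the translate by `V_k` of the Weyl group conjugate
`(0 ⊂ w(E_ω) ⊃ w(ω))` with `w(ω) = V_{k+1} - V_k = ε_{k_1} + ⋯ + ε_{k_j}`, gives the column
`C_{r-k}` with the entries `k_1 < ⋯ < k_j` from top to bottom. The letter `a` is the index
`a - 1 : Fin (n + 1)`; outside the columns the value is `0`. -/
def tableauOf (δ : Gallery n) (i j : ℕ) : ℕ :=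
  if h : j < δ.len then
    let k : Fin δ.len := ⟨δ.len - 1 - j, by omega⟩
    (((columnSet (δ.vert k.succ - δ.vert k.castSucc)).sort (· ≤ ·)).map
      fun a : Fin (n + 1) => (a : ℕ) + 1).getD i 0
  else 0

end OneSkeleton

end

noncomputable section

namespace OneSkeleton

/-! ### Coordinates on the apartment and the Weyl group as the symmetric group. -/

variable {n : ℕ}

/-! Both sides are sequences of subsets `I k` of the n + 1 indices, of sizes prescribed by λ. The
vertices of the apartment are the integral points, the type of a vertex is its coordinate sum modulo
n + 1, and an edge through two integral points V and V' is the segment from V to V' = V + `eps I`.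
As 0 < |I| < n + 1, the types of the two ends of an edge fix |I|. Hence a gallery of type λ from the
origin is a sequence of sets (`exists_galleryOfSteps`, `galleryOfSteps_mem`), and a filling with
strictly increasing columns is the same sequence read from right to left (`exists_tableauOfSteps`).
It remains to translate the two conditions on galleries.

Let I and J be consecutive steps, so that |I| ≤ |J|. The 2-step gallery is minimal exactly when I ⊆
J, because `eps I` and `eps J` lie in one chamber exactly when I and J are initial segments of one
ordering of the indices. An increasing chain of sets admits one ordering for all of them, so global
minimality is containment of adjacent columns (`HasStepSizes.isMinimal_iff`).

A positive folding replaces an element of the step by a smaller one. So the 2-step gallery is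
positively folded exactly when J is reached by such exchanges from some J₀ ⊇ I. In terms of the
counting functions `countLE`, inclusions and exchanges can only increase the function; conversely,
if `countLE I` ≤ `countLE J`, the largest J₀ ⊇ I of the size of J is a starting point. This
inequality says that the rows of the two columns increase weakly (`countLE_le_iff`,
`isPosFoldedStep_iff`).

Given the local conditions, the decreasing sequence of sectors always exists. To `I k` one attaches
the permutation that lists `I k` in increasing and then its complement in decreasing order. The
tableau criterion `bruhatLE_of_rankLE`, which rests on length being the number of inversions
(`weylLength_permAct`), shows together with `IsStandardPerm.rankLE_le` that these permutations
decrease in the Bruhat order. -/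

/-- The class in the apartment of a vector of `ℝ^{n+1}`. -/
def pt (x : Fin (n + 1) → ℝ) : Apartment n := Submodule.Quotient.mk x

/-- The linear form `x ↦ x_i - x_j`, for arbitrary indices `i` and `j`. -/
def coordDiff (i j : Fin (n + 1)) : Apartment n →ₗ[ℝ] ℝ :=
  Submodule.liftQ _ ((LinearMap.proj i : (Fin (n + 1) → ℝ) →ₗ[ℝ] ℝ) - LinearMap.proj j) (by
    rw [Submodule.span_singleton_le_iff_mem]
    simp)

@[simp] theorem coordDiff_pt (i j : Fin (n + 1)) (x : Fin (n + 1) → ℝ) :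
    coordDiff i j (pt x) = x i - x j := by
  simp [coordDiff, pt]

theorem root_eq_coordDiff (α : PosRoot n) : root α = coordDiff α.1.1 α.1.2 := rfl

theorem exists_pt (x : Apartment n) : ∃ y, x = pt y := by
  obtain ⟨y, rfl⟩ := Submodule.Quotient.mk_surjective _ x
  exact ⟨y, rfl⟩

theorem pt_eq_pt_iff {x y : Fin (n + 1) → ℝ} : pt x = pt y ↔ ∃ c, ∀ i, x i = y i + c := by
  rw [pt, pt, Submodule.Quotient.eq, Submodule.mem_span_singleton]
  refine exists_congr fun c => ⟨fun h i => ?_, fun h => ?_⟩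
  · have := congrFun h i
    simp at this
    linarith
  · ext i
    simp [h i]

theorem ext_coordDiff {x y : Apartment n} (h : ∀ i j, coordDiff i j x = coordDiff i j y) :
    x = y := by
  obtain ⟨x, rfl⟩ := exists_pt x
  obtain ⟨y, rfl⟩ := exists_pt y
  refine pt_eq_pt_iff.2 ⟨x 0 - y 0, fun i => ?_⟩
  have := h i 0
  simp at this
  linarith

theorem coordDiff_swap (i j : Fin (n + 1)) (x : Apartment n) :
    coordDiff j i x = -coordDiff i j x := by
  obtain ⟨x, rfl⟩ := exists_pt x
  simp

theorem coordDiff_self (i : Fin (n + 1)) (x : Apartment n) : coordDiff i i x = 0 := by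
  obtain ⟨x, rfl⟩ := exists_pt x
  simp

theorem coordDiff_add_coordDiff (i j k : Fin (n + 1)) (x : Apartment n) :
    coordDiff i j x + coordDiff j k x = coordDiff i k x := by
  obtain ⟨x, rfl⟩ := exists_pt x
  simp

theorem eps_eq_pt (I : Finset (Fin (n + 1))) : eps I = pt fun i => if i ∈ I then 1 else 0 := by
  rw [eps, pt]
  congr 1
  ext i
  simp [Finset.sum_apply, Pi.single_apply]

@[simp] theorem coordDiff_eps (i j : Fin (n + 1)) (I : Finset (Fin (n + 1))) :
    coordDiff i j (eps I) = (if i ∈ I then 1 else 0) - (if j ∈ I then 1 else 0) := by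
  rw [eps_eq_pt, coordDiff_pt]

theorem coordDiff_coroot (i j : Fin (n + 1)) (α : PosRoot n) :
    coordDiff i j (coroot α) = ((if i = α.1.1 then 1 else 0) - (if i = α.1.2 then 1 else 0)) -
      ((if j = α.1.1 then 1 else 0) - (if j = α.1.2 then 1 else 0)) := by
  have : coroot α = pt (Pi.single α.1.1 (1 : ℝ) - Pi.single α.1.2 (1 : ℝ)) := rfl
  rw [this, coordDiff_pt]
  simp [Pi.single_apply]

/-- The action of the symmetric group on the apartment. -/
def permAct : Equiv.Perm (Fin (n + 1)) →* (Apartment n ≃ₗ[ℝ] Apartment n) where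
  -- The inverse makes this a left action, under which ε_i goes to ε_{σ i}.
  toFun σ := Submodule.Quotient.equiv _ _ (LinearEquiv.funCongrLeft ℝ ℝ σ⁻¹) (by
    rw [Submodule.map_span, Set.image_singleton]
    rfl)
  map_one' := by
    ext x
    obtain ⟨x, rfl⟩ := exists_pt x
    rfl
  map_mul' σ τ := by
    ext x
    obtain ⟨x, rfl⟩ := exists_pt x
    rfl

theorem permAct_pt (σ : Equiv.Perm (Fin (n + 1))) (x : Fin (n + 1) → ℝ) :
    permAct σ (pt x) = pt fun i => x (σ⁻¹ i) := rfl

@[simp] theorem coordDiff_permAct (σ : Equiv.Perm (Fin (n + 1))) (i j : Fin (n + 1))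
    (x : Apartment n) :
    coordDiff i j (permAct σ x) = coordDiff (σ⁻¹ i) (σ⁻¹ j) x := by
  obtain ⟨x, rfl⟩ := exists_pt x
  simp [permAct_pt]

theorem permAct_eps (σ : Equiv.Perm (Fin (n + 1))) (I : Finset (Fin (n + 1))) :
    permAct σ (eps I) = eps (I.map σ.toEmbedding) := by
  refine ext_coordDiff fun i j => ?_
  simp [Finset.mem_map_equiv, Equiv.Perm.inv_def]

theorem rootRefl_apply (α : PosRoot n) (x : Apartment n) :
    rootRefl α x = x - root α x • coroot α :=
  Module.reflection_apply _ _

theorem permAct_swap (α : PosRoot n) : permAct (Equiv.swap α.1.1 α.1.2) = rootRefl α := by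
  ext x
  refine ext_coordDiff fun i j => ?_
  have h := α.2.ne
  rw [rootRefl_apply, root_eq_coordDiff]
  obtain ⟨x, rfl⟩ := exists_pt x
  simp only [coordDiff_permAct, coordDiff_pt, map_sub, map_smul, coordDiff_coroot, smul_eq_mul,
    Equiv.swap_inv, Equiv.swap_apply_def]
  split_ifs <;> simp_all <;> ring

theorem affRefl_apply (α : PosRoot n) (m : ℤ) (x : Apartment n) :
    affRefl α m x = x - (root α x - m) • coroot α := by
  have : affRefl α m x = (m : ℝ) • coroot α + rootRefl α x := rfl
  rw [this, rootRefl_apply, sub_smul]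
  abel

/-- The root reflections are the transpositions of coordinates, and these generate the symmetric
group. -/
theorem mem_weylGroup_iff {w : Apartment n ≃ₗ[ℝ] Apartment n} :
    w ∈ weylGroup n ↔ ∃ σ, w = permAct σ := by
  constructor
  · intro h
    have : weylGroup n ≤ permAct.range := by
      rw [weylGroup, Subgroup.closure_le]
      rintro _ ⟨α, rfl⟩
      exact ⟨_, permAct_swap α⟩
    obtain ⟨σ, rfl⟩ := this h
    exact ⟨σ, rfl⟩
  · rintro ⟨σ, rfl⟩
    induction σ using Equiv.Perm.swap_induction_on with
    | one => simp [one_mem]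
    | swap_mul f x y hxy ih =>
      rw [map_mul]
      refine mul_mem (Subgroup.subset_closure ?_) ih
      rcases lt_or_gt_of_ne hxy with h | h
      · exact ⟨⟨(x, y), h⟩, (permAct_swap _).symm⟩
      · exact ⟨⟨(y, x), h⟩, by rw [Equiv.swap_comm]; exact (permAct_swap _).symm⟩

theorem permAct_injective (hn : 1 ≤ n) : Function.Injective (permAct (n := n)) := by
  intro σ τ h
  ext i : 1
  have h1 : permAct σ (eps {i}) = permAct τ (eps {i}) := by rw [h]
  rw [permAct_eps, permAct_eps, Finset.map_singleton, Finset.map_singleton] at h1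
  have key : ∀ a : Fin (n + 1), ({a} : Finset (Fin (n + 1))) ≠ Finset.univ := by
    intro a ha
    have := congrArg Finset.card ha
    simp at this
    omega
  simpa using eps_injOn ⟨by simp, key _⟩ ⟨by simp, key _⟩ h1

/-! ### Chambers -/

/-- The chamber of a permutation. -/
def chamber (σ : Equiv.Perm (Fin (n + 1))) : Set (Apartment n) := permAct σ '' domChamber n

theorem mem_domChamber_iff {x : Apartment n} :
    x ∈ domChamber n ↔ ∀ i j, i < j → 0 ≤ coordDiff i j x :=
  ⟨fun h i j hij => h ⟨(i, j), hij⟩, fun h α => h _ _ α.2⟩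

theorem mem_chamber_iff {σ : Equiv.Perm (Fin (n + 1))} {x : Apartment n} :
    x ∈ chamber σ ↔ ∀ i j, i < j → 0 ≤ coordDiff (σ i) (σ j) x := by
  constructor
  · rintro ⟨y, hy, rfl⟩ i j hij
    simpa using mem_domChamber_iff.1 hy i j hij
  · intro h
    refine ⟨permAct σ⁻¹ x, mem_domChamber_iff.2 fun i j hij => ?_, ?_⟩
    · rw [coordDiff_permAct, inv_inv]
      exact h i j hij
    · rw [← LinearEquiv.mul_apply, ← map_mul]
      simp

theorem isChamber_chamber (σ : Equiv.Perm (Fin (n + 1))) : IsChamber (chamber σ) :=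
  ⟨_, mem_weylGroup_iff.2 ⟨σ, rfl⟩, rfl⟩

theorem isChamber_iff {C : Set (Apartment n)} : IsChamber C ↔ ∃ σ, C = chamber σ := by
  constructor
  · rintro ⟨w, hw, rfl⟩
    obtain ⟨σ, rfl⟩ := mem_weylGroup_iff.1 hw
    exact ⟨σ, rfl⟩
  · rintro ⟨σ, rfl⟩
    exact isChamber_chamber σ

/-- A chamber can be chosen so that its coordinates are ordered by a given function. -/
theorem exists_chamber_of_fun (f : Fin (n + 1) → ℕ) :
    ∃ σ : Equiv.Perm (Fin (n + 1)), ∀ x : Apartment n,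
      (∀ i j, f i ≤ f j → 0 ≤ coordDiff i j x) → x ∈ chamber σ :=
  ⟨Tuple.sort f, fun _ h => mem_chamber_iff.2 fun _ _ hij =>
    h _ _ (Tuple.monotone_sort f hij.le)⟩

theorem chamber_smul_mem {σ : Equiv.Perm (Fin (n + 1))} {x : Apartment n} (hx : x ∈ chamber σ)
    {t : ℝ} (ht : 0 ≤ t) : t • x ∈ chamber σ := by
  rw [mem_chamber_iff] at hx ⊢
  intro i j hij
  simpa using mul_nonneg ht (hx i j hij)

/-! ### Integral points -/

/-- The point of the apartment with given integral coordinates. -/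
def intPt (z : Fin (n + 1) → ℤ) : Apartment n := pt fun i => (z i : ℝ)

@[simp] theorem coordDiff_intPt (z : Fin (n + 1) → ℤ) (i j : Fin (n + 1)) :
    coordDiff i j (intPt z) = (z i : ℝ) - z j := by simp [intPt]

theorem intPt_add (z w : Fin (n + 1) → ℤ) : intPt (z + w) = intPt z + intPt w :=
  ext_coordDiff fun i j => by simp; ring

theorem intPt_sub (z w : Fin (n + 1) → ℤ) : intPt (z - w) = intPt z - intPt w :=
  ext_coordDiff fun i j => by simp; ring

theorem intPt_zero : intPt (0 : Fin (n + 1) → ℤ) = 0 :=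
  ext_coordDiff fun i j => by simp

theorem eps_eq_intPt (I : Finset (Fin (n + 1))) : eps I = intPt fun i => if i ∈ I then 1 else 0 :=
  ext_coordDiff fun i j => by simp

theorem intPt_eq_intPt {z w : Fin (n + 1) → ℤ} (h : intPt z = intPt w) :
    ∃ c, ∀ i, z i = w i + c := by
  refine ⟨z 0 - w 0, fun i => ?_⟩
  have := congrArg (coordDiff i 0) h
  simp at this
  have h2 : ((z i - z 0 : ℤ) : ℝ) = ((w i - w 0 : ℤ) : ℝ) := by push_cast; exact this
  have := Int.cast_injective h2
  omega

theorem exists_intPt_of_coordDiff {v : Apartment n} (h : ∀ i, ∃ m : ℤ, coordDiff i 0 v = m) :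
    ∃ z, v = intPt z := by
  choose z hz using h
  refine ⟨z, ext_coordDiff fun i j => ?_⟩
  rw [coordDiff_intPt, ← hz, ← hz, ← coordDiff_add_coordDiff i 0 j, coordDiff_swap j 0]
  ring

/-! ### Translations and permutations in the affine Weyl group. -/

/-- The translation by a vector. -/
abbrev translation (v : Apartment n) : Apartment n ≃ᵃ[ℝ] Apartment n :=
  AffineEquiv.constVAdd ℝ (Apartment n) v

/-- Two reflections at parallel hyperplanes compose to a translation along the coroot. -/
theorem translation_coroot_mem (α : PosRoot n) (m : ℤ) :
    translation ((m : ℝ) • coroot α) ∈ affWeylGroup n := by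
  have h : translation ((m : ℝ) • coroot α) = affRefl α m * affRefl α 0 := by
    ext x
    have : (affRefl α m * affRefl α 0) x = affRefl α m (affRefl α 0 x) := rfl
    rw [this, affRefl_apply α 0, affRefl_apply]
    simp only [AffineEquiv.constVAdd_apply, vadd_eq_add, map_sub, map_smul, root_coroot]
    module
  rw [h]
  exact mul_mem (Subgroup.subset_closure ⟨α, m, rfl⟩) (Subgroup.subset_closure ⟨α, 0, rfl⟩)

theorem translation_add_mem {v w : Apartment n} (hv : translation v ∈ affWeylGroup n)
    (hw : translation w ∈ affWeylGroup n) : translation (v + w) ∈ affWeylGroup n := by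
  have : translation (v + w) = translation v * translation w := by
    ext x
    simp [AffineEquiv.mul_def]
  rw [this]
  exact mul_mem hv hw

theorem translation_zero_mem : translation (0 : Apartment n) ∈ affWeylGroup n := by
  have : translation (0 : Apartment n) = 1 := by
    ext x
    simp
  rw [this]
  exact one_mem _

/-- Translations by integral vectors with coordinate sum zero lie in the affine Weyl group. -/
theorem translation_intPt_mem (z : Fin (n + 1) → ℤ) (hz : ∑ i, z i = 0) :
    translation (intPt z) ∈ affWeylGroup n := by
  -- The coordinate of index 0 is minus the sum of the others, so the coroots ε_0 - ε_i suffice.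
  have h1 : intPt z = ∑ i : Fin n, ((-z i.succ : ℤ) : ℝ) •
      coroot (⟨(0, i.succ), Fin.succ_pos i⟩ : PosRoot n) := by
    have h0 : z 0 = -∑ i : Fin n, z i.succ := by
      rw [Fin.sum_univ_succ] at hz
      omega
    have : ∀ j, coordDiff j 0 (intPt z) = coordDiff j 0 (∑ i : Fin n, ((-z i.succ : ℤ) : ℝ) •
      coroot (⟨(0, i.succ), Fin.succ_pos i⟩ : PosRoot n)) := by
      intro j
      rw [coordDiff_intPt, map_sum, h0]
      refine Fin.cases ?_ (fun j => ?_) j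
      · simp [coordDiff_self, h0]
      · simp [coordDiff_coroot, mul_sub, Finset.sum_add_distrib, eq_comm, add_comm]
    refine ext_coordDiff fun i j => ?_
    rw [← coordDiff_add_coordDiff i 0 j, coordDiff_swap j 0, this, this,
      ← coordDiff_add_coordDiff i 0 j, coordDiff_swap j 0]
  rw [h1]
  refine Finset.sum_induction _ (fun v => translation v ∈ affWeylGroup n)
    (fun _ _ => translation_add_mem) translation_zero_mem fun i _ => translation_coroot_mem _ _

/-- A permutation acts on the star of an integral point by elements of the affine Weyl group. -/
theorem exists_affWeylGroup_perm (z : Fin (n + 1) → ℤ) (σ : Equiv.Perm (Fin (n + 1))) :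
    ∃ g ∈ affWeylGroup n, ∀ x, g x = intPt z + permAct σ (x - intPt z) := by
  induction σ using Equiv.Perm.swap_induction_on with
  | one => exact ⟨1, one_mem _, fun x => by simp⟩
  | swap_mul f a b hab ih =>
    obtain ⟨g, hg, h⟩ := ih
    have key : ∃ α : PosRoot n, Equiv.swap a b = Equiv.swap α.1.1 α.1.2 := by
      rcases lt_or_gt_of_ne hab with h | h
      · exact ⟨⟨(a, b), h⟩, rfl⟩
      · exact ⟨⟨(b, a), h⟩, Equiv.swap_comm _ _⟩
    obtain ⟨α, hα⟩ := key
    -- At this level the hyperplane passes through `intPt z`, so the affine reflection is the linear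
    -- one based at that point.
    refine ⟨affRefl α (z α.1.1 - z α.1.2) * g, mul_mem (Subgroup.subset_closure ⟨_, _, rfl⟩) hg,
      fun x => ?_⟩
    have : (affRefl α (z α.1.1 - z α.1.2) * g) x = affRefl α (z α.1.1 - z α.1.2) (g x) := rfl
    rw [this, h, hα, map_mul, permAct_swap, affRefl_apply, LinearEquiv.mul_apply, rootRefl_apply,
      root_eq_coordDiff, map_add, coordDiff_intPt]
    push_cast
    module

/-! ### Faces -/

/-- A face lies in a closed half-space of every hyperplane, so it has no points strictly on both
sides. -/
theorem IsFace.root_le {F : Set (Apartment n)} (hF : IsFace F) {x y : Apartment n} (hx : x ∈ F)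
    (hy : y ∈ F) {α : PosRoot n} {m : ℤ} (h : root α x < m) : root α y ≤ m := by
  obtain ⟨-, e, rfl⟩ := hF
  have hx := Set.mem_iInter₂.1 hx α m
  have hy := Set.mem_iInter₂.1 hy α m
  cases he : e α m <;> rw [he] at hx hy <;> simp [halfSpace, hyperplane] at hx hy <;> linarith

theorem IsFace.le_root {F : Set (Apartment n)} (hF : IsFace F) {x y : Apartment n} (hx : x ∈ F)
    (hy : y ∈ F) {α : PosRoot n} {m : ℤ} (h : m < root α x) : m ≤ root α y := by
  obtain ⟨-, e, rfl⟩ := hF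
  have hx := Set.mem_iInter₂.1 hx α m
  have hy := Set.mem_iInter₂.1 hy α m
  cases he : e α m <;> rw [he] at hx hy <;> simp [halfSpace, hyperplane] at hx hy <;> linarith

theorem IsFace.convex {F : Set (Apartment n)} (hF : IsFace F) : Convex ℝ F := by
  obtain ⟨-, e, rfl⟩ := hF
  refine convex_iInter₂ fun α m => ?_
  cases e α m
  · exact convex_hyperplane (root α).isLinear _
  · exact convex_halfSpace_le (root α).isLinear _
  · exact convex_halfSpace_ge (root α).isLinear _

/-- The points that lie on the same side of every hyperplane as a given point form a face. -/
theorem isFace_of_point {F : Set (Apartment n)} (p : Apartment n)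
    (h : ∀ x, x ∈ F ↔ ∀ (α : PosRoot n) (m : ℤ), (root α p = m → root α x = m) ∧
      (root α p < m → root α x ≤ m) ∧ ((m : ℝ) < root α p → m ≤ root α x)) : IsFace F := by
  refine ⟨⟨p, (h p).2 fun α m => ⟨id, le_of_lt, le_of_lt⟩⟩, fun α m => SignType.sign (root α p - m),
    ?_⟩
  ext x
  rw [h, Set.mem_iInter₂]
  refine forall₂_congr fun α m => ?_
  change _ ↔ x ∈ halfSpace α m (SignType.sign (root α p - m))
  rcases lt_trichotomy (root α p) m with h | h | h
  · have hs : SignType.sign (root α p - m) = SignType.neg := sign_neg (by linarith)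
    rw [hs]
    simp [halfSpace, h, h.ne, h.not_gt]
  · have hs : SignType.sign (root α p - m) = SignType.zero := by rw [h, sub_self]; exact sign_zero
    rw [hs]
    simp [halfSpace, hyperplane, h]
  · have hs : SignType.sign (root α p - m) = SignType.pos := sign_pos (by linarith)
    rw [hs]
    simp [halfSpace, h, h.ne', h.not_gt]

/-- The vertices of the apartment are the integral points. -/
theorem isVertex_intPt (z : Fin (n + 1) → ℤ) : IsVertex (intPt z) := by
  refine isFace_of_point (intPt z) fun x => ⟨?_, fun h => ?_⟩
  · rintro rfl α m
    exact ⟨id, le_of_lt, le_of_lt⟩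
  · have key : ∀ i j, i < j → coordDiff i j x = coordDiff i j (intPt z) := fun i j hij => by
      have := (h ⟨(i, j), hij⟩ (z i - z j)).1
      simp only [root_eq_coordDiff, coordDiff_intPt] at this ⊢
      exact_mod_cast this (by push_cast; rfl)
    refine ext_coordDiff fun i j => ?_
    rcases lt_trichotomy i j with h | rfl | h
    · exact key _ _ h
    · simp [coordDiff_self]
    · rw [coordDiff_swap j i, key _ _ h, ← coordDiff_swap]

theorem isSpecial_intPt (z : Fin (n + 1) → ℤ) : IsSpecial (intPt z) :=
  ⟨isVertex_intPt z, fun α => ⟨z α.1.1 - z α.1.2, by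
    simp [hyperplane, root_eq_coordDiff]⟩⟩

/-- Small perturbations of a non-integral number do not cross any integer. -/
theorem exists_radius (a : ℝ) (h : ∀ m : ℤ, a ≠ m) :
    ∃ ε > 0, ∀ t, |t| ≤ ε → ∀ m : ℤ, ((m : ℝ) ≤ a → m ≤ a + t) ∧ (a ≤ m → a + t ≤ m) := by
  have h1 : (⌊a⌋ : ℝ) < a := lt_of_le_of_ne (Int.floor_le a) (h _).symm
  have h2 := Int.lt_floor_add_one a
  refine ⟨min (a - ⌊a⌋) (⌊a⌋ + 1 - a), lt_min (by linarith) (by linarith), fun t ht m => ?_⟩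
  have h3 := abs_le.1 (ht.trans (min_le_left _ _))
  have h4 := abs_le.1 (ht.trans (min_le_right _ _))
  constructor
  · intro hm
    have : (m : ℝ) ≤ ⌊a⌋ := by exact_mod_cast Int.le_floor.2 hm
    linarith
  · intro hm
    have : ((⌊a⌋ + 1 : ℤ) : ℝ) ≤ m := by
      have : ⌊a⌋ < m := Int.floor_lt.2 (lt_of_le_of_ne hm (h m))
      exact_mod_cast this
    push_cast at this
    linarith

/-- If v is not integral, let I be the set of indices whose coordinate agrees with the one of index
0 modulo ℤ; it is proper. A small move along `eps I` keeps v on all hyperplanes through it and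
crosses no other, so {v} is not a face. -/
theorem IsVertex.exists_intPt {v : Apartment n} (hv : IsVertex v) : ∃ z, v = intPt z := by
  classical
  refine exists_intPt_of_coordDiff ?_
  by_contra! hcon
  obtain ⟨i₀, hi₀⟩ := hcon
  set I : Finset (Fin (n + 1)) := Finset.univ.filter fun i => ∃ m : ℤ, coordDiff i 0 v = m with hI
  have h0 : (0 : Fin (n + 1)) ∈ I := by
    simp only [hI, Finset.mem_filter, Finset.mem_univ, true_and]
    exact ⟨0, by simp [coordDiff_self]⟩
  have hi₀' : i₀ ∉ I := by simpa [hI] using hi₀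
  have hne : ∀ i j, ¬(i ∈ I ↔ j ∈ I) → ∀ m : ℤ, coordDiff i j v ≠ m := by
    intro i j hij m hm
    have e := coordDiff_add_coordDiff i j 0 v
    apply hij
    simp only [hI, Finset.mem_filter, Finset.mem_univ, true_and]
    constructor
    · rintro ⟨k, hk⟩
      exact ⟨k - m, by push_cast; linarith⟩
    · rintro ⟨k, hk⟩
      exact ⟨m + k, by push_cast; linarith⟩
  -- There are finitely many roots, so one radius serves for all of them.
  have hε : ∃ ε > 0, ∀ (α : PosRoot n), ¬(α.1.1 ∈ I ↔ α.1.2 ∈ I) → ∀ t : ℝ, |t| ≤ ε → ∀ m : ℤ,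
      ((m : ℝ) ≤ root α v → m ≤ root α v + t) ∧ (root α v ≤ m → root α v + t ≤ m) := by
    have : ∀ α : PosRoot n, ∃ ε : ℝ, 0 < ε ∧ (¬(α.1.1 ∈ I ↔ α.1.2 ∈ I) → ∀ t : ℝ, |t| ≤ ε → ∀ m : ℤ,
      ((m : ℝ) ≤ root α v → m ≤ root α v + t) ∧ (root α v ≤ m → root α v + t ≤ m)) := by
      intro α
      by_cases hα : α.1.1 ∈ I ↔ α.1.2 ∈ I
      · exact ⟨1, one_pos, fun h => absurd hα h⟩
      · obtain ⟨ε, h1, h2⟩ := exists_radius (root α v) (hne _ _ hα)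
        exact ⟨ε, h1, fun _ => h2⟩
    choose ε h1 h2 using this
    obtain ⟨e, he, hle⟩ : ∃ e > 0, ∀ α, e ≤ ε α := by
      rcases isEmpty_or_nonempty (PosRoot n) with hE | hE
      · exact ⟨1, one_pos, fun α => (hE.false α).elim⟩
      · obtain ⟨α, hα⟩ := Finite.exists_min ε
        exact ⟨ε α, h1 α, hα⟩
    exact ⟨e, he, fun α hα t ht => h2 α hα t (ht.trans (hle α))⟩
  obtain ⟨ε, hε0, hε⟩ := hε
  have hmem : v + ε • eps I ∈ ({v} : Set (Apartment n)) := by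
    obtain ⟨⟨w, hw⟩, e, he⟩ := hv
    have hv' : v ∈ ({v} : Set (Apartment n)) := rfl
    rw [he, Set.mem_iInter₂] at hv' ⊢
    intro α m
    have h1 := hv' α m
    have h2 : root α (v + ε • eps I) = root α v +
        ε * ((if α.1.1 ∈ I then 1 else 0) - (if α.1.2 ∈ I then 1 else 0)) := by
      rw [map_add, map_smul, root_eq_coordDiff, coordDiff_eps, smul_eq_mul]
    by_cases hα : α.1.1 ∈ I ↔ α.1.2 ∈ I
    · have h3 : root α (v + ε • eps I) = root α v := by
        rw [h2]
        simp [hα]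
      cases hs : e α m <;> rw [hs] at h1 <;> simpa [halfSpace, hyperplane, h3] using h1
    · have h4 := hε α hα (ε * ((if α.1.1 ∈ I then 1 else 0) - (if α.1.2 ∈ I then 1 else 0)))
        (by
          rw [abs_mul, abs_of_pos hε0]
          split_ifs <;> simp [hε0.le]) m
      rw [← h2] at h4
      cases hs : e α m <;> rw [hs] at h1
      · exact absurd h1 (hne _ _ hα m)
      · exact h4.2 h1
      · exact h4.1 h1
  have hz : ε • eps I = 0 := by simpa using hmem
  have := congrArg (coordDiff 0 i₀) hz
  simp [h0, hi₀'] at this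
  exact hε0.ne' this

/-! ### Edges -/

/-- The segment from `v` to `v + ∑_{i ∈ I} ε_i`. -/
def seg (v : Apartment n) (I : Finset (Fin (n + 1))) : Set (Apartment n) :=
  {x | ∃ t : ℝ, 0 ≤ t ∧ t ≤ 1 ∧ x = v + t • eps I}

theorem left_mem_seg (v : Apartment n) (I : Finset (Fin (n + 1))) : v ∈ seg v I :=
  ⟨0, le_rfl, zero_le_one, by simp⟩

theorem right_mem_seg (v : Apartment n) (I : Finset (Fin (n + 1))) : v + eps I ∈ seg v I :=
  ⟨1, zero_le_one, le_rfl, by simp⟩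

/-- The parameter t can be read off from one pair of an index in I and an index outside; the
equalities carry it over to all other pairs. This form matches the inequalities that define faces.
-/
theorem mem_seg_iff {v x : Apartment n} {I : Finset (Fin (n + 1))} (hI : I.Nonempty)
    (hI' : I ≠ Finset.univ) : x ∈ seg v I ↔
      (∀ i j, (i ∈ I ↔ j ∈ I) → coordDiff i j x = coordDiff i j v) ∧
      ∀ i j, i ∈ I → j ∉ I → coordDiff i j v ≤ coordDiff i j x ∧
        coordDiff i j x ≤ coordDiff i j v + 1 := by
  constructor
  · rintro ⟨t, h0, h1, rfl⟩
    refine ⟨fun i j hij => ?_, fun i j hi hj => ?_⟩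
    · simp [hij]
    · simp [hi, hj, h0, h1]
  · rintro ⟨h1, h2⟩
    obtain ⟨i₀, hi₀⟩ := hI
    obtain ⟨j₀, hj₀⟩ : ∃ j, j ∉ I := by
      by_contra! h
      exact hI' (Finset.eq_univ_iff_forall.2 h)
    obtain ⟨ha, hb⟩ := h2 i₀ j₀ hi₀ hj₀
    obtain ⟨t, ht⟩ : ∃ t, t = coordDiff i₀ j₀ x - coordDiff i₀ j₀ v := ⟨_, rfl⟩
    have key : ∀ i, coordDiff i j₀ x = coordDiff i j₀ v + (if i ∈ I then 1 else 0) * t := by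
      intro i
      rw [ht]
      split_ifs with hi
      · have := h1 i i₀ (by simp [hi, hi₀])
        rw [← coordDiff_add_coordDiff i i₀ j₀, ← coordDiff_add_coordDiff i i₀ j₀ v, this]
        ring
      · rw [h1 i j₀ (by simp [hi, hj₀])]
        ring
    refine ⟨t, by linarith, by linarith, ext_coordDiff fun i j => ?_⟩
    have e1 := coordDiff_add_coordDiff i j₀ j x
    have e2 := coordDiff_add_coordDiff i j₀ j v
    rw [coordDiff_swap j j₀, key, key] at e1
    rw [coordDiff_swap j j₀] at e2
    rw [← e1, map_add, map_smul, coordDiff_eps, ← e2, smul_eq_mul]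
    ring

/-- The face is that of the midpoint: its differences across I are half-integral, so the closest
hyperplanes on either side are those through the two ends. -/
theorem isFace_seg (z : Fin (n + 1) → ℤ) {I : Finset (Fin (n + 1))} (hI : I.Nonempty)
    (hI' : I ≠ Finset.univ) : IsFace (seg (intPt z) I) := by
  refine isFace_of_point (intPt z + (1 / 2 : ℝ) • eps I) fun x => ?_
  rw [mem_seg_iff hI hI']
  have half : ∀ a m : ℤ, (a : ℝ) + 1 / 2 ≠ m := by
    intro a m h
    have : ((2 * a + 1 : ℤ) : ℝ) = ((2 * m : ℤ) : ℝ) := by push_cast; linarith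
    have := Int.cast_injective this
    omega
  have up : ∀ a m : ℤ, (a : ℝ) + 1 / 2 < m → (a : ℝ) + 1 ≤ m := by
    intro a m h
    have : (a : ℝ) < m := by linarith
    exact_mod_cast Int.add_one_le_of_lt (Int.cast_lt.1 this)
  have dn : ∀ a m : ℤ, (m : ℝ) < a + 1 / 2 → (m : ℝ) ≤ a := by
    intro a m h
    have : (m : ℝ) < ((a + 1 : ℤ) : ℝ) := by push_cast; linarith
    have := Int.cast_lt.1 this
    exact_mod_cast Int.lt_add_one_iff.1 this
  have hd : ∀ i j, coordDiff i j (intPt z) = ((z i - z j : ℤ) : ℝ) := by simp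
  constructor
  · rintro ⟨h1, h2⟩ ⟨⟨i, j⟩, hij⟩ m
    simp only [root_eq_coordDiff, map_add, map_smul, coordDiff_eps, smul_eq_mul, hd] at h1 h2 ⊢
    by_cases hi : i ∈ I <;> by_cases hj : j ∈ I
    · rw [h1 i j (by simp [hi, hj])]
      simp only [hi, hj, if_true, sub_self, mul_zero, add_zero]
      exact ⟨id, le_of_lt, le_of_lt⟩
    · obtain ⟨ha, hb⟩ := h2 i j hi hj
      simp only [hi, hj, if_true, if_false, sub_zero, mul_one]
      exact ⟨fun h => absurd h (half _ _), fun h => hb.trans (up _ _ h),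
        fun h => (dn _ _ h).trans ha⟩
    · obtain ⟨ha, hb⟩ := h2 j i hj hi
      have e : ((z i - z j : ℤ) : ℝ) = -((z j - z i : ℤ) : ℝ) := by push_cast; ring
      rw [coordDiff_swap j i, e]
      simp only [hi, hj, if_true, if_false, zero_sub]
      refine ⟨fun h => absurd (b := False) ?_ (half (z j - z i) (-m)) |>.elim, fun h => ?_,
        fun h => ?_⟩
      · push_cast at h ⊢
        linarith
      · have := dn (z j - z i) (-m) (by push_cast at h ⊢; linarith)
        push_cast at this ha ⊢
        linarith
      · have := up (z j - z i) (-m) (by push_cast at h ⊢; linarith)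
        push_cast at this hb ⊢
        linarith
    · rw [h1 i j (by simp [hi, hj])]
      simp only [hi, hj, if_false, sub_self, mul_zero, add_zero]
      exact ⟨id, le_of_lt, le_of_lt⟩
  · intro h
    have key : ∀ i j (hij : i < j), (∀ m : ℤ, _) := fun i j hij => h ⟨(i, j), hij⟩
    simp only [root_eq_coordDiff, map_add, map_smul, coordDiff_eps, smul_eq_mul, hd] at key ⊢
    have e : ∀ i j, ((z i - z j : ℤ) : ℝ) = -((z j - z i : ℤ) : ℝ) := by
      intro i j
      push_cast
      ring
    have k1 : ∀ i j, i < j → (i ∈ I ↔ j ∈ I) → coordDiff i j x = ((z i - z j : ℤ) : ℝ) := by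
      intro i j hij hI
      exact (key i j hij (z i - z j)).1 (by simp [hI])
    refine ⟨fun i j hij => ?_, fun i j hi hj => ?_⟩
    · rcases lt_trichotomy i j with hlt | rfl | hlt
      · exact k1 i j hlt hij
      · simp [coordDiff_self]
      · rw [coordDiff_swap j i, k1 j i hlt hij.symm, e j i, neg_neg]
    · rcases lt_trichotomy i j with hlt | rfl | hlt
      · have a1 := (key i j hlt (z i - z j)).2.2
        have a2 := (key i j hlt (z i - z j + 1)).2.1
        simp only [hi, hj, if_true, if_false] at a1 a2
        push_cast at a1 a2 ⊢
        exact ⟨a1 (by linarith), a2 (by linarith)⟩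
      · exact absurd hi hj
      · have a1 := (key j i hlt (z j - z i)).2.1
        have a2 := (key j i hlt (z j - z i - 1)).2.2
        simp only [hi, hj, if_true, if_false] at a1 a2
        rw [coordDiff_swap j i]
        push_cast at a1 a2 ⊢
        have a1 := a1 (by linarith)
        have a2 := a2 (by linarith)
        constructor <;> linarith

theorem eps_ne_zero {I : Finset (Fin (n + 1))} (hI : I.Nonempty) (hI' : I ≠ Finset.univ) :
    eps I ≠ 0 := by
  intro h
  obtain ⟨i, hi⟩ := hI
  obtain ⟨j, hj⟩ : ∃ j, j ∉ I := by
    by_contra! h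
    exact hI' (Finset.eq_univ_iff_forall.2 h)
  simpa [hi, hj] using congrArg (coordDiff i j) h

theorem faceDim_seg (v : Apartment n) {I : Finset (Fin (n + 1))} (hI : I.Nonempty)
    (hI' : I ≠ Finset.univ) : faceDim (seg v I) = 1 := by
  have h : vectorSpan ℝ (seg v I) = ℝ ∙ eps I := by
    apply le_antisymm
    · rw [vectorSpan_eq_span_vsub_set_right ℝ (left_mem_seg v I), Submodule.span_le]
      rintro _ ⟨x, ⟨t, -, -, rfl⟩, rfl⟩
      exact Submodule.mem_span_singleton.2 ⟨t, by simp⟩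
    · rw [Submodule.span_singleton_le_iff_mem]
      simpa using vsub_mem_vectorSpan ℝ (right_mem_seg v I) (left_mem_seg v I)
  rw [faceDim, direction_affineSpan, h, finrank_span_singleton (eps_ne_zero hI hI')]

theorem isEdge_seg (z : Fin (n + 1) → ℤ) {I : Finset (Fin (n + 1))} (hI : I.Nonempty)
    (hI' : I ≠ Finset.univ) : IsEdge (seg (intPt z) I) :=
  ⟨isFace_seg z hI hI', faceDim_seg _ hI hI'⟩

/-- An edge that contains two distinct integral points is the segment between them. -/
theorem IsEdge.eq_seg {E : Set (Apartment n)} (hE : IsEdge E) {z w : Fin (n + 1) → ℤ}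
    (hz : intPt z ∈ E) (hw : intPt w ∈ E) (hne : intPt z ≠ intPt w) :
    ∃ I : Finset (Fin (n + 1)), I.Nonempty ∧ I ≠ Finset.univ ∧ intPt w = intPt z + eps I ∧
      E = seg (intPt z) I := by
  set u : Fin (n + 1) → ℤ := w - z with hu
  -- Otherwise some hyperplane has one of the two points strictly on one side and the other point
  -- strictly on the opposite side, or contradicts the face condition at distance one from `intPt
  -- z`.
  have hroot : ∀ i j, i < j → |u i - u j| ≤ 1 := by
    intro i j hij
    rw [abs_le]
    constructor
    · by_contra! hcon
      have := hE.1.root_le hw hz (α := ⟨(i, j), hij⟩) (m := z i - z j - 1) (by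
        simp only [root_eq_coordDiff, coordDiff_intPt]
        have : w i - w j < z i - z j - 1 := by simp [hu] at hcon; omega
        exact_mod_cast this)
      simp only [root_eq_coordDiff, coordDiff_intPt] at this
      push_cast at this
      linarith
    · by_contra! hcon
      have := hE.1.le_root hw hz (α := ⟨(i, j), hij⟩) (m := z i - z j + 1) (by
        simp only [root_eq_coordDiff, coordDiff_intPt]
        have : z i - z j + 1 < w i - w j := by simp [hu] at hcon; omega
        exact_mod_cast this)
      simp only [root_eq_coordDiff, coordDiff_intPt] at this
      push_cast at this
      linarith
  have hroot' : ∀ i j, |u i - u j| ≤ 1 := by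
    intro i j
    rcases lt_trichotomy i j with h | rfl | h
    · exact hroot _ _ h
    · simp
    · rw [abs_sub_comm]
      exact hroot _ _ h
  -- Only the minimum of u and the minimum plus one occur as values; I is where the larger one is
  -- taken.
  obtain ⟨i₀, hi₀⟩ := Finite.exists_min u
  set I : Finset (Fin (n + 1)) := Finset.univ.filter fun i => u i ≠ u i₀ with hIdef
  have hval : ∀ i, u i = u i₀ + if i ∈ I then 1 else 0 := by
    intro i
    have h1 := hi₀ i
    have h2 := (abs_le.1 (hroot' i i₀)).2
    split_ifs with h
    · simp [hIdef] at h
      omega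
    · simp [hIdef] at h
      omega
  have hstep : intPt w = intPt z + eps I := by
    have : intPt u = eps I := by
      rw [eps_eq_intPt]
      refine ext_coordDiff fun i j => ?_
      rw [coordDiff_intPt, coordDiff_intPt, hval i, hval j]
      push_cast
      ring
    rw [← this, ← intPt_add, hu]
    simp
  have hI' : I ≠ Finset.univ := fun h => by
    have := Finset.mem_univ i₀
    rw [← h] at this
    simp [hIdef] at this
  have hI : I.Nonempty := by
    rw [Finset.nonempty_iff_ne_empty]
    intro h
    rw [h] at hstep
    apply hne
    rw [hstep]
    simp [eps]
  refine ⟨I, hI, hI', hstep, ?_⟩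
  apply Set.Subset.antisymm
  -- Dimension one puts E on the line in direction `eps I`; the hyperplanes through the two integral
  -- points bound the parameter.
  · intro x hx
    have h1 : eps I ∈ vectorSpan ℝ E := by
      have := vsub_mem_vectorSpan ℝ hw hz
      rwa [hstep, vsub_eq_sub, add_sub_cancel_left] at this
    have h2 : x - intPt z ∈ vectorSpan ℝ E := vsub_mem_vectorSpan ℝ hx hz
    have h3 : Module.finrank ℝ (vectorSpan ℝ E) = 1 := by
      rw [← direction_affineSpan]
      exact hE.2
    obtain ⟨t, ht⟩ := (finrank_eq_one_iff_of_nonzero' (⟨eps I, h1⟩ : vectorSpan ℝ E)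
      (by simpa using eps_ne_zero hI hI')).1 h3 ⟨x - intPt z, h2⟩
    have ht : t • eps I = x - intPt z := congrArg Subtype.val ht
    have hx' : x = intPt z + t • eps I := by rw [ht]; abel
    have hbound : ∀ i j, i ∈ I → j ∉ I → 0 ≤ t ∧ t ≤ 1 := by
      intro i j hi hj
      have e1 : coordDiff i j x = z i - z j + t := by rw [hx']; simp [hi, hj]
      have e2 : coordDiff i j (intPt w) = z i - z j + 1 := by rw [hstep]; simp [hi, hj]
      have e3 : coordDiff i j (intPt z) = z i - z j := by simp
      rcases lt_trichotomy i j with h | rfl | h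
      · have a1 := hE.1.le_root hw hx (α := ⟨(i, j), h⟩) (m := z i - z j)
        have a2 := hE.1.root_le hz hx (α := ⟨(i, j), h⟩) (m := z i - z j + 1)
        simp only [root_eq_coordDiff, e1, e2, e3] at a1 a2
        push_cast at a1 a2
        have a1 := a1 (by linarith)
        have a2 := a2 (by linarith)
        constructor <;> linarith
      · exact absurd hi hj
      · rw [coordDiff_swap] at e1 e2 e3
        have a1 := hE.1.root_le hw hx (α := ⟨(j, i), h⟩) (m := z j - z i)
        have a2 := hE.1.le_root hz hx (α := ⟨(j, i), h⟩) (m := z j - z i - 1)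
        simp only [root_eq_coordDiff] at a1 a2
        push_cast at a1 a2
        have a1 := a1 (by linarith)
        have a2 := a2 (by linarith)
        constructor <;> linarith
    obtain ⟨i, hi⟩ := hI
    obtain ⟨h0, h1⟩ := hbound i i₀ hi (by simp [hIdef])
    exact ⟨t, h0, h1, hx'⟩
  · rintro _ ⟨t, h0, h1, rfl⟩
    have := hE.1.convex hz hw (a := 1 - t) (b := t) (by linarith) h0 (by ring)
    rw [hstep] at this
    convert this using 1
    module

/-! ### Vertices of the fundamental alcove and its walls -/

/-- The set of the first `s` indices. -/
def initialSet (s : ℕ) : Finset (Fin (n + 1)) := Finset.univ.filter fun j => (j : ℕ) < s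

@[simp] theorem mem_initialSet {s : ℕ} {j : Fin (n + 1)} :
    j ∈ (initialSet s : Finset (Fin (n + 1))) ↔ (j : ℕ) < s := by
  simp [initialSet]

theorem fundCoweight_eq (i : Fin n) : fundCoweight i = eps (initialSet ((i : ℕ) + 1)) := by
  rw [fundCoweight]
  congr 1
  ext j
  simp

theorem card_initialSet {s : ℕ} (hs : s ≤ n + 1) :
    (initialSet s : Finset (Fin (n + 1))).card = s := by
  simp [initialSet, Fin.card_filter_val_lt, hs]

theorem eps_initialSet_mem (s : ℕ) : eps (initialSet s) ∈ fundAlcove n := by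
  rintro ⟨⟨i, j⟩, hij⟩
  have : (i : ℕ) < j := hij
  simp only [root_eq_coordDiff, coordDiff_eps, mem_initialSet]
  split_ifs <;> first | omega | norm_num

/-- The walls of the fundamental alcove, indexed by the opposite vertices. -/
def wall (hn : 1 ≤ n) (t : Fin (n + 1)) : PosRoot n × ℤ :=
  -- The origin is opposite to the wall of the highest root at level 1, and the vertex `eps
  -- (initialSet t)` with t > 0 to the wall of a simple root.
  if h : (t : ℕ) = 0 then (⟨(0, Fin.last n), by rw [Fin.lt_def]; simpa using Nat.lt_of_lt_of_le one_pos hn⟩, 1)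
  else (⟨(⟨t - 1, by omega⟩, t), show (t : ℕ) - 1 < t by omega⟩, 0)

theorem root_wall_eps (hn : 1 ≤ n) (t : Fin (n + 1)) {s : ℕ} (hs : s ≤ n) :
    eps (initialSet s) ∈ hyperplane (wall hn t).1 (wall hn t).2 ↔ s ≠ t := by
  simp only [hyperplane, Set.mem_ofPred_eq, wall]
  split_ifs with h
  · simp only [root_eq_coordDiff, coordDiff_eps, mem_initialSet, h, Fin.val_zero, Fin.val_last]
    split_ifs <;> norm_num <;> omega
  · simp only [root_eq_coordDiff, coordDiff_eps, mem_initialSet]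
    split_ifs <;> norm_num <;> omega

theorem isFace_alcove_inter_wall (hn : 1 ≤ n) (t : Fin (n + 1)) :
    IsFace (fundAlcove n ∩ hyperplane (wall hn t).1 (wall hn t).2) := by
  classical
  -- The alcove is on the upper side of all levels m ≤ 0 and on the lower side of all levels m ≥ 1.
  refine ⟨?_, fun α m => if (α, m) = wall hn t then SignType.zero else if m ≤ 0 then SignType.pos
    else SignType.neg, ?_⟩
  · obtain ⟨s, hs, hst⟩ : ∃ s, s ≤ n ∧ s ≠ t := by
      rcases Nat.eq_zero_or_pos (t : ℕ) with h | h
      · exact ⟨1, hn, by omega⟩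
      · exact ⟨0, by omega, by omega⟩
    exact ⟨_, eps_initialSet_mem s, (root_wall_eps hn t hs).2 hst⟩
  · ext x
    rw [Set.mem_iInter₂]
    constructor
    · rintro ⟨h1, h2⟩ α m
      dsimp only
      split_ifs with ha hb
      · rw [← ha] at h2
        exact h2
      · have : (m : ℝ) ≤ 0 := by exact_mod_cast hb
        exact this.trans (h1 α).1
      · have : (1 : ℝ) ≤ m := by exact_mod_cast (by omega : (1 : ℤ) ≤ m)
        exact (h1 α).2.trans this
    · intro h
      refine ⟨fun α => ⟨?_, ?_⟩, ?_⟩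
      · have := h α 0
        dsimp only at this
        split_ifs at this with ha
        · simp only [halfSpace, hyperplane, Set.mem_ofPred_eq, Int.cast_zero] at this
          exact this.ge
        · simpa [halfSpace] using this
        · omega
      · have := h α 1
        dsimp only at this
        split_ifs at this with ha hb
        · simp only [halfSpace, hyperplane, Set.mem_ofPred_eq, Int.cast_one] at this
          exact this.le
        · omega
        · simpa [halfSpace] using this
      · have := h (wall hn t).1 (wall hn t).2
        simpa [halfSpace] using this

theorem eps_initialSet_succ (s : Fin (n + 1)) :
    eps (initialSet ((s : ℕ) + 1)) - eps (initialSet s) = eps {s} := by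
  refine ext_coordDiff fun i j => ?_
  simp only [map_sub, coordDiff_eps, mem_initialSet, Finset.mem_singleton, Fin.ext_iff]
  split_ifs <;> first | omega | norm_num

theorem eps_initialSet_top : eps (initialSet (n + 1)) = (0 : Apartment n) := by
  refine ext_coordDiff fun i j => ?_
  simp [i.2, j.2]

theorem eps_initialSet_zero : eps (initialSet 0) = (0 : Apartment n) := by
  refine ext_coordDiff fun i j => ?_
  simp

theorem span_eps_singleton :
    Submodule.span ℝ (Set.range fun s : Fin (n + 1) => (eps {s} : Apartment n)) = ⊤ := by
  rw [eq_top_iff]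
  rintro x -
  obtain ⟨y, rfl⟩ := exists_pt x
  have : pt y = ∑ i, y i • (eps {i} : Apartment n) := by
    refine ext_coordDiff fun i j => ?_
    simp [mul_sub]
  rw [this]
  exact Submodule.sum_mem _ fun i _ => Submodule.smul_mem _ _ (Submodule.subset_span ⟨i, rfl⟩)

theorem finrank_apartment : Module.finrank ℝ (Apartment n) = n := by
  have h := Submodule.finrank_quotient_add_finrank
    (Submodule.span ℝ {(fun _ => 1 : Fin (n + 1) → ℝ)})
  rw [finrank_span_singleton (by intro h; simpa using congrFun h 0)] at h
  simpa using h

/-- The dimension is at most n - 1 because the root is constant on the wall. It is at least n - 1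
because adding the one opposite vertex gives all vertices of the alcove, whose consecutive
differences `eps {s}` span the apartment. -/
theorem wall_mem_alcoveWalls (hn : 1 ≤ n) (t : Fin (n + 1)) : wall hn t ∈ alcoveWalls n := by
  refine ⟨isFace_alcove_inter_wall hn t, ?_⟩
  set F := fundAlcove n ∩ hyperplane (wall hn t).1 (wall hn t).2 with hF
  rw [faceDim, direction_affineSpan]
  apply le_antisymm
  · have h1 : vectorSpan ℝ F ≤ LinearMap.ker (root (wall hn t).1) := by
      rw [vectorSpan, Submodule.span_le]
      rintro _ ⟨x, hx, y, hy, rfl⟩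
      have hx := hx.2
      have hy := hy.2
      simp only [hyperplane, Set.mem_ofPred_eq] at hx hy
      simp [hx, hy]
    have h2 : root (wall hn t).1 ≠ 0 := by
      intro h
      have := root_coroot (wall hn t).1
      rw [h] at this
      simp at this
    have h3 := Module.Dual.finrank_ker_add_one_of_ne_zero (f := root (wall hn t).1) h2
    rw [finrank_apartment] at h3
    have := Submodule.finrank_mono h1
    omega
  · have hmem : ∀ s, s ≤ n + 1 → eps (initialSet s) ∈ insert (eps (initialSet t)) F := by
      intro s hs
      by_cases hst : s = t
      · left
        rw [hst]
      rcases Nat.lt_or_ge n s with h | h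
      · obtain rfl : s = n + 1 := by omega
        by_cases ht : (t : ℕ) = 0
        · left
          rw [ht, eps_initialSet_top, eps_initialSet_zero]
        · right
          rw [eps_initialSet_top, ← eps_initialSet_zero]
          exact ⟨eps_initialSet_mem 0, (root_wall_eps hn t (Nat.zero_le _)).2 (Ne.symm ht)⟩
      · right
        exact ⟨eps_initialSet_mem s, (root_wall_eps hn t h).2 hst⟩
    have htop : vectorSpan ℝ (insert (eps (initialSet t)) F) = ⊤ := by
      rw [eq_top_iff, ← span_eps_singleton, Submodule.span_le]
      rintro _ ⟨s, rfl⟩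
      have := vsub_mem_vectorSpan ℝ (hmem (s + 1) (by omega)) (hmem s (by omega))
      rwa [vsub_eq_sub, eps_initialSet_succ] at this
    have := finrank_vectorSpan_insert_le_set ℝ F (eps (initialSet t))
    rw [htop, finrank_top, finrank_apartment] at this
    exact this

/-! ### Types of vertices -/

/-- The integral points whose coordinate sum has a given class modulo `n + 1`. -/
def HasClass (v : Apartment n) (c : ZMod (n + 1)) : Prop :=
  ∃ z : Fin (n + 1) → ℤ, v = intPt z ∧ ((∑ i, z i : ℤ) : ZMod (n + 1)) = c

/-- Two integral representatives differ by a constant c, which changes the coordinate sum by (n + 1)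
c. -/
theorem HasClass.unique {v : Apartment n} {c d : ZMod (n + 1)} (hc : HasClass v c)
    (hd : HasClass v d) : c = d := by
  obtain ⟨z, rfl, rfl⟩ := hc
  obtain ⟨w, h, rfl⟩ := hd
  obtain ⟨k, hk⟩ := intPt_eq_intPt h
  rw [Finset.sum_congr rfl fun i _ => hk i, Finset.sum_add_distrib]
  have := ZMod.natCast_self (n + 1)
  push_cast at this
  simp [this]

theorem hasClass_zero : HasClass (0 : Apartment n) 0 := ⟨0, intPt_zero.symm, by simp⟩

theorem HasClass.add_eps {v : Apartment n} {c : ZMod (n + 1)} (h : HasClass v c)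
    (I : Finset (Fin (n + 1))) : HasClass (v + eps I) (c + I.card) := by
  obtain ⟨z, rfl, rfl⟩ := h
  refine ⟨z + fun i => if i ∈ I then 1 else 0, ?_, ?_⟩
  · rw [intPt_add, eps_eq_intPt]
  · simp [Finset.sum_add_distrib]

theorem hasClass_eps (I : Finset (Fin (n + 1))) : HasClass (eps I) (I.card : ZMod (n + 1)) := by
  simpa using hasClass_zero.add_eps I

/-- A reflection moves an integral point by an integral multiple of a coroot, which has coordinate
sum zero. -/
theorem HasClass.affWeylGroup {v : Apartment n} {c : ZMod (n + 1)} (h : HasClass v c)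
    {g : Apartment n ≃ᵃ[ℝ] Apartment n} (hg : g ∈ affWeylGroup n) : HasClass (g v) c := by
  have hinv : ∀ (α : PosRoot n) (m : ℤ), (affRefl α m)⁻¹ = affRefl α m := by
    intro α m
    rw [inv_eq_iff_mul_eq_one]
    ext x
    have : (affRefl α m * affRefl α m) x = affRefl α m (affRefl α m x) := rfl
    rw [this, affRefl_apply α m x, affRefl_apply]
    simp only [map_sub, map_smul, root_coroot]
    change _ = x
    module
  have key : ∀ (α : PosRoot n) (m : ℤ) (x : Apartment n), HasClass x c →
      HasClass (affRefl α m x) c := by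
    rintro α m _ ⟨z, rfl, rfl⟩
    refine ⟨z - (fun i => (z α.1.1 - z α.1.2 - m) *
      ((if i = α.1.1 then 1 else 0) - (if i = α.1.2 then 1 else 0))), ?_, ?_⟩
    · refine ext_coordDiff fun i j => ?_
      rw [affRefl_apply, map_sub, map_smul, coordDiff_coroot]
      simp only [root_eq_coordDiff, coordDiff_intPt, Pi.sub_apply, smul_eq_mul]
      push_cast
      ring
    · simp [Finset.sum_sub_distrib, ← Finset.mul_sum]
  induction hg using Subgroup.closure_induction'' generalizing v with
  | mem g hg =>
    obtain ⟨α, m, rfl⟩ := hg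
    exact key α m v h
  | inv_mem g hg =>
    obtain ⟨α, m, rfl⟩ := hg
    rw [hinv]
    exact key α m v h
  | one => exact h
  | mul g g' _ _ ih ih' => exact ih (ih' h)

/-- The integral points of the fundamental alcove are its vertices. -/
theorem exists_eq_initialSet {z : Fin (n + 1) → ℤ} (h : intPt z ∈ fundAlcove n) :
    ∃ s, s ≤ n ∧ intPt z = eps (initialSet s) := by
  have hz : ∀ i j, i < j → z j ≤ z i ∧ z i ≤ z j + 1 := by
    intro i j hij
    have := h ⟨(i, j), hij⟩
    simp only [root_eq_coordDiff, coordDiff_intPt] at this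
    constructor
    · have := this.1
      exact_mod_cast (by linarith : (z j : ℝ) ≤ z i)
    · have := this.2
      exact_mod_cast (by linarith : (z i : ℝ) ≤ z j + 1)
  -- Only two values occur, and by `hz` the larger one fills an initial segment.
  have hz' : ∀ i, z (Fin.last n) ≤ z i ∧ z i ≤ z (Fin.last n) + 1 := by
    intro i
    rcases (Fin.le_last i).eq_or_lt with rfl | h
    · omega
    · exact hz _ _ h
  have hne : (Finset.univ.filter fun i => z i = z (Fin.last n)).Nonempty := ⟨Fin.last n, by simp⟩
  set s := Finset.min' _ hne with hs
  have hs1 : z s = z (Fin.last n) := by simpa using Finset.min'_mem _ hne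
  have hs2 : ∀ i, z i = z (Fin.last n) → s ≤ i := fun i hi => Finset.min'_le _ _ (by simp [hi])
  have hval : ∀ i, z i = z (Fin.last n) + if (i : ℕ) < s then 1 else 0 := by
    intro i
    have h1 := hz' i
    split_ifs with hi
    · have : z i ≠ z (Fin.last n) := fun h => by
        have := hs2 i h
        rw [Fin.le_def] at this
        omega
      omega
    · rcases (Fin.le_def.2 (not_lt.1 hi) : s ≤ i).eq_or_lt with h | h
      · rw [← h, hs1, add_zero]
      · have := hz _ _ h
        omega
  refine ⟨s, Nat.lt_succ_iff.1 s.2, ext_coordDiff fun i j => ?_⟩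
  rw [coordDiff_intPt, hval i, hval j, coordDiff_eps]
  simp

theorem exists_affWeylGroup_alcove {v : Apartment n} {s : ℕ} (hs : s ≤ n + 1)
    (hv : HasClass v (s : ZMod (n + 1))) : ∃ g ∈ affWeylGroup n, g v = eps (initialSet s) := by
  obtain ⟨z, rfl, hz⟩ := hv
  have h1 : ((n + 1 : ℕ) : ℤ) ∣ ∑ i, z i - s := by
    rw [← ZMod.intCast_zmod_eq_zero_iff_dvd]
    push_cast at hz ⊢
    rw [hz, sub_self]
  obtain ⟨k, hk⟩ := h1
  -- The constant k does not change the point, but makes the coordinate sum zero.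
  refine ⟨translation (intPt fun i => (if i ∈ (initialSet s : Finset (Fin (n + 1))) then 1 else 0)
    - z i + k), translation_intPt_mem _ ?_, ?_⟩
  · rw [Finset.sum_add_distrib, Finset.sum_sub_distrib, Finset.sum_boole]
    simp only [Finset.filter_mem_eq_inter, Finset.univ_inter, card_initialSet hs, Finset.sum_const,
      Finset.card_univ, Fintype.card_fin, nsmul_eq_mul, ← hk]
    ring
  · refine ext_coordDiff fun i j => ?_
    simp only [AffineEquiv.constVAdd_apply, vadd_eq_add, map_add, coordDiff_intPt, coordDiff_eps]
    push_cast
    ring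

/-- The class is invariant and distinguishes the vertices of the alcove, so v is conjugate to
exactly one of them, and that one misses only the opposite wall. -/
theorem wall_mem_faceType_iff (hn : 1 ≤ n) {v : Apartment n} {s t : ℕ} (hs : s ≤ n) (ht : t < n + 1)
    (hv : HasClass v (s : ZMod (n + 1))) : wall hn ⟨t, ht⟩ ∈ faceType {v} ↔ s ≠ t := by
  constructor
  · rintro ⟨-, g, hg, h1, h2⟩
    simp only [Set.image_singleton, Set.singleton_subset_iff] at h1 h2
    have hc := hv.affWeylGroup hg
    obtain ⟨z, hz, -⟩ := id hc
    rw [hz] at h1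
    obtain ⟨s', hs', he⟩ := exists_eq_initialSet h1
    rw [hz, he] at h2 hc
    have h3 := (hasClass_eps (initialSet s' : Finset (Fin (n + 1)))).unique hc
    rw [card_initialSet (by omega), ZMod.natCast_eq_natCast_iff', Nat.mod_eq_of_lt (by omega),
      Nat.mod_eq_of_lt (by omega)] at h3
    rw [← h3]
    exact (root_wall_eps hn ⟨t, ht⟩ hs').1 h2
  · intro hst
    obtain ⟨g, hg, he⟩ := exists_affWeylGroup_alcove (by omega) hv
    refine ⟨wall_mem_alcoveWalls hn _, g, hg, ?_, ?_⟩
    · simpa [he] using eps_initialSet_mem s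
    · simpa [he] using (root_wall_eps hn ⟨t, ht⟩ hs).2 hst

/-- Vertices of the same type have the same class. -/
theorem HasClass.eq_of_faceType_eq (hn : 1 ≤ n) {v w : Apartment n} {c d : ZMod (n + 1)}
    (hv : HasClass v c) (hw : HasClass w d) (h : faceType {v} = faceType {w}) : c = d := by
  rw [← ZMod.natCast_zmod_val c] at hv ⊢
  rw [← ZMod.natCast_zmod_val d] at hw ⊢
  have hc := ZMod.val_lt c
  have hd := ZMod.val_lt d
  by_contra hne
  have h1 := (wall_mem_faceType_iff hn (Nat.lt_succ_iff.1 hc) hd hv).2 fun h => hne (by rw [h])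
  rw [h, wall_mem_faceType_iff hn (Nat.lt_succ_iff.1 hd) hd hw] at h1
  exact h1 rfl

theorem faceType_image {g : Apartment n ≃ᵃ[ℝ] Apartment n} (hg : g ∈ affWeylGroup n)
    (F : Set (Apartment n)) : faceType (g '' F) = faceType F := by
  have key : ∀ (g : Apartment n ≃ᵃ[ℝ] Apartment n) (F : Set (Apartment n)), g ∈ affWeylGroup n →
      faceType (g '' F) ⊆ faceType F := by
    rintro g F hg p ⟨hp, k, hk, h1, h2⟩
    have h : k '' (g '' F) = (k * g) '' F := by
      rw [Set.image_image]
      rfl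
    rw [h] at h1 h2
    exact ⟨hp, k * g, mul_mem hk hg, h1, h2⟩
  refine (key g F hg).antisymm ?_
  have h : (g⁻¹ : Apartment n ≃ᵃ[ℝ] Apartment n) '' (g '' F) = F := by
    rw [Set.image_image]
    have : ∀ x, (g⁻¹ : Apartment n ≃ᵃ[ℝ] Apartment n) (g x) = x := g.symm_apply_apply
    simp [this]
  have h2 := key g⁻¹ (g '' F) (inv_mem hg)
  rwa [h] at h2

/-! ### Galleries as sequences of index sets -/

/-- The gallery that starts at the origin and has the steps `∑_{i ∈ I k} ε_i`. -/
def galleryOfSteps {r : ℕ} (I : Fin r → Finset (Fin (n + 1))) : Gallery n where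
  len := r
  vert k := Fin.partialSum (fun j => eps (I j)) k
  edge k := seg (Fin.partialSum (fun j => eps (I j)) k.castSucc) (I k)

theorem fundEdge_eq (i : Fin n) : fundEdge i = seg 0 (initialSet ((i : ℕ) + 1)) := by
  ext x
  constructor
  · rintro ⟨h, t, ht, rfl⟩
    rw [fundCoweight_eq] at h ⊢
    refine ⟨t, ht, ?_, by simp⟩
    -- The highest root takes the value t, and the alcove bounds it by 1.
    have := (h ⟨(0, Fin.last n), by rw [Fin.lt_def]; simpa using i.pos⟩).2
    simpa [root_eq_coordDiff, not_lt.2 (Nat.succ_le_of_lt i.2)] using this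
  · rintro ⟨t, h0, h1, rfl⟩
    rw [zero_add]
    refine ⟨fun α => ?_, t, h0, by rw [fundCoweight_eq]⟩
    have := eps_initialSet_mem (n := n) ((i : ℕ) + 1) α
    rw [map_smul, smul_eq_mul]
    exact ⟨mul_nonneg h0 this.1, mul_le_one₀ h1 this.1 this.2⟩

theorem galleryOf_eq (lam : Fin n → ℕ) :
    galleryOf lam = galleryOfSteps fun k => initialSet (((stepList lam).get k : ℕ) + 1) := by
  have hv : ∀ k : Fin ((stepList lam).length + 1),
      (((stepList lam).take k).map fundCoweight).sum = Fin.partialSum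
        (fun j => (eps (initialSet (((stepList lam).get j : ℕ) + 1)) : Apartment n)) k := by
    intro k
    rw [Fin.partialSum]
    have : (fun j => (eps (initialSet (((stepList lam).get j : ℕ) + 1)) : Apartment n)) =
        fundCoweight ∘ (stepList lam).get := by
      funext j
      simp [fundCoweight_eq]
    rw [this, ← List.map_ofFn, List.ofFn_get, List.map_take]
  rw [galleryOf, galleryOfSteps]
  congr 1
  · funext k
    exact hv k
  · funext k
    rw [fundEdge_eq]
    ext x
    rw [← hv]
    simp only [seg, Set.mem_ofPred_eq, zero_add, sub_eq_iff_eq_add']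
    rfl

theorem galleryOfSteps_vert_succ {r : ℕ} (I : Fin r → Finset (Fin (n + 1))) (k : Fin r) :
    (galleryOfSteps I).vert k.succ = (galleryOfSteps I).vert k.castSucc + eps (I k) :=
  Fin.partialSum_succ _ _

theorem exists_intPt_partialSum {r : ℕ} (I : Fin r → Finset (Fin (n + 1))) (k : Fin (r + 1)) :
    ∃ z, Fin.partialSum (fun j => (eps (I j) : Apartment n)) k = intPt z ∧
      ∑ i, z i = Fin.partialSum (fun j => ((I j).card : ℤ)) k := by
  induction k using Fin.induction with
  | zero => exact ⟨0, by rw [Fin.partialSum_zero, intPt_zero], by simp⟩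
  | succ k ih =>
    obtain ⟨z, h1, h2⟩ := ih
    refine ⟨z + fun i => if i ∈ I k then 1 else 0, ?_, ?_⟩
    · rw [Fin.partialSum_succ, h1, intPt_add, eps_eq_intPt]
    · rw [Fin.partialSum_succ, ← h2]
      simp [Finset.sum_add_distrib]

theorem exists_perm_map_eq {I J : Finset (Fin (n + 1))} (h : I.card = J.card) :
    ∃ σ : Equiv.Perm (Fin (n + 1)), I.map σ.toEmbedding = J := by
  have e : {x // x ∈ I} ≃ {x // x ∈ J} := Finset.equivOfCardEq h
  refine ⟨e.extendSubtype, Finset.eq_of_subset_of_card_le ?_ (by simp [h])⟩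
  intro x hx
  obtain ⟨y, hy, rfl⟩ := Finset.mem_map.1 hx
  exact e.extendSubtype_mem y hy

theorem image_seg (g : Apartment n ≃ᵃ[ℝ] Apartment n) (v : Apartment n)
    (I : Finset (Fin (n + 1))) {J : Finset (Fin (n + 1))} {w : Apartment n}
    (h : ∀ t : ℝ, g (v + t • eps I) = w + t • eps J) :
    g '' seg v I = seg w J := by
  ext x
  constructor
  · rintro ⟨_, ⟨t, h0, h1, rfl⟩, rfl⟩
    exact ⟨t, h0, h1, h t⟩
  · rintro ⟨t, h0, h1, rfl⟩
    exact ⟨_, ⟨t, h0, h1, rfl⟩, h t⟩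

/-- The k-th vertices have equal coordinate sums, so a translation in the affine Weyl group matches
them; a permutation about the common vertex then takes the one step to the other. -/
theorem galleryType_galleryOfSteps {r : ℕ} {I J : Fin r → Finset (Fin (n + 1))}
    (h : ∀ k, (I k).card = (J k).card) :
    galleryType (galleryOfSteps I) = galleryType (galleryOfSteps J) := by
  have hc : (fun j => ((I j).card : ℤ)) = fun j => ((J j).card : ℤ) := by
    funext j
    rw [h]
  have hvert : ∀ k : Fin (r + 1), faceType {Fin.partialSum (fun j => (eps (I j) : Apartment n)) k} =
      faceType {Fin.partialSum (fun j => (eps (J j) : Apartment n)) k} := by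
    intro k
    obtain ⟨z, hz, hz'⟩ := exists_intPt_partialSum I k
    obtain ⟨w, hw, hw'⟩ := exists_intPt_partialSum J k
    have hg : translation (intPt (w - z)) ∈ affWeylGroup n :=
      translation_intPt_mem _ (by simp [hz', hw', hc])
    have := faceType_image hg {intPt z}
    rw [Set.image_singleton] at this
    simp only [AffineEquiv.constVAdd_apply, vadd_eq_add, ← intPt_add, sub_add_cancel] at this
    rw [hz, hw, this]
  have hedge : ∀ k : Fin r,
      faceType (seg (Fin.partialSum (fun j => (eps (I j) : Apartment n)) k.castSucc) (I k)) =
      faceType (seg (Fin.partialSum (fun j => (eps (J j) : Apartment n)) k.castSucc) (J k)) := by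
    intro k
    obtain ⟨z, hz, hz'⟩ := exists_intPt_partialSum I k.castSucc
    obtain ⟨w, hw, hw'⟩ := exists_intPt_partialSum J k.castSucc
    have hg : translation (intPt (w - z)) ∈ affWeylGroup n :=
      translation_intPt_mem _ (by simp [hz', hw', hc])
    obtain ⟨σ, hσ⟩ := exists_perm_map_eq (h k)
    obtain ⟨g, hg', hgx⟩ := exists_affWeylGroup_perm w σ
    have h1 := faceType_image hg (seg (intPt z) (I k))
    have h2 := faceType_image hg' (seg (intPt w) (I k))
    rw [image_seg (w := intPt w) (J := I k)] at h1
    · rw [image_seg (w := intPt w) (J := J k)] at h2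
      · rw [hz, hw, h2, h1]
      · intro t
        rw [hgx, add_sub_cancel_left, map_smul, permAct_eps, hσ]
    · intro t
      simp only [AffineEquiv.constVAdd_apply, vadd_eq_add]
      rw [intPt_sub]
      abel
  exact Prod.ext (congrArg List.ofFn (funext hvert)) (congrArg List.ofFn (funext hedge))

/-- The sequences of index sets with the cardinalities prescribed by `λ`. -/
def HasStepSizes (lam : Fin n → ℕ) (I : Fin (stepList lam).length → Finset (Fin (n + 1))) : Prop :=
  ∀ k, (I k).card = ((stepList lam).get k : ℕ) + 1

theorem HasStepSizes.nonempty {lam : Fin n → ℕ}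
    {I : Fin (stepList lam).length → Finset (Fin (n + 1))} (h : HasStepSizes lam I) (k) :
    (I k).Nonempty := by
  rw [← Finset.card_pos, h]
  omega

theorem HasStepSizes.ne_univ {lam : Fin n → ℕ}
    {I : Fin (stepList lam).length → Finset (Fin (n + 1))} (h : HasStepSizes lam I) (k) :
    I k ≠ Finset.univ := by
  intro he
  have := h k
  rw [he, Finset.card_univ, Fintype.card_fin] at this
  have := ((stepList lam).get k).2
  omega

theorem galleryOfSteps_mem {lam : Fin n → ℕ}
    {I : Fin (stepList lam).length → Finset (Fin (n + 1))} (h : HasStepSizes lam I) :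
    galleryOfSteps I ∈ galleries lam := by
  have hv : ∀ k, ∃ z, (galleryOfSteps I).vert k = intPt z := fun k => by
    obtain ⟨z, hz, -⟩ := exists_intPt_partialSum I k
    exact ⟨z, hz⟩
  refine ⟨⟨⟨fun k => ?_, fun k => ?_, fun k => ⟨left_mem_seg _ _, ?_⟩⟩, ?_, ?_⟩, ?_, ?_⟩
  · obtain ⟨z, hz⟩ := hv k
    rw [hz]
    exact isVertex_intPt z
  · obtain ⟨z, hz⟩ := hv (Fin.castSucc k)
    have : (galleryOfSteps I).edge k = seg ((galleryOfSteps I).vert (Fin.castSucc k)) (I k) := rfl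
    rw [this, hz]
    exact isEdge_seg z (h.nonempty k) (h.ne_univ k)
  · exact (galleryOfSteps_vert_succ I k).symm ▸
      right_mem_seg ((galleryOfSteps I).vert (Fin.castSucc k)) (I k)
  · obtain ⟨z, hz⟩ := hv 0
    rw [hz]
    exact isSpecial_intPt z
  · obtain ⟨z, hz⟩ := hv (Fin.last _)
    rw [hz]
    exact isSpecial_intPt z
  · rw [HasType, galleryOf_eq]
    refine galleryType_galleryOfSteps fun k => ?_
    rw [h k, card_initialSet (by omega)]
  · exact Fin.partialSum_zero fun j => eps (I j)

/-- The types fix the classes of the vertices. Consecutive classes differ by a number between 1 and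
n, so the ends of an edge are distinct and the edge is a segment; the size of its index set is known
modulo n + 1 and hence known. -/
theorem exists_galleryOfSteps (hn : 1 ≤ n) {lam : Fin n → ℕ} {δ : Gallery n}
    (h : δ ∈ galleries lam) : ∃ I, HasStepSizes lam I ∧ δ = galleryOfSteps I := by
  obtain ⟨len, vert, edge⟩ := δ
  obtain ⟨⟨⟨hvert, hedge, hmem⟩, -, -⟩, htype, h0⟩ := h
  dsimp only at hvert hedge hmem h0
  rw [HasType, galleryOf_eq, galleryType, galleryType, Prod.mk.injEq] at htype
  obtain ⟨ht, -⟩ := htype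
  have hlen : len = (stepList lam).length := by
    have := congrArg List.length ht
    simpa [galleryOfSteps] using this
  subst hlen
  have ht := fun k => congrFun (List.ofFn_injective ht) k
  dsimp only at ht
  set J : Fin (stepList lam).length → Finset (Fin (n + 1)) :=
    fun k => initialSet (((stepList lam).get k : ℕ) + 1) with hJ
  have hclassJ : ∀ k, HasClass ((galleryOfSteps J).vert k)
      (((Fin.partialSum (fun j => ((J j).card : ℤ)) k : ℤ)) : ZMod (n + 1)) := by
    intro k
    obtain ⟨z, h1, h2⟩ := exists_intPt_partialSum J k
    exact ⟨z, h1, by rw [h2]⟩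
  choose z hz using fun k => (hvert k).exists_intPt
  have hclass : ∀ k, HasClass (vert k)
      (((Fin.partialSum (fun j => ((J j).card : ℤ)) k : ℤ)) : ZMod (n + 1)) := by
    intro k
    have : HasClass (vert k) ((∑ i, z k i : ℤ) : ZMod (n + 1)) := ⟨z k, hz k, rfl⟩
    rwa [this.eq_of_faceType_eq hn (hclassJ k) (ht k)] at this
  have hstep : ∀ k : Fin (stepList lam).length, HasClass (vert k.succ)
      ((((Fin.partialSum (fun j => ((J j).card : ℤ)) k.castSucc : ℤ)) : ZMod (n + 1)) +
        (J k).card) := by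
    intro k
    have := hclass k.succ
    rw [Fin.partialSum_succ] at this
    simpa using this
  have hJcard : ∀ k, (J k).card = ((stepList lam).get k : ℕ) + 1 := fun k =>
    card_initialSet (by omega)
  have key : ∀ k : Fin (stepList lam).length, ∃ I : Finset (Fin (n + 1)),
      I.card = (J k).card ∧ vert k.succ = vert k.castSucc + eps I ∧
        edge k = seg (vert k.castSucc) I := by
    intro k
    have hlt := ((stepList lam).get k).2
    have hmk := hmem k
    rw [hz k.castSucc, hz k.succ] at hmk
    -- Equal ends would make n + 1 divide the step size, which is between 1 and n.
    have hne : intPt (z k.castSucc) ≠ intPt (z k.succ) := by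
      rw [← hz, ← hz]
      intro he
      have h1 := hstep k
      rw [← he] at h1
      have h2 := (hclass k.castSucc).unique h1
      rw [left_eq_add, ZMod.natCast_eq_zero_iff] at h2
      have := Nat.le_of_dvd (by rw [hJcard]; omega) h2
      rw [hJcard] at this
      omega
    obtain ⟨I, hI, hI', h1, h2⟩ := (hedge k).eq_seg hmk.1 hmk.2 hne
    rw [← hz, ← hz] at h1
    rw [← hz] at h2
    refine ⟨I, ?_, h1, h2⟩
    have h3 := (hclass k.castSucc).add_eps I
    rw [← h1] at h3
    have h4 := h3.unique (hstep k)
    have h5 : I.card < n + 1 := by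
      simpa using (Finset.card_lt_iff_ne_univ I).2 hI'
    rw [add_right_inj, ZMod.natCast_eq_natCast_iff', Nat.mod_eq_of_lt h5,
      Nat.mod_eq_of_lt (by rw [hJcard]; omega)] at h4
    exact h4
  choose I hI1 hI2 hI3 using key
  have hv : vert = Fin.partialSum fun j => eps (I j) := by
    funext k
    induction k using Fin.induction with
    | zero => rw [h0, Fin.partialSum_zero]
    | succ k ih => rw [hI2, ih, Fin.partialSum_succ]
  refine ⟨I, fun k => (hI1 k).trans (hJcard k), ?_⟩
  rw [galleryOfSteps]
  congr 1
  · funext k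
    rw [hI3, hv]

/-! ### Counting functions of finite sets -/

/-- The number of elements of `A` that are at most `x`. -/
def countLE {N : ℕ} (A : Finset (Fin N)) (x : Fin N) : ℕ := (A.filter (· ≤ x)).card

theorem lt_countLE_iff {N : ℕ} {A : Finset (Fin N)} {x : Fin N} {i : ℕ} :
    i < countLE A x ↔ ∃ h : i < A.card, A.orderEmbOfFin rfl ⟨i, h⟩ ≤ x := by
  constructor
  · intro h
    have hi : i < A.card := h.trans_le (Finset.card_filter_le _ _)
    refine ⟨hi, ?_⟩
    by_contra! hx
    have hsub : A.filter (· ≤ x) ⊆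
        (Finset.univ.filter fun j : Fin A.card => (j : ℕ) < i).image (A.orderEmbOfFin rfl) := by
      intro y hy
      rw [Finset.mem_filter] at hy
      obtain ⟨j, rfl⟩ : y ∈ Set.range (A.orderEmbOfFin rfl) := by
        rw [Finset.range_orderEmbOfFin]
        exact hy.1
      refine Finset.mem_image_of_mem _ ?_
      simp only [Finset.mem_filter, Finset.mem_univ, true_and]
      have := (A.orderEmbOfFin rfl).lt_iff_lt.1 (hy.2.trans_lt hx)
      exact this
    have := (Finset.card_le_card hsub).trans Finset.card_image_le
    rw [Fin.card_filter_val_lt] at this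
    have h2 : i < (A.filter (· ≤ x)).card := h
    omega
  · rintro ⟨hi, hx⟩
    have hsub : (Finset.univ.filter fun j : Fin A.card => (j : ℕ) < i + 1).image
        (A.orderEmbOfFin rfl) ⊆ A.filter (· ≤ x) := by
      intro y hy
      obtain ⟨j, hj, rfl⟩ := Finset.mem_image.1 hy
      simp only [Finset.mem_filter, Finset.mem_univ, true_and] at hj
      refine Finset.mem_filter.2 ⟨Finset.orderEmbOfFin_mem _ _ _, le_trans ?_ hx⟩
      exact (A.orderEmbOfFin rfl).monotone (Fin.le_def.2 (Nat.lt_succ_iff.1 hj))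
    have := Finset.card_le_card hsub
    rw [Finset.card_image_of_injective _ (A.orderEmbOfFin rfl).injective,
      Fin.card_filter_val_lt] at this
    change i < (A.filter (· ≤ x)).card
    omega

/-- Comparing order statistics is comparing counting functions. The counting form is easy to follow
through inclusions, exchanges and chains of columns. -/
theorem countLE_le_iff {N : ℕ} {A B : Finset (Fin N)} (h : A.card ≤ B.card) :
    (∀ x, countLE A x ≤ countLE B x) ↔ ∀ i (hi : i < A.card),
      B.orderEmbOfFin rfl ⟨i, hi.trans_le h⟩ ≤ A.orderEmbOfFin rfl ⟨i, hi⟩ := by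
  constructor
  · intro hx i hi
    obtain ⟨_, h2⟩ := lt_countLE_iff.1
      ((lt_countLE_iff.2 ⟨hi, le_rfl⟩).trans_le (hx (A.orderEmbOfFin rfl ⟨i, hi⟩)))
    exact h2
  · intro hi x
    by_contra! hcon
    obtain ⟨h1, h2⟩ := lt_countLE_iff.1 hcon
    exact lt_irrefl _ (lt_countLE_iff.2 ⟨h1.trans_le h, (hi _ h1).trans h2⟩)

/-! ### The diagram -/

/-- In a sorted list the entries that are at least i form a final segment, so their number is
detected by the entry at position j from the end. -/
theorem lt_countP_iff_of_pairwise (l : List (Fin n)) (hl : l.Pairwise (· ≤ ·)) (i j : ℕ) :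
    j < l.countP (fun k : Fin n => decide (i ≤ (k : ℕ))) ↔
      ∃ h : j < l.length, i ≤ (l.get (Fin.rev ⟨j, h⟩) : ℕ) := by
  induction l with
  | nil => simp
  | cons a t ih =>
    rw [List.pairwise_cons] at hl
    have ih := ih hl.2
    by_cases hia : i ≤ (a : ℕ)
    · have hall : (a :: t).countP (fun k : Fin n => decide (i ≤ (k : ℕ))) = (a :: t).length := by
        rw [List.countP_eq_length]
        intro b hb
        rcases List.mem_cons.1 hb with rfl | hb
        · simpa using hia
        · simpa using hia.trans (hl.1 b hb)
      rw [hall]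
      refine ⟨fun h => ⟨h, ?_⟩, fun h => h.1⟩
      have hb := List.get_mem (a :: t) (Fin.rev ⟨j, h⟩)
      rcases List.mem_cons.1 hb with hb | hb
      · rw [hb]
        exact hia
      · exact hia.trans (hl.1 _ hb)
    · rw [List.countP_cons_of_neg (by simpa using hia), ih]
      have e : ∀ (h : j < t.length) (h' : j < (a :: t).length),
          (a :: t).get (Fin.rev ⟨j, h'⟩) = t.get (Fin.rev ⟨j, h⟩) := by
        intro h h'
        have : Fin.rev ⟨j, h'⟩ = Fin.succ (Fin.rev ⟨j, h⟩) := by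
          ext
          simp [Fin.val_rev]
          omega
        rw [this]
        rfl
      constructor
      · rintro ⟨h, h2⟩
        have h' : j < (a :: t).length := by simp; omega
        exact ⟨h', by rwa [e h h']⟩
      · rintro ⟨h, h2⟩
        have h' : j < t.length + 1 := by simpa using h
        rcases Nat.lt_succ_iff_lt_or_eq.1 h' with h3 | rfl
        · exact ⟨h3, by rwa [e h3 h] at h2⟩
        · simp [Fin.rev] at h2
          omega

theorem pairwise_stepList (lam : Fin n → ℕ) : (stepList lam).Pairwise (· ≤ ·) := by
  rw [stepList, List.pairwise_flatMap]
  refine ⟨fun a _ => ?_, (List.pairwise_lt_finRange n).imp fun {a b} hab x hx y hy => ?_⟩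
  · simp [List.pairwise_replicate]
  · rw [List.eq_of_mem_replicate hx, List.eq_of_mem_replicate hy]
    exact hab.le

theorem rowLen_eq_countP (lam : Fin n → ℕ) (i : ℕ) :
    rowLen lam i = (stepList lam).countP fun k : Fin n => decide (i ≤ (k : ℕ)) := by
  rw [rowLen, stepList, List.countP_flatMap, Finset.sum_filter, Fin.sum_univ_def]
  congr 2
  funext k
  simp [List.countP_replicate]

/-- This passes from row lengths to column lengths: column j is as long as the size of the j-th step
counted from the end. -/
theorem mem_diagram_iff {lam : Fin n → ℕ} {i j : ℕ} :
    (i, j) ∈ diagram lam ↔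
      ∃ h : j < (stepList lam).length, i < ((stepList lam).get (Fin.rev ⟨j, h⟩) : ℕ) + 1 := by
  have h1 : (i, j) ∈ diagram lam ↔ (i < n ∧ j < rowLen lam 0) ∧ j < rowLen lam i := by
    rw [← YoungDiagram.mem_cells]
    simp [diagram]
  simp only [Nat.lt_succ_iff, ← lt_countP_iff_of_pairwise _ (pairwise_stepList lam),
    ← rowLen_eq_countP, h1, and_iff_right_iff_imp]
  intro h
  refine ⟨?_, h.trans_le (rowLen_anti lam (Nat.zero_le i))⟩
  rw [rowLen_eq_countP, lt_countP_iff_of_pairwise _ (pairwise_stepList lam)] at h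
  obtain ⟨h, h2⟩ := h
  exact h2.trans_lt (Fin.is_lt _)

/-! ### Tableaux as sequences of columns -/

/-- The tableau whose columns, from right to left, are the sets `I k`. -/
def tableauOfSteps {r : ℕ} (I : Fin r → Finset (Fin (n + 1))) (i j : ℕ) : ℕ :=
  if h : j < r then
    if h' : i < (I (Fin.rev ⟨j, h⟩)).card then
      ((I (Fin.rev ⟨j, h⟩)).orderEmbOfFin rfl ⟨i, h'⟩ : ℕ) + 1
    else 0
  else 0

theorem columnSet_eps {I : Finset (Fin (n + 1))} (hI : I.Nonempty) (hI' : I ≠ Finset.univ) :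
    columnSet (eps I) = I := by
  have h : ∃ J : Finset (Fin (n + 1)), (J.Nonempty ∧ J ≠ Finset.univ) ∧ eps I = eps J :=
    ⟨I, ⟨hI, hI'⟩, rfl⟩
  rw [columnSet, dif_pos h]
  exact eps_injOn h.choose_spec.1 ⟨hI, hI'⟩ h.choose_spec.2.symm

theorem getD_sort (J : Finset (Fin (n + 1))) (i : ℕ) :
    ((J.sort (· ≤ ·)).map fun a : Fin (n + 1) => (a : ℕ) + 1).getD i 0 =
      if h : i < J.card then (J.orderEmbOfFin rfl ⟨i, h⟩ : ℕ) + 1 else 0 := by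
  split_ifs with h
  · rw [List.getD_eq_getElem _ _ (by simpa using h), List.getElem_map,
      Finset.orderEmbOfFin_apply]
    simp
  · rw [List.getD_eq_default _ _ (by simpa using h)]

theorem tableauOf_galleryOfSteps {r : ℕ} {I : Fin r → Finset (Fin (n + 1))}
    (hI : ∀ k, (I k).Nonempty) (hI' : ∀ k, I k ≠ Finset.univ) :
    tableauOf (galleryOfSteps I) = tableauOfSteps I := by
  funext i j
  rw [tableauOf, tableauOfSteps]
  change (if h : j < r then _ else _) = _
  by_cases h : j < r
  · have hk : (⟨r - 1 - j, by omega⟩ : Fin r) = Fin.rev ⟨j, h⟩ := by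
      ext
      simp [Fin.val_rev]
      omega
    have hset : ∀ k : Fin r, columnSet ((galleryOfSteps I).vert (Fin.succ k) -
        (galleryOfSteps I).vert (Fin.castSucc k)) = I k := by
      intro k
      have h1 : (galleryOfSteps I).vert (Fin.succ k) - (galleryOfSteps I).vert (Fin.castSucc k) =
          eps (I k) := sub_eq_iff_eq_add'.2 (galleryOfSteps_vert_succ I k)
      rw [h1, columnSet_eps (hI k) (hI' k)]
    rw [dif_pos h, dif_pos h, ← getD_sort, ← hk, ← hset]
    rfl
  · rw [dif_neg h, dif_neg h]

theorem mem_iff_exists_tableauOfSteps {r : ℕ} (I : Fin r → Finset (Fin (n + 1))) {j : ℕ} (h : j < r)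
    (x : Fin (n + 1)) : x ∈ I (Fin.rev ⟨j, h⟩) ↔
      ∃ i, i < (I (Fin.rev ⟨j, h⟩)).card ∧ tableauOfSteps I i j = x + 1 := by
  constructor
  · intro hx
    obtain ⟨i, rfl⟩ : x ∈ Set.range ((I (Fin.rev ⟨j, h⟩)).orderEmbOfFin rfl) := by
      rw [Finset.range_orderEmbOfFin]
      exact hx
    exact ⟨i, i.2, by rw [tableauOfSteps, dif_pos h, dif_pos i.2]⟩
  · rintro ⟨i, hi, hx⟩
    rw [tableauOfSteps, dif_pos h, dif_pos hi] at hx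
    have : (I (Fin.rev ⟨j, h⟩)).orderEmbOfFin rfl ⟨i, hi⟩ = x := by
      ext
      omega
    rw [← this]
    exact Finset.orderEmbOfFin_mem _ _ _

section

variable {lam : Fin n → ℕ} {I : Fin (stepList lam).length → Finset (Fin (n + 1))}

theorem HasStepSizes.mem_diagram_iff (hI : HasStepSizes lam I) {i j : ℕ} :
    (i, j) ∈ diagram lam ↔
      ∃ h : j < (stepList lam).length, i < (I (Fin.rev ⟨j, h⟩)).card := by
  rw [OneSkeleton.mem_diagram_iff]
  simp only [hI _]

theorem HasStepSizes.tableau_eq (_ : HasStepSizes lam I) {i j : ℕ}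
    (h : j < (stepList lam).length) (h' : i < (I (Fin.rev ⟨j, h⟩)).card) :
    tableauOfSteps I i j = ((I (Fin.rev ⟨j, h⟩)).orderEmbOfFin rfl ⟨i, h'⟩ : ℕ) + 1 := by
  rw [tableauOfSteps, dif_pos h, dif_pos h']

theorem HasStepSizes.tableau_rev (hI : HasStepSizes lam I) {i : ℕ}
    (k : Fin (stepList lam).length) (h : i < (I k).card) :
    tableauOfSteps I i (Fin.rev k : Fin _) = ((I k).orderEmbOfFin rfl ⟨i, h⟩ : ℕ) + 1 := by
  obtain ⟨⟨j, hj⟩, rfl⟩ := Fin.rev_surjective k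
  have e : ((Fin.rev (Fin.rev ⟨j, hj⟩) : Fin (stepList lam).length) : ℕ) = j := by rw [Fin.rev_rev]
  rw [e]
  exact hI.tableau_eq hj h

theorem HasStepSizes.isYoungTableau (hI : HasStepSizes lam I) :
    IsYoungTableau lam (tableauOfSteps I) := by
  refine ⟨fun i j hij => ?_, fun i i' j hii hij => ?_, fun i j hij => ?_⟩
  · obtain ⟨h, h'⟩ := hI.mem_diagram_iff.1 hij
    rw [hI.tableau_eq h h']
    omega
  · obtain ⟨h, h'⟩ := hI.mem_diagram_iff.1 hij
    rw [hI.tableau_eq h h', hI.tableau_eq h (hii.trans h'), add_lt_add_iff_right]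
    exact ((I (Fin.rev ⟨j, h⟩)).orderEmbOfFin rfl).strictMono hii
  · rw [hI.mem_diagram_iff] at hij
    push Not at hij
    rw [tableauOfSteps]
    split_ifs with h h'
    · exact absurd h' (not_lt.2 (hij h))
    · rfl
    · rfl

theorem tableauOfSteps_injOn : Set.InjOn tableauOfSteps {I | HasStepSizes lam I} := by
  intro I hI J hJ h
  funext k
  obtain ⟨j, rfl⟩ := Fin.rev_surjective k
  ext x
  have hc : (I (Fin.rev j)).card = (J (Fin.rev j)).card := (hI _).trans (hJ _).symm
  rw [mem_iff_exists_tableauOfSteps I j.2, mem_iff_exists_tableauOfSteps J j.2, h]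
  simp only [Fin.eta, hc]

theorem exists_tableauOfSteps {T : ℕ → ℕ → ℕ} (hT : IsYoungTableau lam T) :
    ∃ I, HasStepSizes lam I ∧ tableauOfSteps I = T := by
  obtain ⟨h1, h2, h3⟩ := hT
  have hmem : ∀ (k : Fin (stepList lam).length) (i : ℕ), i < ((stepList lam).get k : ℕ) + 1 →
      (i, (Fin.rev k : ℕ)) ∈ diagram lam := by
    intro k i hi
    refine OneSkeleton.mem_diagram_iff.2 ⟨(Fin.rev k).2, ?_⟩
    rwa [Fin.eta, Fin.rev_rev]
  -- The letters 1, …, n + 1 become indices by subtracting 1; down a column they stay strictly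
  -- increasing.
  let f : ∀ k : Fin (stepList lam).length, Fin (((stepList lam).get k : ℕ) + 1) → Fin (n + 1) :=
    fun k i => ⟨T i (Fin.rev k) - 1, by
      have := h1 _ _ (hmem k i i.2)
      omega⟩
  have hf : ∀ k, StrictMono (f k) := by
    intro k i i' hii
    have a1 := h1 _ _ (hmem k i i.2)
    have a2 := h2 i i' (Fin.rev k) hii (hmem k i' i'.2)
    rw [Fin.lt_def]
    change T i (Fin.rev k) - 1 < T i' (Fin.rev k) - 1
    omega
  have hcard : ∀ k, (Finset.univ.image (f k)).card = ((stepList lam).get k : ℕ) + 1 := by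
    intro k
    rw [Finset.card_image_of_injective _ (hf k).injective]
    simp
  have hI : HasStepSizes lam fun k => Finset.univ.image (f k) := hcard
  refine ⟨fun k => Finset.univ.image (f k), hI, ?_⟩
  funext i j
  by_cases hij : (i, j) ∈ diagram lam
  · obtain ⟨h, h'⟩ := hI.mem_diagram_iff.1 hij
    rw [hI.tableau_eq h h']
    -- The increasing enumeration of a finite set is unique, so reading the set off again returns
    -- the column.
    have hu := Finset.orderEmbOfFin_unique (s := Finset.univ.image (f (Fin.rev ⟨j, h⟩))) (hcard _)
      (f := f (Fin.rev ⟨j, h⟩)) (by simp) (hf _)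
    have h4 : i < ((stepList lam).get (Fin.rev ⟨j, h⟩) : ℕ) + 1 := by
      rw [← hcard]
      exact h'
    have h5 : (Finset.univ.image (f (Fin.rev ⟨j, h⟩))).orderEmbOfFin rfl ⟨i, h'⟩ =
        f (Fin.rev ⟨j, h⟩) ⟨i, h4⟩ := by
      have := congrFun hu ⟨i, h4⟩
      rw [this, Finset.orderEmbOfFin_apply, Finset.orderEmbOfFin_apply]
      rfl
    rw [h5]
    have := h1 _ _ hij
    change T i (Fin.rev (Fin.rev ⟨j, h⟩) : Fin _) - 1 + 1 = T i j
    rw [Fin.rev_rev]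
    dsimp only
    omega
  · rw [hI.isYoungTableau.2.2 i j hij, h3 i j hij]

/-- Columns are in reverse order of steps: the left neighbour of the column of step k is the column
of step k + 1. -/
theorem HasStepSizes.isMinimalTableau_iff (hI : HasStepSizes lam I) :
    IsMinimalTableau lam (tableauOfSteps I) ↔
      ∀ (k : ℕ) (hk : k + 1 < (stepList lam).length), I ⟨k, by omega⟩ ⊆ I ⟨k + 1, hk⟩ := by
  rw [IsMinimalTableau, and_iff_right hI.isYoungTableau]
  constructor
  · intro h k hk x hx
    have hj : (stepList lam).length - (k + 1) - 1 + 1 < (stepList lam).length := by omega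
    have e1 : (⟨k, by omega⟩ : Fin (stepList lam).length) = Fin.rev ⟨_, hj⟩ := by
      ext
      simp [Fin.val_rev]
      omega
    have hj' : (stepList lam).length - (k + 1) - 1 < (stepList lam).length := by omega
    have e2 : (⟨k + 1, hk⟩ : Fin (stepList lam).length) = Fin.rev ⟨_, hj'⟩ := by
      ext
      simp [Fin.val_rev]
      omega
    rw [e1, mem_iff_exists_tableauOfSteps I hj] at hx
    obtain ⟨i, hi, hx⟩ := hx
    obtain ⟨i', hi', he⟩ := h i _ (hI.mem_diagram_iff.2 ⟨hj, hi⟩)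
    obtain ⟨_, hi'⟩ := hI.mem_diagram_iff.1 hi'
    rw [e2, mem_iff_exists_tableauOfSteps I hj']
    exact ⟨i', hi', he.trans hx⟩
  · intro h i j hij
    obtain ⟨hj, hi⟩ := hI.mem_diagram_iff.1 hij
    rw [hI.tableau_eq hj hi]
    have hx := Finset.orderEmbOfFin_mem (I (Fin.rev ⟨j + 1, hj⟩)) rfl ⟨i, hi⟩
    generalize (I (Fin.rev ⟨j + 1, hj⟩)).orderEmbOfFin rfl ⟨i, hi⟩ = x at hx ⊢
    have hj' : j < (stepList lam).length := by omega
    have hk : (stepList lam).length - (j + 2) + 1 < (stepList lam).length := by omega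
    have e1 : Fin.rev ⟨j + 1, hj⟩ = ⟨(stepList lam).length - (j + 2), by omega⟩ := by
      ext
      simp [Fin.val_rev]
    have e2 : (⟨(stepList lam).length - (j + 2) + 1, hk⟩ : Fin (stepList lam).length) =
        Fin.rev ⟨j, hj'⟩ := by
      ext
      simp [Fin.val_rev]
      omega
    have hx' := h _ hk (by rwa [← e1])
    rw [e2, mem_iff_exists_tableauOfSteps I hj'] at hx'
    obtain ⟨i', hi', he⟩ := hx'
    exact ⟨i', hI.mem_diagram_iff.2 ⟨hj', hi'⟩, he⟩

theorem HasStepSizes.card_le (hI : HasStepSizes lam I) {k k' : Fin (stepList lam).length}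
    (h : k ≤ k') : (I k).card ≤ (I k').card := by
  rw [hI, hI, add_le_add_iff_right]
  rcases h.eq_or_lt with rfl | h
  · exact le_rfl
  · exact List.pairwise_iff_get.1 (pairwise_stepList lam) k k' h

theorem HasStepSizes.isSemistandard_iff (hI : HasStepSizes lam I) :
    IsSemistandard lam (tableauOfSteps I) ↔
      ∀ (k : ℕ) (hk : k + 1 < (stepList lam).length) (x : Fin (n + 1)),
        countLE (I ⟨k, by omega⟩) x ≤ countLE (I ⟨k + 1, hk⟩) x := by
  rw [IsSemistandard, and_iff_right hI.isYoungTableau]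
  constructor
  · intro h k hk
    rw [countLE_le_iff (hI.card_le (Fin.le_def.2 (Nat.le_succ k)))]
    intro i hi
    have hj : (Fin.rev ⟨k, by omega⟩ : Fin (stepList lam).length).1 < _ := Fin.is_lt _
    have hi' : i < (I ⟨k + 1, hk⟩).card :=
      hi.trans_le (hI.card_le (Fin.le_def.2 (Nat.le_succ k)))
    have h1 := h i (Fin.rev ⟨k + 1, hk⟩ : Fin (stepList lam).length)
      (Fin.rev ⟨k, by omega⟩ : Fin (stepList lam).length) (by simp [Fin.val_rev]; omega)
      (hI.mem_diagram_iff.2 ⟨hj, by simpa only [Fin.eta, Fin.rev_rev] using hi⟩)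
    rw [hI.tableau_rev _ hi, hI.tableau_rev _ hi', add_le_add_iff_right] at h1
    exact h1
  · intro h i j j' hjj hij
    obtain ⟨hj', hi'⟩ := hI.mem_diagram_iff.1 hij
    -- Rows are compared for arbitrary pairs of columns; chaining the counting functions reduces
    -- this to adjacent ones.
    have key : ∀ (k k' : ℕ) (hkk : k ≤ k') (hk' : k' < (stepList lam).length) (x : Fin (n + 1)),
        countLE (I ⟨k, by omega⟩) x ≤ countLE (I ⟨k', hk'⟩) x := by
      intro k k' hkk
      induction k', hkk using Nat.le_induction with
      | base => exact fun _ _ => le_rfl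
      | succ k' hkk ih => exact fun hk' x => (ih (by omega) x).trans (h k' hk' x)
    have hle : Fin.rev ⟨j', hj'⟩ ≤ Fin.rev ⟨j, hjj.trans hj'⟩ :=
      Fin.rev_le_rev.2 (Fin.le_def.2 hjj.le)
    have h1 := (countLE_le_iff (hI.card_le hle)).1 (key _ _ hle (Fin.is_lt _)) i hi'
    rw [hI.tableau_eq hj' hi', hI.tableau_eq (hjj.trans hj') (hi'.trans_le (hI.card_le hle)),
      add_le_add_iff_right]
    exact h1

end

/-! ### The exchange order on finite sets -/

/-- The set `B` arises from `A` by replacing an element by a smaller one. -/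
def IsExchange {N : ℕ} (A B : Finset (Fin N)) : Prop :=
  ∃ i j, i < j ∧ i ∉ A ∧ j ∈ A ∧ B = insert i (A.erase j)

theorem IsExchange.card_eq {N : ℕ} {A B : Finset (Fin N)} (h : IsExchange A B) :
    B.card = A.card := by
  obtain ⟨i, j, -, hi, hj, rfl⟩ := h
  rw [Finset.card_insert_of_notMem (fun h => hi (Finset.mem_of_mem_erase h)),
    Finset.card_erase_add_one hj]

theorem countLE_mono {N : ℕ} {A B : Finset (Fin N)} (h : A ⊆ B) (x : Fin N) :
    countLE A x ≤ countLE B x :=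
  Finset.card_le_card (Finset.filter_subset_filter _ h)

theorem countLE_exchange {N : ℕ} {A : Finset (Fin N)} {i j : Fin N} (hij : i < j) (hi : i ∉ A)
    (hj : j ∈ A) (x : Fin N) :
    countLE (insert i (A.erase j)) x = countLE A x + if i ≤ x ∧ x < j then 1 else 0 := by
  have hi' : i ∉ (A.erase j).filter (· ≤ x) := by simp [hi]
  rw [countLE, countLE, Finset.filter_insert, Finset.filter_erase]
  rw [Finset.filter_erase] at hi'
  by_cases h1 : i ≤ x
  · rw [if_pos h1, Finset.card_insert_of_notMem hi']
    by_cases h2 : x < j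
    · rw [if_pos ⟨h1, h2⟩, Finset.erase_eq_of_notMem (by simp [h2])]
    · rw [if_neg (fun h => h2 h.2), Finset.card_erase_add_one (by simp [hj, not_lt.1 h2]), add_zero]
  · rw [if_neg h1, if_neg (fun h => h1 h.1), Finset.erase_eq_of_notMem, add_zero]
    simp only [Finset.mem_filter, not_and, not_le]
    exact fun _ => (not_le.1 h1).trans hij

theorem IsExchange.countLE_le {N : ℕ} {A B : Finset (Fin N)} (h : IsExchange A B) (x : Fin N) :
    countLE A x ≤ countLE B x := by
  obtain ⟨i, j, hij, hi, hj, rfl⟩ := h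
  rw [countLE_exchange hij hi hj]
  exact Nat.le_add_right _ _

/-- The componentwise order on sets of the same size is generated by exchanges. -/
theorem reflTransGen_isExchange {N : ℕ} {A B : Finset (Fin N)} (hc : A.card = B.card)
    (h : ∀ x, countLE A x ≤ countLE B x) : Relation.ReflTransGen IsExchange A B := by
  induction hd : (A \ B).card generalizing A with
  | zero =>
    have : A ⊆ B := Finset.sdiff_eq_empty_iff_subset.1 (Finset.card_eq_zero.1 hd)
    rw [Finset.eq_of_subset_of_card_le this hc.ge]
  | succ d ih =>
    have hne : (A \ B).Nonempty := Finset.card_pos.1 (by omega)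
    obtain ⟨hzA, hzB⟩ := Finset.mem_sdiff.1 (Finset.min'_mem _ hne)
    have hmin : ∀ a ∈ A, a < (A \ B).min' hne → a ∈ B := by
      intro a ha hlt
      by_contra hB
      exact absurd (Finset.min'_le _ a (Finset.mem_sdiff.2 ⟨ha, hB⟩)) (not_le.2 hlt)
    generalize (A \ B).min' hne = z at hzA hzB hmin
    -- Here z is the least element of A \ B. Without such a y, every element of B up to z would lie
    -- in A, and B would have fewer elements up to z than A.
    obtain ⟨y, hyB, hyA, hyz⟩ : ∃ y ∈ B, y ∉ A ∧ y < z := by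
      by_contra! hcon
      have hsub : (B.filter (· ≤ z)) ⊆ (A.filter (· ≤ z)).erase z := by
        intro y hy
        rw [Finset.mem_filter] at hy
        have hyz : y ≠ z := fun h => hzB (h ▸ hy.1)
        refine Finset.mem_erase.2 ⟨hyz, Finset.mem_filter.2 ⟨?_, hy.2⟩⟩
        by_contra hyA
        exact absurd (hcon y hy.1 hyA) (not_le.2 (lt_of_le_of_ne hy.2 hyz))
      have h1 := Finset.card_le_card hsub
      have h2 := Finset.card_erase_lt_of_mem (Finset.mem_filter.2 ⟨hzA, le_rfl⟩ :
        z ∈ A.filter (· ≤ z))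
      exact absurd (h z) (not_le.2 (h1.trans_lt h2))
    have hex : IsExchange A (insert y (A.erase z)) := ⟨y, z, hyz, hyA, hzA, rfl⟩
    refine Relation.ReflTransGen.head hex (ih (hex.card_eq.trans hc) (fun x => ?_) ?_)
    · rw [countLE_exchange hyz hyA hzA]
      split_ifs with hx
      -- For y ≤ x < z all elements of A up to x lie in B, while y lies only in B; this leaves room
      -- for the extra 1.
      · refine Nat.succ_le_of_lt (Finset.card_lt_card ?_)
        rw [Finset.ssubset_iff_of_subset]
        · exact ⟨y, Finset.mem_filter.2 ⟨hyB, hx.1⟩, fun hy => hyA (Finset.mem_filter.1 hy).1⟩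
        · intro a ha
          rw [Finset.mem_filter] at ha ⊢
          exact ⟨hmin a ha.1 (ha.2.trans_lt hx.2), ha.2⟩
      · exact h x
    · have : insert y (A.erase z) \ B = (A \ B).erase z := by
        ext a
        simp only [Finset.mem_sdiff, Finset.mem_insert, Finset.mem_erase]
        constructor
        · rintro ⟨rfl | ⟨h1, h2⟩, h3⟩
          · exact absurd hyB h3
          · exact ⟨h1, h2, h3⟩
        · rintro ⟨h1, h2, h3⟩
          exact ⟨Or.inr ⟨h1, h2⟩, h3⟩
      rw [this, Finset.card_erase_of_mem (Finset.mem_sdiff.2 ⟨hzA, hzB⟩), hd]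
      rfl

theorem countLE_add_card {N : ℕ} (A : Finset (Fin N)) (x : Fin N) :
    countLE A x + (A.filter (x < ·)).card = A.card := by
  have := Finset.card_filter_add_card_filter_not (s := A) (· ≤ x)
  simp only [not_le] at this
  exact this

/-- The largest superset of a given size. -/
theorem exists_superset_max {N : ℕ} (I : Finset (Fin N)) {m : ℕ} (hm : I.card ≤ m) (hN : m ≤ N) :
    ∃ J, I ⊆ J ∧ J.card = m ∧ ∀ x, (∀ y ∈ J, y ≤ x → y ∈ I) ∨ ∀ y, x < y → y ∈ J := by
  induction m, hm using Nat.le_induction with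
  | base => exact ⟨I, subset_rfl, rfl, fun x => Or.inl fun y hy _ => hy⟩
  | succ m hm ih =>
    obtain ⟨J, hIJ, hJ, h⟩ := ih (by omega)
    -- The set is enlarged by its largest missing element.
    have hne : Jᶜ.Nonempty := by
      rw [← Finset.card_pos, Finset.card_compl, Fintype.card_fin]
      omega
    have hz := Finset.max'_mem _ hne
    have hmax : ∀ y, Jᶜ.max' hne < y → y ∈ J := by
      intro y hy
      by_contra hyJ
      exact absurd (Finset.le_max' _ y (Finset.mem_compl.2 hyJ)) (not_le.2 hy)
    generalize Jᶜ.max' hne = z at hz hmax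
    rw [Finset.mem_compl] at hz
    refine ⟨insert z J, hIJ.trans (Finset.subset_insert _ _), ?_, fun x => ?_⟩
    · rw [Finset.card_insert_of_notMem hz, hJ]
    · rcases lt_or_ge x z with hx | hx
      · rcases h x with h | h
        · left
          intro y hy hyx
          rcases Finset.mem_insert.1 hy with rfl | hy
          · exact absurd hyx (not_le.2 hx)
          · exact h y hy hyx
        · exact absurd (h z hx) hz
      · right
        intro y hy
        exact Finset.mem_insert_of_mem (hmax y (hx.trans_lt hy))

/-- The largest superset has the smallest counting function: up to x it either counts only elements
of I, or it contains everything above x and so has as few elements up to x as its size allows. -/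
theorem exists_superset_countLE_le {N : ℕ} {I J : Finset (Fin N)} (hc : I.card ≤ J.card)
    (h : ∀ x, countLE I x ≤ countLE J x) :
    ∃ J₀, I ⊆ J₀ ∧ J₀.card = J.card ∧ ∀ x, countLE J₀ x ≤ countLE J x := by
  obtain ⟨J₀, h1, h2, h3⟩ := exists_superset_max I hc (by simpa using Finset.card_le_univ J)
  refine ⟨J₀, h1, h2, fun x => ?_⟩
  rcases h3 x with h3 | h3
  · refine (Finset.card_le_card fun y hy => ?_).trans (h x)
    rw [Finset.mem_filter] at hy ⊢
    exact ⟨h3 y hy.1 hy.2, hy.2⟩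
  · have a1 := countLE_add_card J₀ x
    have a2 := countLE_add_card J x
    have : (J.filter (x < ·)).card ≤ (J₀.filter (x < ·)).card := by
      refine Finset.card_le_card fun y hy => ?_
      rw [Finset.mem_filter] at hy ⊢
      exact ⟨h3 y hy.2, hy.2⟩
    omega

/-! ### Minimal and positively folded 2-step galleries -/

/-- Both `eps I` and `eps J` lie in the chamber of σ, so I and J are initial segments of the
ordering σ, and the smaller one is contained in the larger. -/
theorem subset_of_isMinimalStep {u : Apartment n} {I J : Finset (Fin (n + 1))}
    (hc : I.card ≤ J.card) (h : IsMinimalStep (seg u I) (u + eps I) (seg (u + eps I) J)) :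
    I ⊆ J := by
  obtain ⟨C, hC, hF, hE⟩ := h
  obtain ⟨σ, rfl⟩ := isChamber_iff.1 hC
  have h1 : eps J ∈ chamber σ := by
    have := hF (right_mem_seg _ J)
    simpa [sector] using this
  have h2 : eps I ∈ chamber σ := by
    have := hE (left_mem_seg _ I)
    simpa [sector, opp] using this
  rw [mem_chamber_iff] at h1 h2
  intro a ha
  by_contra haJ
  obtain ⟨b, hb, hbI⟩ : ∃ b ∈ J, b ∉ I := by
    by_contra! hcon
    have : J ⊂ I := (Finset.ssubset_iff_of_subset hcon).2 ⟨a, ha, haJ⟩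
    exact absurd (Finset.card_lt_card this) (not_lt.2 hc)
  obtain ⟨i, rfl⟩ := σ.surjective a
  obtain ⟨j, rfl⟩ := σ.surjective b
  rcases lt_trichotomy i j with hij | rfl | hij
  · have := h1 i j hij
    simp [haJ, hb] at this
    linarith
  · exact haJ hb
  · have := h2 j i hij
    simp [ha, hbI] at this
    linarith

theorem isMinimalStep_of_subset (u : Apartment n) {I J : Finset (Fin (n + 1))} (h : I ⊆ J) :
    IsMinimalStep (seg u I) (u + eps I) (seg (u + eps I) J) := by
  -- The values are 0 on I, 1 on J \ I and 2 outside J, so I comes first and J second.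
  obtain ⟨σ, hσ⟩ := exists_chamber_of_fun fun y : Fin (n + 1) =>
    (if y ∈ I then 0 else 1) + if y ∈ J then 0 else 1
  have h1 : eps J ∈ chamber σ := by
    refine hσ _ fun i j hij => ?_
    have hi := @h i
    have hj := @h j
    rw [coordDiff_eps]
    split_ifs at hij ⊢ <;> first | omega | tauto | norm_num
  have h2 : eps I ∈ chamber σ := by
    refine hσ _ fun i j hij => ?_
    have hi := @h i
    have hj := @h j
    rw [coordDiff_eps]
    split_ifs at hij ⊢ <;> first | omega | tauto | norm_num
  refine ⟨chamber σ, isChamber_chamber σ, ?_, ?_⟩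
  · rintro _ ⟨t, h0, -, rfl⟩
    change u + eps I + t • eps J - (u + eps I) ∈ chamber σ
    rw [add_sub_cancel_left]
    exact chamber_smul_mem h1 h0
  · rintro _ ⟨t, -, h0, rfl⟩
    change -(u + t • eps I - (u + eps I)) ∈ chamber σ
    have : -(u + t • eps I - (u + eps I)) = (1 - t) • eps I := by module
    rw [this]
    exact chamber_smul_mem h2 (by linarith)

theorem affRefl_affRefl (α : PosRoot n) (m : ℤ) (x : Apartment n) :
    affRefl α m (affRefl α m x) = x := by
  rw [affRefl_apply α m x, affRefl_apply]
  simp only [map_sub, map_smul, root_coroot]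
  module

/-- A test point that shows on which side of a separating hyperplane the open edge lies. -/
theorem midpoint_mem_openFace (z : Fin (n + 1) → ℤ) (J : Finset (Fin (n + 1))) :
    intPt z + (1 / 2 : ℝ) • eps J ∈ openFace (seg (intPt z) J) := by
  refine ⟨⟨1 / 2, by norm_num, by norm_num, rfl⟩, ?_⟩
  rintro α m h _ ⟨t, -, -, rfl⟩
  have half : ∀ a m : ℤ, (a : ℝ) + 1 / 2 ≠ m := by
    intro a m h
    have : ((2 * a + 1 : ℤ) : ℝ) = ((2 * m : ℤ) : ℝ) := by push_cast; linarith
    have := Int.cast_injective this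
    omega
  simp only [hyperplane, Set.mem_ofPred_eq, root_eq_coordDiff, map_add, map_smul, coordDiff_intPt,
    coordDiff_eps, smul_eq_mul] at h ⊢
  by_cases ha : α.1.1 ∈ J <;> by_cases hb : α.1.2 ∈ J
  · simpa [ha, hb] using h
  · exfalso
    apply half (z α.1.1 - z α.1.2) m
    simp [ha, hb] at h ⊢
    linarith
  · exfalso
    apply half (z α.1.1 - z α.1.2 - 1) m
    simp [ha, hb] at h ⊢
    linarith
  · simpa [ha, hb] using h

/-- This rules out one alternative of `Separates`: the anti-dominant sector at v is never on the
upper side of a hyperplane through v. -/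
theorem exists_mem_antiDomAt (v : Apartment n) (α : PosRoot n) :
    ∃ x ∈ antiDomAt v, root α x < root α v := by
  refine ⟨v - eps (initialSet ((α.1.1 : ℕ) + 1)), ?_, ?_⟩
  · change -(v - eps (initialSet ((α.1.1 : ℕ) + 1)) - v) ∈ domChamber n
    rw [sub_sub_cancel_left, neg_neg]
    exact fun β => (eps_initialSet_mem _ β).1
  · have : (α.1.1 : ℕ) < α.1.2 := α.2
    rw [map_sub, root_eq_coordDiff, coordDiff_eps]
    simp [not_lt.2 (Nat.succ_le_of_lt this)]

theorem eps_exchange {J : Finset (Fin (n + 1))} (α : PosRoot n) (hi : α.1.1 ∈ J)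
    (hj : α.1.2 ∉ J) : eps (insert α.1.2 (J.erase α.1.1)) = eps J - coroot α := by
  refine ext_coordDiff fun a b => ?_
  have h := α.2.ne
  have key : ∀ c, (if c ∈ insert α.1.2 (J.erase α.1.1) then (1 : ℝ) else 0) =
      (if c ∈ J then 1 else 0) - ((if c = α.1.1 then 1 else 0) - (if c = α.1.2 then 1 else 0)) := by
    intro c
    by_cases h1 : c = α.1.1
    · subst h1
      simp [h, hi]
    · by_cases h2 : c = α.1.2
      · subst h2
        simp [hj, h.symm]
      · simp [h1, h2]
  rw [map_sub, coordDiff_eps, coordDiff_eps, coordDiff_coroot, key, key]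
  ring

/-- The anti-dominant sector forces the folded edge to the positive side of α = ε_i - ε_j, so i lies
in J and j does not. Reflecting back puts j in place of i, and i < j. -/
theorem exists_exchange_of_isPosFolding {z : Fin (n + 1) → ℤ} {F : Set (Apartment n)}
    {J : Finset (Fin (n + 1))} (h : IsPosFolding (intPt z) F (seg (intPt z) J)) :
    ∃ J', F = seg (intPt z) J' ∧ IsExchange J' J := by
  obtain ⟨-, α, m, himg, hv, hsep⟩ := h
  have hv : root α (intPt z) = m := hv
  obtain ⟨h1, h2⟩ | ⟨h1, -⟩ := hsep
  · have hmid : (m : ℝ) < _ := h2 (midpoint_mem_openFace z J)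
    rw [map_add, hv, map_smul, root_eq_coordDiff, coordDiff_eps, smul_eq_mul] at hmid
    have hi : α.1.1 ∈ J := by
      by_contra hi
      simp only [hi, if_false] at hmid
      split_ifs at hmid <;> linarith
    have hj : α.1.2 ∉ J := by
      intro hj
      simp [hi, hj] at hmid
    refine ⟨insert α.1.2 (J.erase α.1.1), ?_, α.1.1, α.1.2, α.2, by simp [α.2.ne], by simp, ?_⟩
    · have hF : F = affRefl α m '' (affRefl α m '' F) := by
        rw [Set.image_image]
        simp [affRefl_affRefl]
      rw [hF, himg]
      refine image_seg _ _ _ fun t => ?_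
      rw [affRefl_apply, map_add, hv, eps_exchange α hi hj, map_smul, root_eq_coordDiff,
        coordDiff_eps]
      simp only [hi, hj, if_true, if_false, smul_eq_mul]
      module
    · rw [Finset.erase_insert (by simp [hj]), Finset.insert_erase hi]
  · obtain ⟨x, hx, hlt⟩ := exists_mem_antiDomAt (intPt z) α
    have : (m : ℝ) ≤ root α x := h1 (Or.inl hx)
    linarith

theorem isPosFolding_of_exchange (z : Fin (n + 1) → ℤ) {J' J : Finset (Fin (n + 1))}
    (h : IsExchange J' J) : IsPosFolding (intPt z) (seg (intPt z) J') (seg (intPt z) J) := by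
  obtain ⟨i, j, hij, hi, hj, hJ⟩ := h
  have hiJ : i ∈ J := by simp [hJ]
  have hjJ : j ∉ J := by simp [hJ, hij.ne']
  have hJ' : J' = insert j (J.erase i) := by
    rw [hJ, Finset.erase_insert (by simp [hi]), Finset.insert_erase hj]
  let α : PosRoot n := ⟨(i, j), hij⟩
  have heps : eps J' = eps J - coroot α := by
    rw [hJ']
    exact eps_exchange α hiJ hjJ
  have hv : root α (intPt z) = ((z i - z j : ℤ) : ℝ) := by
    rw [root_eq_coordDiff, coordDiff_intPt]
    push_cast
    rfl
  have hr : root α (eps J) = 1 := by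
    rw [root_eq_coordDiff, coordDiff_eps]
    simp [α, hiJ, hjJ]
  have hr' : root α (eps J') = -1 := by
    rw [root_eq_coordDiff, coordDiff_eps]
    simp [α, hi, hj]
  refine ⟨isFace_seg z ⟨j, hj⟩ fun h => hi (h ▸ Finset.mem_univ i), α, z i - z j, ?_, hv,
    Or.inl ⟨?_, ?_⟩⟩
  · refine image_seg _ _ _ fun t => ?_
    rw [affRefl_apply, map_add, hv, map_smul, hr', heps, smul_eq_mul]
    module
  · rintro x (hx | ⟨t, h0, -, rfl⟩)
    · have hx : 0 ≤ root α (-(x - intPt z)) := hx α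
      rw [map_neg, map_sub, hv] at hx
      change root α x ≤ ((z i - z j : ℤ) : ℝ)
      linarith
    · change root α _ ≤ ((z i - z j : ℤ) : ℝ)
      rw [map_add, hv, map_smul, hr', smul_eq_mul]
      linarith
  · rintro _ ⟨⟨t, h0, -, rfl⟩, hx⟩
    change ((z i - z j : ℤ) : ℝ) < root α _
    rw [map_add, hv, map_smul, hr, smul_eq_mul, mul_one]
    rcases h0.eq_or_lt with rfl | h0
    -- The vertex itself is not in the open edge, as it lies on this hyperplane and the other end
    -- does not.
    · exfalso
      have h1 : root α _ = _ := hx α (z i - z j) (by simp only [zero_smul, add_zero]; exact hv) (right_mem_seg _ _)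
      rw [map_add, hv, hr] at h1
      linarith
    · linarith

/-- A 2-step gallery is positively folded if and only if the columns of its steps are weakly
increasing along the rows. -/
theorem isPosFoldedStep_iff {u : Apartment n} {z : Fin (n + 1) → ℤ} {I J : Finset (Fin (n + 1))}
    (hz : u + eps I = intPt z) (hc : I.card ≤ J.card) (hJ : J.Nonempty) (hJ' : J ≠ Finset.univ) :
    IsPosFoldedStep (seg u I) (u + eps I) (seg (u + eps I) J) ↔
      ∀ x, countLE I x ≤ countLE J x := by
  constructor
  · rintro (h | ⟨F₀, -, hmin, hfold⟩)
    · exact countLE_mono (subset_of_isMinimalStep hc h)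
    -- Only the last face is known to be a segment, so the chain of foldings is followed backwards
    -- from it.
    · have key : ∀ F, Relation.ReflTransGen (IsPosFolding (u + eps I)) F (seg (u + eps I) J) →
          ∃ J₀, F = seg (u + eps I) J₀ ∧ J₀.card = J.card ∧ ∀ x, countLE J₀ x ≤ countLE J x := by
        intro F hF
        induction hF using Relation.ReflTransGen.head_induction_on with
        | refl => exact ⟨J, rfl, rfl, fun _ => le_rfl⟩
        | head hstep _ ih =>
          obtain ⟨J₁, rfl, h1, h2⟩ := ih
          rw [hz] at hstep
          obtain ⟨J₀, rfl, hex⟩ := exists_exchange_of_isPosFolding hstep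
          exact ⟨J₀, by rw [hz], hex.card_eq.symm.trans h1, fun x => (hex.countLE_le x).trans (h2 x)⟩
      obtain ⟨J₀, rfl, h1, h2⟩ := key _ hfold
      exact fun x => (countLE_mono (subset_of_isMinimalStep (h1 ▸ hc) hmin) x).trans (h2 x)
  · intro h
    obtain ⟨J₀, h1, h2, h3⟩ := exists_superset_countLE_le hc h
    refine Or.inr ⟨seg (u + eps I) J₀, ?_, isMinimalStep_of_subset u h1, ?_⟩
    · rw [hz]
      refine isFace_seg z ?_ fun h => hJ' ?_
      · rwa [← Finset.card_pos, h2, Finset.card_pos]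
      · rwa [← Finset.card_eq_iff_eq_univ, ← h2, Finset.card_eq_iff_eq_univ]
    · rw [hz]
      exact (reflTransGen_isExchange h2 h3).lift (seg (intPt z)) fun _ _ => isPosFolding_of_exchange z

/-! ### Inversions and the length function -/

/-- The inversions of a permutation. -/
def inversions {N : ℕ} (w : Equiv.Perm (Fin N)) : Finset (Fin N × Fin N) :=
  Finset.univ.filter fun p => p.1 < p.2 ∧ w p.2 < w p.1

@[simp] theorem mem_inversions {N : ℕ} {w : Equiv.Perm (Fin N)} {p : Fin N × Fin N} :
    p ∈ inversions w ↔ p.1 < p.2 ∧ w p.2 < w p.1 := by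
  simp [inversions]

/-- The inversions of x inject into those of x s other than (p, q): s is applied to both entries of
a pair if their images are in increasing order, and the pair is kept otherwise. -/
theorem card_inversions_lt_mul_swap {N : ℕ} {x : Equiv.Perm (Fin N)} {p q : Fin N} (hpq : p < q)
    (hx : x p < x q) : (inversions x).card < (inversions (x * Equiv.swap p q)).card := by
  set s := Equiv.swap p q with hs
  have hss : ∀ i, s (s i) = i := fun i => Equiv.swap_apply_self p q i
  have hsp : s p = q := Equiv.swap_apply_left p q
  have hsq : s q = p := Equiv.swap_apply_right p q
  have hso : ∀ i, i ≠ p → i ≠ q → s i = i := fun i => Equiv.swap_apply_of_ne_of_ne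
  have hmem : (p, q) ∈ inversions (x * s) := by
    simp [hsp, hsq, hpq, hx]
  rw [← Finset.card_erase_add_one hmem, Nat.lt_succ_iff]
  refine Finset.card_le_card_of_injOn
    (fun c => if s c.1 < s c.2 then (s c.1, s c.2) else c) ?_ ?_
  · rintro ⟨i, j⟩ hij
    have hij := mem_inversions.1 hij
    dsimp only at hij ⊢
    rw [Finset.mem_coe, Finset.mem_erase, mem_inversions]
    split_ifs with h
    · refine ⟨fun he => ?_, h, by simpa [hss] using hij.2⟩
      have h1 := congrArg Prod.fst he
      have h2 := congrArg Prod.snd he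
      dsimp only at h1 h2
      have h3 : i = q := by rw [← hss i, h1, hsp]
      have h4 : j = p := by rw [← hss j, h2, hsq]
      exact absurd hij.1 (by rw [h3, h4]; exact hpq.not_gt)
    · refine ⟨fun he => ?_, hij.1, ?_⟩
      · have h1 := congrArg Prod.fst he
        have h2 := congrArg Prod.snd he
        dsimp only at h1 h2
        exact absurd hij.2 (by rw [h1, h2]; exact hx.not_gt)
      · simp only [Equiv.Perm.mul_apply]
        by_cases hip : i = p
        · by_cases hjq : j = q
          · rw [hip, hjq, hsp, hsq]
            exact hx
          · rw [hso j (hip ▸ hij.1.ne') hjq, hip, hsp]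
            exact (hip ▸ hij.2).trans hx
        · by_cases hjq : j = q
          · rw [hjq, hsq, hso i hip (hjq ▸ hij.1.ne)]
            exact hx.trans (hjq ▸ hij.2)
          · exfalso
            apply h
            by_cases hiq : i = q
            · rw [hiq, hsq, hso j (fun h => (hpq.trans (hiq ▸ hij.1)).ne' h) hjq]
              exact hpq.trans (hiq ▸ hij.1)
            · by_cases hjp : j = p
              · rw [hjp, hsp, hso i hip hiq]
                exact (hjp ▸ hij.1).trans hpq
              · rw [hso i hip hiq, hso j hjp hjq]
                exact hij.1
  · rintro ⟨i, j⟩ hij ⟨i', j'⟩ hij' he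
    have hij := (mem_inversions.1 hij).1
    have hij' := (mem_inversions.1 hij').1
    dsimp only at hij hij' he
    split_ifs at he with h h' h'
    · rw [Prod.mk.injEq, s.injective.eq_iff, s.injective.eq_iff] at he
      rw [he.1, he.2]
    · rw [Prod.mk.injEq] at he
      rw [← he.1, ← he.2, hss, hss] at h'
      exact absurd hij h'
    · rw [Prod.mk.injEq] at he
      rw [he.1, he.2, hss, hss] at h
      exact absurd hij' h
    · exact he

/-- Exchanging the adjacent values k and k + 1 affects only the pair of positions at which they
stand. -/
theorem card_inversions_swap_mul_le {w : Equiv.Perm (Fin (n + 1))} (k : Fin n) :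
    (inversions (Equiv.swap k.castSucc k.succ * w)).card ≤ (inversions w).card + 1 := by
  refine (Finset.card_le_card (t := insert (w⁻¹ k.castSucc, w⁻¹ k.succ) (inversions w)) ?_).trans
    (Finset.card_insert_le _ _)
  rintro ⟨i, j⟩ hij
  obtain ⟨h1, h2⟩ := mem_inversions.1 hij
  dsimp only at h1 h2
  rw [Finset.mem_insert, mem_inversions, Prod.mk.injEq, Equiv.Perm.eq_inv_iff_eq,
    Equiv.Perm.eq_inv_iff_eq]
  simp only [Equiv.Perm.mul_apply, Equiv.swap_apply_def] at h2
  have hne : w i ≠ w j := fun h => h1.ne (w.injective h)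
  rw [Fin.lt_def] at h1 h2
  split_ifs at h2 <;> simp only [Fin.ext_iff, Fin.val_castSucc, Fin.val_succ] at * <;> omega

theorem exists_descent {w : Equiv.Perm (Fin (n + 1))} (hw : w ≠ 1) :
    ∃ k : Fin n, w⁻¹ k.succ < w⁻¹ k.castSucc := by
  by_contra! hcon
  have hmono : StrictMono (w⁻¹ : Equiv.Perm (Fin (n + 1))) := by
    rw [Fin.strictMono_iff_lt_succ]
    exact fun k => lt_of_le_of_ne (hcon k) fun h => k.castSucc_lt_succ.ne (w⁻¹.injective h)
  have := (hmono.range_inj strictMono_id).1 (by rw [w⁻¹.surjective.range_eq, Set.range_id])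
  apply hw
  rw [← inv_eq_one]
  ext i
  rw [this]
  rfl

/-- Sorting by exchanges of adjacent values: each descent of w⁻¹ gives an exchange that removes
exactly one inversion. -/
theorem exists_word (w : Equiv.Perm (Fin (n + 1))) :
    ∃ l : List (Apartment n ≃ₗ[ℝ] Apartment n), l.length = (inversions w).card ∧
      (∀ s ∈ l, ∃ α : PosRoot n, IsSimpleRoot α ∧ s = rootRefl α) ∧ l.prod = permAct w := by
  induction hd : (inversions w).card using Nat.strong_induction_on generalizing w with
  | _ d ih =>
    by_cases hw : w = 1
    · subst hw
      have : inversions (1 : Equiv.Perm (Fin (n + 1))) = ∅ := by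
        ext p
        simp only [mem_inversions, Equiv.Perm.one_apply, Finset.notMem_empty, iff_false]
        exact fun h => h.1.not_gt h.2
      rw [this, Finset.card_empty] at hd
      exact ⟨[], hd, by simp, by simp⟩
    · obtain ⟨k, hk⟩ := exists_descent hw
      have hinv : ∀ i, w (w⁻¹ i) = i := w.apply_symm_apply
      set x := Equiv.swap k.castSucc k.succ * w with hx
      have hxw : w = Equiv.swap k.castSucc k.succ * x := by
        rw [hx, ← mul_assoc, Equiv.swap_mul_self, one_mul]
      have h1 : (inversions x).card < (inversions w).card := by
        -- Exchanging two values is exchanging the positions at which they stand, so the lemma on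
        -- right multiplication applies.
        have := card_inversions_lt_mul_swap (x := x) hk (by
          rw [hx, Equiv.Perm.mul_apply, Equiv.Perm.mul_apply, hinv, hinv]
          simp [k.castSucc_lt_succ])
        rwa [Equiv.mul_swap_eq_swap_mul, hx, Equiv.Perm.mul_apply, Equiv.Perm.mul_apply,
          hinv, hinv, Equiv.swap_apply_left, Equiv.swap_apply_right, ← mul_assoc, Equiv.swap_mul_self, one_mul, ← hx] at this
      have h2 : (inversions w).card ≤ (inversions x).card + 1 := by
        conv_lhs => rw [hxw]
        exact card_inversions_swap_mul_le k
      obtain ⟨l, hl1, hl2, hl3⟩ := ih _ (hd ▸ h1) x rfl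
      let α : PosRoot n := ⟨(k.castSucc, k.succ), k.castSucc_lt_succ⟩
      refine ⟨rootRefl α :: l, by simp; omega, ?_, ?_⟩
      · rintro s hs
        rcases List.mem_cons.1 hs with rfl | hs
        · exact ⟨α, by simp [IsSimpleRoot, α], rfl⟩
        · exact hl2 s hs
      · rw [List.prod_cons, hl3, ← permAct_swap, ← map_mul, ← hxw]

theorem card_inversions_le_of_word (l : List (Apartment n ≃ₗ[ℝ] Apartment n))
    (hl : ∀ s ∈ l, ∃ α : PosRoot n, IsSimpleRoot α ∧ s = rootRefl α) :
    ∃ w, l.prod = permAct w ∧ (inversions w).card ≤ l.length := by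
  induction l with
  | nil =>
    refine ⟨1, by simp, ?_⟩
    rw [List.length_nil, Nat.le_zero, Finset.card_eq_zero]
    ext p
    simp only [mem_inversions, Equiv.Perm.one_apply, Finset.notMem_empty, iff_false]
    exact fun h => h.1.not_gt h.2
  | cons s l ih =>
    obtain ⟨w, h1, h2⟩ := ih fun s hs => hl s (List.mem_cons_of_mem _ hs)
    obtain ⟨⟨⟨i, j⟩, hij⟩, hα, rfl⟩ := hl s List.mem_cons_self
    obtain ⟨k, rfl⟩ : ∃ k : Fin n, i = k.castSucc :=
      ⟨⟨i, by have := j.2; simp only [IsSimpleRoot] at hα; omega⟩, rfl⟩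
    obtain rfl : j = k.succ := by
      ext
      simpa [IsSimpleRoot] using hα
    refine ⟨Equiv.swap k.castSucc k.succ * w, ?_, ?_⟩
    · rw [List.prod_cons, h1, map_mul, ← permAct_swap]
    · rw [List.length_cons]
      exact (card_inversions_swap_mul_le k).trans (by omega)

/-- The length of an element of the Weyl group is the number of its inversions. -/
theorem weylLength_permAct (hn : 1 ≤ n) (w : Equiv.Perm (Fin (n + 1))) :
    weylLength (permAct w) = (inversions w).card := by
  apply le_antisymm
  · exact Nat.sInf_le (exists_word w)
  · obtain ⟨l, h1, h2, h3⟩ := exists_word w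
    refine le_csInf ⟨_, l, h1, h2, h3⟩ ?_
    rintro _ ⟨l, rfl, hl, hprod⟩
    obtain ⟨w', h4, h5⟩ := card_inversions_le_of_word l hl
    rwa [← permAct_injective hn (hprod.symm.trans h4)] at h5

/-! ### The tableau criterion for the Bruhat order -/

/-- The number of positions below `p` with a value at most `x`. -/
def rankLE {N : ℕ} (u : Equiv.Perm (Fin N)) (p : ℕ) (x : Fin N) : ℕ :=
  (Finset.univ.filter fun c : Fin N => (c : ℕ) < p ∧ u c ≤ x).card

theorem rankLE_succ {N : ℕ} (u : Equiv.Perm (Fin N)) (a x : Fin N) :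
    rankLE u (a + 1) x = rankLE u a x + if u a ≤ x then 1 else 0 := by
  rw [rankLE, rankLE]
  split_ifs with h
  · rw [← Finset.card_insert_of_notMem (a := a) (by simp)]
    congr 1
    ext c
    simp only [Finset.mem_filter, Finset.mem_univ, true_and, Finset.mem_insert, Nat.lt_succ_iff,
      Nat.le_iff_lt_or_eq, ← Fin.ext_iff]
    constructor
    · rintro ⟨h1 | h1, h2⟩
      · exact Or.inr ⟨h1, h2⟩
      · exact Or.inl h1
    · rintro (rfl | ⟨h1, h2⟩)
      · exact ⟨Or.inr rfl, h⟩
      · exact ⟨Or.inl h1, h2⟩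
  · rw [add_zero]
    congr 1
    ext c
    simp only [Finset.mem_filter, Finset.mem_univ, true_and, Nat.lt_succ_iff,
      Nat.le_iff_lt_or_eq, ← Fin.ext_iff]
    constructor
    · rintro ⟨h1 | rfl, h2⟩
      · exact ⟨h1, h2⟩
      · exact absurd h2 h
    · rintro ⟨h1, h2⟩
      exact ⟨Or.inl h1, h2⟩

theorem rankLE_congr {N : ℕ} {u v : Equiv.Perm (Fin N)} {a : ℕ}
    (h : ∀ c : Fin N, (c : ℕ) < a → u c = v c) (x : Fin N) : rankLE u a x = rankLE v a x := by
  rw [rankLE, rankLE]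
  congr 1
  ext c
  simp only [Finset.mem_filter, Finset.mem_univ, true_and, and_congr_right_iff]
  intro hc
  rw [h c hc]

theorem rankLE_add_card {N : ℕ} (u : Equiv.Perm (Fin N)) (p : ℕ) {x y : Fin N} (hxy : x ≤ y) :
    rankLE u p x + (Finset.univ.filter fun c : Fin N => (c : ℕ) < p ∧ x < u c ∧ u c ≤ y).card =
      rankLE u p y := by
  rw [rankLE, rankLE, ← Finset.card_union_of_disjoint]
  · congr 1
    ext c
    simp only [Finset.mem_union, Finset.mem_filter, Finset.mem_univ, true_and]
    constructor
    · rintro (⟨h1, h2⟩ | ⟨h1, -, h2⟩)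
      · exact ⟨h1, h2.trans hxy⟩
      · exact ⟨h1, h2⟩
    · rintro ⟨h1, h2⟩
      rcases le_or_gt (u c) x with h | h
      · exact Or.inl ⟨h1, h⟩
      · exact Or.inr ⟨h1, h, h2⟩
  · rw [Finset.disjoint_left]
    intro c h1 h2
    simp only [Finset.mem_filter, Finset.mem_univ, true_and] at h1 h2
    exact absurd h1.2 (not_le.2 h2.2.1)

/-- The values at positions below p change as a set only if a < p ≤ b; then `u a` is replaced by `u
b`, which loses a count only when `u a` ≤ x < `u b`. -/
theorem rankLE_mul_swap_le {N : ℕ} (u : Equiv.Perm (Fin N)) {a b : Fin N} (hab : a < b)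
    (p : ℕ) (x : Fin N) (h : ¬((a : ℕ) < p ∧ p ≤ b ∧ u a ≤ x ∧ x < u b)) :
    rankLE u p x ≤ rankLE (u * Equiv.swap a b) p x := by
  rcases lt_or_ge (b : ℕ) p with hbp | hpb
  · refine Finset.card_le_card_of_injOn (Equiv.swap a b) (fun c hc => ?_)
      (Equiv.swap a b).injective.injOn
    have hc := (Finset.mem_filter.1 hc).2
    refine Finset.mem_filter.2 ⟨Finset.mem_univ _, ?_, ?_⟩
    · have : (a : ℕ) < p := (Fin.lt_def.1 hab).trans hbp
      rw [Equiv.swap_apply_def]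
      split_ifs <;> tauto
    · rw [Equiv.Perm.mul_apply, Equiv.swap_apply_self]
      exact hc.2
  · refine Finset.card_le_card fun c hc => ?_
    obtain ⟨-, hc1, hc2⟩ := Finset.mem_filter.1 hc
    refine Finset.mem_filter.2 ⟨Finset.mem_univ _, hc1, ?_⟩
    have hcb : c ≠ b := by
      rintro rfl
      omega
    rw [Equiv.Perm.mul_apply]
    by_cases hca : c = a
    · subst hca
      rw [Equiv.swap_apply_left]
      by_contra hcon
      exact h ⟨hc1, hpb, hc2, not_le.1 hcon⟩
    · rwa [Equiv.swap_apply_of_ne_of_ne hca hcb]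

/-- Take for a the first position where u and v differ, so that `u a` < `v a`, and for b the first
later position with `u a` < `u b` ≤ `v a`. The swap lowers the rank of u by one only where a < p ≤ b
and `u a` ≤ x < `u b`; there the ranks of u and v differ strictly. -/
theorem exists_bruhat_step {N : ℕ} {u v : Equiv.Perm (Fin N)} (huv : u ≠ v)
    (h : ∀ p x, rankLE v p x ≤ rankLE u p x) :
    ∃ a b, a < b ∧ u a < u b ∧ ∀ p x, rankLE v p x ≤ rankLE (u * Equiv.swap a b) p x := by
  have hne : (Finset.univ.filter fun c => u c ≠ v c).Nonempty := by
    by_contra hcon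
    rw [Finset.not_nonempty_iff_eq_empty, Finset.filter_eq_empty_iff] at hcon
    exact huv (Equiv.ext fun c => by simpa using hcon (Finset.mem_univ c))
  obtain ⟨a, ha, hmin⟩ : ∃ a, u a ≠ v a ∧ ∀ c, c < a → u c = v c := by
    refine ⟨_, (Finset.mem_filter.1 (Finset.min'_mem _ hne)).2, fun c hc => ?_⟩
    by_contra hcon
    exact absurd (Finset.min'_le _ c (Finset.mem_filter.2 ⟨Finset.mem_univ c, hcon⟩))
      (not_le.2 hc)
  have hlt : u a < v a := by
    refine lt_of_le_of_ne ?_ ha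
    have h1 := h (a + 1) (v a)
    rw [rankLE_succ, rankLE_succ, rankLE_congr fun c hc => hmin c hc, if_pos le_rfl] at h1
    by_contra hcon
    rw [if_neg hcon] at h1
    omega
  have hne' : (Finset.univ.filter fun c => a < c ∧ u a < u c ∧ u c ≤ v a).Nonempty := by
    have hinv : u (u⁻¹ (v a)) = v a := u.apply_symm_apply _
    refine ⟨u⁻¹ (v a), Finset.mem_filter.2 ⟨Finset.mem_univ _, ?_, by rwa [hinv], hinv.le⟩⟩
    rcases lt_trichotomy a (u⁻¹ (v a)) with h1 | h1 | h1
    · exact h1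
    · exact absurd (Equiv.Perm.eq_inv_iff_eq.1 h1) ha
    · have := hmin _ h1
      rw [hinv] at this
      exact absurd (v.injective this) h1.ne'
  obtain ⟨b, ⟨hab, hub, hbv⟩, hbmin⟩ : ∃ b, (a < b ∧ u a < u b ∧ u b ≤ v a) ∧
      ∀ c, a < c → c < b → ¬(u a < u c ∧ u c ≤ v a) := by
    refine ⟨_, (Finset.mem_filter.1 (Finset.min'_mem _ hne')).2, fun c hac hc hcon => ?_⟩
    exact absurd (Finset.min'_le _ c (Finset.mem_filter.2 ⟨Finset.mem_univ c, hac, hcon⟩))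
      (not_le.2 hc)
  refine ⟨a, b, hab, hub, fun p x => ?_⟩
  by_cases hp : (a : ℕ) < p ∧ p ≤ b ∧ u a ≤ x ∧ x < u b
  · obtain ⟨hap, hpb, hax, hxb⟩ := hp
    have hxy : x ≤ v a := hxb.le.trans hbv
    have e1 := rankLE_add_card u p hxy
    have e2 := rankLE_add_card v p hxy
    have e3 := h p (v a)
    -- By the choice of b, the positions below p at which u has a value in (x, `v a`] come before a,
    -- where u and v agree; for v the position a itself is counted in addition.
    have e4 : (Finset.univ.filter fun c : Fin N => (c : ℕ) < p ∧ x < u c ∧ u c ≤ v a).card + 1 ≤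
        (Finset.univ.filter fun c : Fin N => (c : ℕ) < p ∧ x < v c ∧ v c ≤ v a).card := by
      refine Nat.succ_le_of_lt (Finset.card_lt_card ((Finset.ssubset_iff_of_subset ?_).2
        ⟨a, ?_, ?_⟩))
      · intro c hc
        obtain ⟨-, h1, h2, h3⟩ := Finset.mem_filter.1 hc
        rcases lt_trichotomy a c with hac | rfl | hac
        · exact absurd ⟨hax.trans_lt h2, h3⟩ (hbmin c hac (Fin.lt_def.2 (by omega)))
        · exact absurd h2 (not_lt.2 hax)
        · rw [hmin c hac] at h2 h3
          exact Finset.mem_filter.2 ⟨Finset.mem_univ _, h1, h2, h3⟩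
      · exact Finset.mem_filter.2 ⟨Finset.mem_univ _, hap, hxb.trans_le hbv, le_rfl⟩
      · intro hc
        exact absurd (Finset.mem_filter.1 hc).2.2.1 (not_lt.2 hax)
    have e5 : rankLE u p x ≤ rankLE (u * Equiv.swap a b) p x + 1 := by
      refine (Finset.card_le_card (t := insert a _) fun c hc => ?_).trans
        (Finset.card_insert_le a _)
      obtain ⟨-, hc1, hc2⟩ := Finset.mem_filter.1 hc
      rw [Finset.mem_insert]
      refine or_iff_not_imp_left.2 fun hca => ?_
      refine Finset.mem_filter.2 ⟨Finset.mem_univ _, hc1, ?_⟩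
      have hcb : c ≠ b := by
        rintro rfl
        omega
      rwa [Equiv.Perm.mul_apply, Equiv.swap_apply_of_ne_of_ne hca hcb]
    omega
  · exact (h p x).trans (rankLE_mul_swap_le u hab p x hp)

/-- The tableau criterion for the Bruhat order. -/
theorem bruhatLE_of_rankLE (hn : 1 ≤ n) {u v : Equiv.Perm (Fin (n + 1))}
    (h : ∀ p x, rankLE v p x ≤ rankLE u p x) : BruhatLE (permAct u) (permAct v) := by
  induction hd : (n + 1) * (n + 1) - (inversions u).card using Nat.strong_induction_on
    generalizing u with
  | _ d ih =>
    by_cases huv : u = v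
    · rw [huv]
      exact Relation.ReflTransGen.refl
    · obtain ⟨a, b, hab, hu, h'⟩ := exists_bruhat_step huv h
      have hlt := card_inversions_lt_mul_swap hab hu
      have hle := Finset.card_le_univ (inversions (u * Equiv.swap a b))
      rw [Fintype.card_prod, Fintype.card_fin] at hle
      refine Relation.ReflTransGen.head ⟨⟨⟨(u a, u b), hu⟩, ?_⟩, ?_⟩
        (ih _ (by omega) h' rfl)
      -- Swapping positions a and b is the left multiplication by the reflection that swaps the
      -- values `u a` and `u b`.
      · rw [← permAct_swap, ← map_mul, Equiv.mul_swap_eq_swap_mul]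
      · rwa [weylLength_permAct hn, weylLength_permAct hn]

/-! ### The largest permutation with given ordered initial values -/

/-- The values of `w` are first the elements of `I` in increasing order, then the remaining
elements in decreasing order. -/
structure IsStandardPerm {N : ℕ} (I : Finset (Fin N)) (w : Equiv.Perm (Fin N)) : Prop where
  mem_iff : ∀ a : Fin N, w a ∈ I ↔ (a : ℕ) < I.card
  lt_of_lt : ∀ a b : Fin N, a < b → (b : ℕ) < I.card → w a < w b
  gt_of_lt : ∀ a b : Fin N, a < b → I.card ≤ (a : ℕ) → w b < w a

theorem exists_isStandardPerm {N : ℕ} (I : Finset (Fin N)) :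
    ∃ w : Equiv.Perm (Fin N), IsStandardPerm I w := by
  have hc : I.card + Iᶜ.card = N := by simp
  let f : Fin N → Fin N := fun a =>
    if h : (a : ℕ) < I.card then I.orderEmbOfFin rfl ⟨a, h⟩
    else Iᶜ.orderEmbOfFin rfl (Fin.rev ⟨a - I.card, by omega⟩)
  have hpos : ∀ (a : Fin N) (h : (a : ℕ) < I.card), f a = I.orderEmbOfFin rfl ⟨a, h⟩ := fun a h => dif_pos h
  have hneg : ∀ (a : Fin N) (h : ¬(a : ℕ) < I.card),
      f a = Iᶜ.orderEmbOfFin rfl (Fin.rev ⟨a - I.card, by omega⟩) := fun a h => dif_neg h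
  have hmem : ∀ a, f a ∈ I ↔ (a : ℕ) < I.card := by
    intro a
    by_cases h : (a : ℕ) < I.card
    · rw [hpos a h]
      refine iff_of_true ?_ h
      exact Finset.orderEmbOfFin_mem _ _ _
    · rw [hneg a h]
      refine iff_of_false ?_ h
      exact Finset.mem_compl.1 (Finset.orderEmbOfFin_mem _ _ _)
  have hlt : ∀ a b : Fin N, a < b → (b : ℕ) < I.card → f a < f b := by
    intro a b hab hb
    rw [hpos b hb, hpos a ((Fin.lt_def.1 hab).trans hb)]
    exact (I.orderEmbOfFin rfl).strictMono hab
  have hgt : ∀ a b : Fin N, a < b → I.card ≤ (a : ℕ) → f b < f a := by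
    intro a b hab ha
    have hab' := Fin.lt_def.1 hab
    rw [hneg a (not_lt.2 ha), hneg b (not_lt.2 (ha.trans hab'.le))]
    refine (Iᶜ.orderEmbOfFin rfl).strictMono (Fin.rev_lt_rev.2 (Fin.lt_def.2 ?_))
    dsimp only
    omega
  have hne : ∀ a b : Fin N, a < b → f a ≠ f b := by
    intro a b hab he
    by_cases hb : (b : ℕ) < I.card
    · exact (hlt a b hab hb).ne he
    · by_cases ha : (a : ℕ) < I.card
      · exact hb ((hmem b).1 (he ▸ (hmem a).2 ha))
      · exact (hgt a b hab (not_lt.1 ha)).ne' he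
  have hinj : Function.Injective f := by
    intro a b he
    rcases lt_trichotomy a b with h | h | h
    · exact absurd he (hne a b h)
    · exact h
    · exact absurd he.symm (hne b a h)
  exact ⟨Equiv.ofBijective f (Finite.injective_iff_bijective.1 hinj), hmem, hlt, hgt⟩

theorem rankLE_le {N : ℕ} (w : Equiv.Perm (Fin N)) (p : ℕ) (x : Fin N) : rankLE w p x ≤ p := by
  have h : rankLE w p x ≤ (Finset.univ.filter fun c : Fin N => (c : ℕ) < p).card :=
    Finset.card_le_card fun c hc =>
      Finset.mem_filter.2 ⟨Finset.mem_univ c, (Finset.mem_filter.1 hc).2.1⟩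
  rw [Fin.card_filter_val_lt] at h
  exact h.trans (min_le_right _ _)

theorem rankLE_mono {N : ℕ} (w : Equiv.Perm (Fin N)) {p q : ℕ} (h : p ≤ q) (x : Fin N) :
    rankLE w p x ≤ rankLE w q x :=
  Finset.card_le_card fun c hc => by
    obtain ⟨-, h1, h2⟩ := Finset.mem_filter.1 hc
    exact Finset.mem_filter.2 ⟨Finset.mem_univ c, h1.trans_le h, h2⟩

theorem rankLE_le_countLE {N : ℕ} {w : Equiv.Perm (Fin N)} {I : Finset (Fin N)} {p : ℕ} {x : Fin N}
    (h : ∀ c : Fin N, (c : ℕ) < p → w c ≤ x → w c ∈ I) : rankLE w p x ≤ countLE I x := by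
  refine Finset.card_le_card_of_injOn w (fun c hc => ?_) w.injective.injOn
  obtain ⟨-, h1, h2⟩ := Finset.mem_filter.1 hc
  exact Finset.mem_filter.2 ⟨h c h1 h2, h2⟩

/-- If all values above x stand at positions below p, then as few values up to x as possible stand
there. -/
theorem rankLE_le_of_forall_gt {N : ℕ} {w : Equiv.Perm (Fin N)} {p : ℕ} {x : Fin N}
    (h : ∀ c : Fin N, x < w c → (c : ℕ) < p) (u : Equiv.Perm (Fin N)) :
    rankLE w p x ≤ rankLE u p x := by
  have key : ∀ v : Equiv.Perm (Fin N), rankLE v p x +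
      (Finset.univ.filter fun c : Fin N => (c : ℕ) < p ∧ x < v c).card =
        (Finset.univ.filter fun c : Fin N => (c : ℕ) < p).card := by
    intro v
    have := Finset.card_filter_add_card_filter_not
      (s := Finset.univ.filter fun c : Fin N => (c : ℕ) < p) (fun c => v c ≤ x)
    simp only [Finset.filter_filter, not_le] at this
    exact this
  have h1 : (Finset.univ.filter fun c : Fin N => (c : ℕ) < p ∧ x < u c).card ≤
      (Finset.univ.filter fun c : Fin N => (c : ℕ) < p ∧ x < w c).card := by
    have hw : ∀ c, w (w⁻¹ c) = c := w.apply_symm_apply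
    refine Finset.card_le_card_of_injOn (fun c => w⁻¹ (u c)) (fun c hc => ?_)
      ((w⁻¹.injective.comp u.injective).injOn)
    have hc := (Finset.mem_filter.1 hc).2.2
    have hc' : x < w (w⁻¹ (u c)) := by rwa [hw]
    exact Finset.mem_filter.2 ⟨Finset.mem_univ _, h _ hc', hc'⟩
  have h2 := key u
  have h3 := key w
  omega

/-- Either all of the first p values are at most x, or one of them exceeds x; in the latter case, I
being listed increasingly, all elements of I up to x come before it. -/
theorem IsStandardPerm.min_le_rankLE {N : ℕ} {I : Finset (Fin N)} {w : Equiv.Perm (Fin N)}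
    (hw : IsStandardPerm I w) {p : ℕ} (hp : p ≤ I.card) (x : Fin N) :
    min p (countLE I x) ≤ rankLE w p x := by
  by_cases h : ∀ c : Fin N, (c : ℕ) < p → w c ≤ x
  · refine (min_le_left _ _).trans ?_
    have h1 : (Finset.univ.filter fun c : Fin N => (c : ℕ) < p).card ≤ rankLE w p x :=
      Finset.card_le_card fun c hc => by
        have := (Finset.mem_filter.1 hc).2
        exact Finset.mem_filter.2 ⟨Finset.mem_univ c, this, h c this⟩
    have h2 := Finset.card_le_univ I
    rw [Fintype.card_fin] at h2
    rwa [Fin.card_filter_val_lt, min_eq_right (hp.trans h2)] at h1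
  · push Not at h
    obtain ⟨a, ha, hax⟩ := h
    refine (min_le_right _ _).trans ?_
    have hww : ∀ c, w (w⁻¹ c) = c := w.apply_symm_apply
    refine Finset.card_le_card_of_injOn (w⁻¹ : Equiv.Perm (Fin N)) (fun y hy => ?_)
      w⁻¹.injective.injOn
    obtain ⟨hy1, hy2⟩ := Finset.mem_filter.1 hy
    rw [← hww y] at hy1 hy2
    refine Finset.mem_filter.2 ⟨Finset.mem_univ _, ?_, hy2⟩
    rcases lt_or_ge (w⁻¹ y) a with hlt | hge
    · exact (Fin.lt_def.1 hlt).trans ha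
    · rcases hge.eq_or_lt with he | hlt
      · rw [← he]
        exact ha
      · exact absurd (hw.lt_of_lt _ _ hlt ((hw.mem_iff _).1 hy1)) (not_lt.2 (hy2.trans hax.le))

/-- For p ≤ |I| the first p values of w lie in I. For larger p, either all values above x are
already used and the rank is the least possible, or a value above x is still to come; as the
complement is listed decreasingly, only elements of I are then counted. The increasing initial part
of u gives the matching lower bounds. -/
theorem IsStandardPerm.rankLE_le {N : ℕ} {I J : Finset (Fin N)} {w u : Equiv.Perm (Fin N)}
    (hw : IsStandardPerm I w) (hu : IsStandardPerm J u) (hc : I.card ≤ J.card)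
    (h : ∀ x, countLE I x ≤ countLE J x) (p : ℕ) (x : Fin N) : rankLE w p x ≤ rankLE u p x := by
  rcases le_or_gt p I.card with hp | hp
  · refine (le_min (OneSkeleton.rankLE_le w p x) ?_).trans (hu.min_le_rankLE (hp.trans hc) x)
    exact (rankLE_le_countLE fun c hcp _ => (hw.mem_iff c).2 (hcp.trans_le hp)).trans (h x)
  · by_cases hall : ∀ c : Fin N, x < w c → (c : ℕ) < p
    · exact rankLE_le_of_forall_gt hall u
    · push Not at hall
      obtain ⟨b, hb, hpb⟩ := hall
      have h1 : rankLE w p x ≤ countLE I x := by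
        refine rankLE_le_countLE fun c hcp hcx => (hw.mem_iff c).2 ?_
        by_contra hcI
        exact absurd (hw.gt_of_lt c b (Fin.lt_def.2 (hcp.trans_le hpb)) (not_lt.1 hcI))
          (not_lt.2 (hcx.trans hb.le))
      refine (le_min ?_ (h1.trans (h x))).trans ((hu.min_le_rankLE hc x).trans
        (rankLE_mono u hp.le x))
      exact h1.trans (Finset.card_filter_le _ _)

theorem IsStandardPerm.eps_mem {I : Finset (Fin (n + 1))} {w : Equiv.Perm (Fin (n + 1))}
    (hw : IsStandardPerm I w) : eps I ∈ chamber w := by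
  rw [mem_chamber_iff]
  intro i j hij
  have hij := Fin.lt_def.1 hij
  rw [coordDiff_eps]
  simp only [hw.mem_iff]
  split_ifs <;> first | omega | norm_num

/-! ### Sectors -/

theorem mem_chamber_iff_simple {σ : Equiv.Perm (Fin (n + 1))} {x : Apartment n} :
    x ∈ chamber σ ↔ ∀ i : Fin n, 0 ≤ coordDiff (σ i.castSucc) (σ i.succ) x := by
  rw [mem_chamber_iff]
  refine ⟨fun h i => h _ _ i.castSucc_lt_succ, fun h i j hij => ?_⟩
  obtain ⟨y, rfl⟩ := exists_pt x
  simp only [coordDiff_pt, sub_nonneg] at h ⊢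
  have : Antitone (y ∘ σ) := Fin.antitone_iff_succ_le.2 h
  exact this hij.le

theorem exists_intPt_coordDiff (σ : Equiv.Perm (Fin (n + 1))) (a : Fin n → ℤ) :
    ∃ z, ∀ i : Fin n, coordDiff (σ i.castSucc) (σ i.succ) (intPt z) = a i := by
  refine ⟨fun j => -Fin.partialSum a (σ⁻¹ j), fun i => ?_⟩
  have h : ∀ j, σ⁻¹ (σ j) = j := σ.symm_apply_apply
  rw [coordDiff_intPt, h, h, Fin.partialSum_succ]
  push_cast
  ring

theorem mem_sector_chamber_iff {σ : Equiv.Perm (Fin (n + 1))} {v x : Apartment n} :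
    x ∈ sector v (chamber σ) ↔ ∀ i : Fin n,
      coordDiff (σ i.castSucc) (σ i.succ) v ≤ coordDiff (σ i.castSucc) (σ i.succ) x := by
  change x - v ∈ chamber σ ↔ _
  simp only [mem_chamber_iff_simple, map_sub, sub_nonneg]

theorem isSector_sector (z : Fin (n + 1) → ℤ) (σ : Equiv.Perm (Fin (n + 1))) :
    IsSector (sector (intPt z) (chamber σ)) :=
  ⟨_, _, isVertex_intPt z, isChamber_chamber σ, rfl⟩

/-- Sectors with the same chamber are equivalent. -/
theorem sectorEquiv_sector (z w : Fin (n + 1) → ℤ) (σ : Equiv.Perm (Fin (n + 1))) :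
    SectorEquiv (sector (intPt z) (chamber σ)) (sector (intPt w) (chamber σ)) := by
  refine ⟨isSector_sector z σ, isSector_sector w σ, ?_⟩
  -- The apex of the intersection takes the larger of the two values of each simple root of the
  -- chamber.
  obtain ⟨u, hu⟩ := exists_intPt_coordDiff σ fun i =>
    max (z (σ i.castSucc) - z (σ i.succ)) (w (σ i.castSucc) - w (σ i.succ))
  have h : sector (intPt z) (chamber σ) ∩ sector (intPt w) (chamber σ) =
      sector (intPt u) (chamber σ) := by
    ext x
    rw [Set.mem_inter_iff, mem_sector_chamber_iff, mem_sector_chamber_iff, mem_sector_chamber_iff,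
      ← forall_and]
    refine forall_congr' fun i => ?_
    rw [hu]
    simp
  rw [h]
  exact isSector_sector u σ

theorem chamber_eq_sector (σ : Equiv.Perm (Fin (n + 1))) :
    chamber σ = sector (intPt 0) (chamber σ) := by
  ext x
  simp [sector, intPt_zero]

theorem isChamber_opp {C : Set (Apartment n)} (hC : IsChamber C) : IsChamber (opp C) := by
  obtain ⟨σ, rfl⟩ := isChamber_iff.1 hC
  refine isChamber_iff.2 ⟨σ * Fin.revPerm, ?_⟩
  ext x
  change -x ∈ chamber σ ↔ _
  simp only [mem_chamber_iff, Equiv.Perm.mul_apply, Fin.revPerm_apply, map_neg, ← coordDiff_swap]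
  constructor
  · exact fun h i j hij => h _ _ (Fin.rev_lt_rev.2 hij)
  · intro h i j hij
    have := h (Fin.rev j) (Fin.rev i) (Fin.rev_lt_rev.2 hij)
    rwa [Fin.rev_rev, Fin.rev_rev] at this

theorem eq_zero_of_mem_chamber {σ : Equiv.Perm (Fin (n + 1))} {x : Apartment n}
    (h : x ∈ chamber σ) (h' : -x ∈ chamber σ) : x = 0 := by
  rw [mem_chamber_iff] at h h'
  have key : ∀ i j, i < j → coordDiff (σ i) (σ j) x = 0 := by
    intro i j hij
    have h1 := h i j hij
    have h2 := h' i j hij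
    rw [map_neg] at h2
    linarith
  refine ext_coordDiff fun a b => ?_
  rw [map_zero]
  obtain ⟨i, rfl⟩ := σ.surjective a
  obtain ⟨j, rfl⟩ := σ.surjective b
  rcases lt_trichotomy i j with hij | rfl | hij
  · exact key i j hij
  · exact coordDiff_self _ _
  · rw [coordDiff_swap, key j i hij, neg_zero]

/-! ### Minimal and positively folded galleries -/

section

variable {lam : Fin n → ℕ} {I : Fin (stepList lam).length → Finset (Fin (n + 1))}

theorem exists_intPt_vert {r : ℕ} (I : Fin r → Finset (Fin (n + 1))) (k : Fin (r + 1)) :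
    ∃ z, (galleryOfSteps I).vert k = intPt z := by
  obtain ⟨z, hz, -⟩ := exists_intPt_partialSum I k
  exact ⟨z, hz⟩

theorem galleryOfSteps_vert_add {r : ℕ} (I : Fin r → Finset (Fin (n + 1))) (k : ℕ) (hk : k < r) :
    (galleryOfSteps I).vert (⟨k + 1, Nat.succ_lt_succ hk⟩ : Fin (r + 1)) =
      (galleryOfSteps I).vert (⟨k, Nat.lt_succ_of_lt hk⟩ : Fin (r + 1)) + eps (I ⟨k, hk⟩) :=
  galleryOfSteps_vert_succ I ⟨k, hk⟩

theorem HasStepSizes.isMinimal_iff (hI : HasStepSizes lam I) :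
    IsMinimal (galleryOfSteps I) ↔
      ∀ (k : ℕ) (hk : k + 1 < (stepList lam).length), I ⟨k, by omega⟩ ⊆ I ⟨k + 1, hk⟩ := by
  constructor
  · rintro ⟨S, -, h⟩ k hk
    obtain ⟨v, C, -, hC, -, h1, h2⟩ := h k hk
    change seg ((galleryOfSteps I).vert (⟨k, by omega⟩ : Fin ((stepList lam).length + 1)))
      (I ⟨k, by omega⟩) ⊆ _ at h1
    change seg ((galleryOfSteps I).vert (⟨k + 1, by omega⟩ : Fin ((stepList lam).length + 1)))
      (I ⟨k + 1, hk⟩) ⊆ _ at h2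
    rw [galleryOfSteps_vert_add I k (by omega)] at h2
    set u := (galleryOfSteps I).vert (⟨k, by omega⟩ : Fin ((stepList lam).length + 1))
    -- The base vertex of the sector is arbitrary in the definition, but the common vertex of the
    -- two edges lies in both v + C and v - C, which meet only in v.
    have hv : v = u + eps (I ⟨k, by omega⟩) := by
      obtain ⟨σ, rfl⟩ := isChamber_iff.1 hC
      exact (sub_eq_zero.1 (eq_zero_of_mem_chamber (h1 (right_mem_seg _ _))
        (h2 (left_mem_seg _ _)))).symm
    subst hv
    refine subset_of_isMinimalStep (hI.card_le (Fin.le_def.2 (Nat.le_succ k)))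
      ⟨opp C, isChamber_opp hC, h2, ?_⟩
    have : opp (opp C) = C := by
      ext x
      simp [opp]
    rwa [this]
  · intro h
    have hmono : ∀ k k' : Fin (stepList lam).length, k ≤ k' → I k ⊆ I k' := by
      rintro ⟨k, hk⟩ ⟨k', hk'⟩ hkk
      replace hkk : k ≤ k' := hkk
      induction k', hkk using Nat.le_induction with
      | base => exact subset_rfl
      | succ k' hkk ih => exact (ih (by omega)).trans (h k' hk')
    -- For a chain of sets, ordering the indices by the number of sets that contain them makes every
    -- `I k` a final segment, so one chamber contains all -`eps (I k)`.
    obtain ⟨σ, hσ⟩ := exists_chamber_of_fun fun y : Fin (n + 1) =>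
      (Finset.univ.filter fun k => y ∈ I k).card
    have hmem : ∀ k, -eps (I k) ∈ chamber σ := by
      intro k
      refine hσ _ fun i j hij => ?_
      have : i ∈ I k → j ∈ I k := by
        intro hi
        by_contra hj
        refine absurd (Finset.card_lt_card ((Finset.ssubset_iff_of_subset fun k' hk' => ?_).2
          ⟨k, ?_, ?_⟩)) (not_lt.2 hij)
        · have hk' := (Finset.mem_filter.1 hk').2
          refine Finset.mem_filter.2 ⟨Finset.mem_univ _, ?_⟩
          rcases le_total k k' with hkk | hkk
          · exact hmono _ _ hkk hi
          · exact absurd (hmono _ _ hkk hk') hj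
        · exact Finset.mem_filter.2 ⟨Finset.mem_univ _, hi⟩
        · exact fun hk => hj (Finset.mem_filter.1 hk).2
      rw [map_neg, coordDiff_eps]
      split_ifs <;> first | tauto | norm_num
    refine ⟨sector (intPt 0) (chamber σ), isSector_sector 0 σ, fun k hk => ?_⟩
    obtain ⟨z, hz⟩ := exists_intPt_vert I ⟨k + 1, by
      change k + 1 < (stepList lam).length at hk
      omega⟩
    have hk' : k + 1 < (stepList lam).length := hk
    refine ⟨intPt z, chamber σ, isVertex_intPt z, isChamber_chamber σ, sectorEquiv_sector z 0 σ,
      ?_, ?_⟩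
    · change seg ((galleryOfSteps I).vert (⟨k, by omega⟩ : Fin ((stepList lam).length + 1)))
        (I ⟨k, by omega⟩) ⊆ _
      rw [galleryOfSteps_vert_add I k (by omega)] at hz
      rintro _ ⟨t, -, h1, rfl⟩
      rw [← hz]
      have e : ∀ u e : Apartment n, u + t • e - (u + e) = (1 - t) • (-e) := fun u e => by module
      change _ - _ ∈ chamber σ
      rw [e]
      exact chamber_smul_mem (hmem _) (by linarith)
    · change seg ((galleryOfSteps I).vert (⟨k + 1, by omega⟩ : Fin ((stepList lam).length + 1)))
        (I ⟨k + 1, hk⟩) ⊆ _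
      rw [hz]
      rintro _ ⟨t, h0, -, rfl⟩
      change -(_ - _) ∈ chamber σ
      rw [add_sub_cancel_left, ← smul_neg]
      exact chamber_smul_mem (hmem _) h0

theorem HasStepSizes.isLocallyPosFolded_iff (hI : HasStepSizes lam I) :
    IsLocallyPosFolded (galleryOfSteps I) ↔
      ∀ (k : ℕ) (hk : k + 1 < (stepList lam).length) (x : Fin (n + 1)),
        countLE (I ⟨k, by omega⟩) x ≤ countLE (I ⟨k + 1, hk⟩) x := by
  refine forall₂_congr fun k hk => ?_
  have hk' : k + 1 < (stepList lam).length := hk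
  obtain ⟨z, hz⟩ := exists_intPt_vert I ⟨k + 1, by omega⟩
  change IsPosFoldedStep (seg ((galleryOfSteps I).vert
    (⟨k, by omega⟩ : Fin ((stepList lam).length + 1))) (I ⟨k, by omega⟩))
    ((galleryOfSteps I).vert (⟨k + 1, by omega⟩ : Fin ((stepList lam).length + 1)))
    (seg ((galleryOfSteps I).vert (⟨k + 1, by omega⟩ : Fin ((stepList lam).length + 1)))
      (I ⟨k + 1, hk⟩)) ↔ _
  rw [galleryOfSteps_vert_add I k (by omega)] at hz ⊢
  exact isPosFoldedStep_iff hz (hI.card_le (Fin.le_def.2 (Nat.le_succ k))) (hI.nonempty _)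
    (hI.ne_univ _)

theorem HasStepSizes.isPosFolded_iff (hn : 1 ≤ n) (hI : HasStepSizes lam I) :
    IsPosFolded (galleryOfSteps I) ↔
      ∀ (k : ℕ) (hk : k + 1 < (stepList lam).length) (x : Fin (n + 1)),
        countLE (I ⟨k, by omega⟩) x ≤ countLE (I ⟨k + 1, hk⟩) x := by
  rw [IsPosFolded, hI.isLocallyPosFolded_iff, and_iff_left_iff_imp]
  intro h
  -- The local conditions already provide the sectors, through the standard permutations of the
  -- steps.
  choose w hw using fun k => exists_isStandardPerm (I k)
  refine ⟨fun k => chamber (w k), fun k => ⟨isChamber_chamber _, ?_⟩, fun k hk => ?_⟩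
  · rintro _ ⟨t, h0, -, rfl⟩
    change (galleryOfSteps I).vert (Fin.castSucc k) + t • eps (I k) -
      (galleryOfSteps I).vert (Fin.castSucc k) ∈ chamber (w k)
    rw [add_sub_cancel_left]
    exact chamber_smul_mem (hw k).eps_mem h0
  · have hk' : k + 1 < (stepList lam).length := hk
    have hequiv : ∀ (k : Fin ((stepList lam).length + 1)) (σ : Equiv.Perm (Fin (n + 1))),
        SectorEquiv (chamber σ) (sector ((galleryOfSteps I).vert k) (chamber σ)) := by
      intro k σ
      obtain ⟨z, hz⟩ := exists_intPt_vert I k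
      have := sectorEquiv_sector 0 z σ
      rwa [← chamber_eq_sector, ← hz] at this
    refine ⟨permAct (w ⟨k, by omega⟩), mem_weylGroup_iff.2 ⟨_, rfl⟩, permAct (w ⟨k + 1, hk⟩),
      mem_weylGroup_iff.2 ⟨_, rfl⟩, hequiv ⟨k, by omega⟩ _, hequiv ⟨k + 1, by omega⟩ _,
      bruhatLE_of_rankLE hn ?_⟩
    exact (hw _).rankLE_le (hw _) (hI.card_le (Fin.le_def.2 (Nat.le_succ k))) (h k hk)

/-- Galleries and fillings are both parametrized by sequences of sets, so any two conditions that
agree on these sequences give a bijection. -/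
theorem bijOn_tableauOf (hn : 1 ≤ n) {P : Gallery n → Prop} {Q : (ℕ → ℕ → ℕ) → Prop}
    (hQ : ∀ T, Q T → IsYoungTableau lam T)
    (h : ∀ I, HasStepSizes lam I → (P (galleryOfSteps I) ↔ Q (tableauOfSteps I))) :
    Set.BijOn tableauOf {δ ∈ galleries lam | P δ} {T | Q T} := by
  have htab : ∀ I, HasStepSizes lam I → tableauOf (galleryOfSteps I) = tableauOfSteps I :=
    fun I hI => tableauOf_galleryOfSteps hI.nonempty hI.ne_univ
  refine ⟨?_, ?_, ?_⟩
  · rintro δ ⟨hδ, hP⟩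
    obtain ⟨I, hI, rfl⟩ := exists_galleryOfSteps hn hδ
    change Q _
    rw [htab I hI]
    exact (h I hI).1 hP
  · rintro δ ⟨hδ, -⟩ δ' ⟨hδ', -⟩ he
    obtain ⟨I, hI, rfl⟩ := exists_galleryOfSteps hn hδ
    obtain ⟨J, hJ, rfl⟩ := exists_galleryOfSteps hn hδ'
    rw [htab I hI, htab J hJ] at he
    rw [tableauOfSteps_injOn hI hJ he]
  · rintro T hT
    obtain ⟨I, hI, rfl⟩ := exists_tableauOfSteps (hQ T hT)
    exact ⟨_, ⟨galleryOfSteps_mem hI, (h I hI).2 hT⟩, htab I hI⟩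

end

end OneSkeleton

end

/-! ### The theorem. -/

open OneSkeleton in
theorem theorem22 (n : ℕ) (hn : 1 ≤ n) (lam : Fin n → ℕ) :
    Set.BijOn tableauOf {δ ∈ galleries lam | IsMinimal δ} {T | IsMinimalTableau lam T} ∧
    Set.BijOn tableauOf {δ ∈ galleries lam | IsPosFolded δ} {T | IsSemistandard lam T} :=
  ⟨bijOn_tableauOf hn (fun _ hT => hT.1) fun _ hI =>
      hI.isMinimal_iff.trans hI.isMinimalTableau_iff.symm,
    bijOn_tableauOf hn (fun _ hT => hT.1) fun _ hI =>
      (hI.isPosFolded_iff hn).trans hI.isSemistandard_iff.symm⟩
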